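/- Let $0<p<n$, let $V$ be an $n$-dimensional smooth manifold with a smooth pseudo-Riemannian metric $g_{ab}$ of arbitrary signature, and let $\nabla$ be its Levi-Civita connection (indices are raised and lowered with $g$). Let $q\in V$ and let $P_{ab}$ be a smooth orthogonal projector of rank $p$ on an open neighbourhood $U$ of $q$, that is, $P_{ab}=P_{ba}$, $P_{ar}P^r{}_b=P_{ab}$, $P^a{}_a=p$; put $\Pi_{ab}=g_{ab}-P_{ab}$. Define $$M_{abc}=\nabla_bP_{ac}+\nabla_cP_{ab}-\nabla_aP_{bc},\qquad E_a=M_{acb}P^{cb},\qquad W_a=-M_{acb}\Pi^{cb},$$ $$T_{abc}=M_{abc}+\frac1{n-p}W_a\Pi_{bc}-\frac1pE_aP_{bc},\qquad u_a=\frac{E_a}{2p}+\frac{W_a}{2(n-p)},$$ and assume that $T_{abc}=0$ on $U$. Consider smooth coordinate charts $(x^1,\dots,x^n)=(x^\alpha,x^A)$, $1\le\alpha\le p<A\le n$, around $q$ in which $$ds^2=\Xi_1(x)\,G_{\alpha\beta}(x^\gamma)\,dx^\alpha dx^\beta+\Xi_2(x)\,G_{AB}(x^C)\,dx^Adx^B$$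 with $C^2$ functions $\Xi_1,\Xi_2,G_{\alpha\beta},G_{AB}$, and whose two leaf metrics $\Xi_1G_{\alpha\beta}dx^\alpha dx^\beta$ and $\Xi_2G_{AB}dx^Adx^B$ are $P_{ab}$ and $\Pi_{ab}$ respectively. Then: 1. there is such a chart with $\Xi_1=\Xi_2=1$ (near $q$ the metric is reducible) if and only if $E_a=W_a=0$ in a neighbourhood of $q$; 2. there is such a chart with $\Xi_1=1$ and $\Xi_2=\Xi_2(x^\alpha)$ (warped product) if and only if, in a neighbourhood of $q$, $E_a=0$ and $W_a$ is exact; 3. there is such a chart with $\Xi_1=\Xi_1(x^A)$ and $\Xi_2=\Xi_2(x^\alpha)$ (double warped product) if and only if $E_a$ and $W_a$ are both exact in a neighbourhood of $q$; 4. there is such a chart with $\Xi_1=1$ (twisted product) if and only if $E_a=0$ in a neighbourhood of $q$; 5. there is such a chart with $\Xi_1=\Xi_2$ (conformally reducible) if and only if $u_a$ is exact in a neighbourhood of $q$. Here a 1-form is exact on an open set if it is the differential of a smooth function there. -/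

import Mathlib

open scoped Manifold ContDiff Bundle

noncomputable section

namespace BiConformal

/-! ### Classical tensor calculus in a coordinate domain of `ℝⁿ`

A covariant tensor of rank two in local coordinates is a matrix-valued function of the
coordinates; below `g` is the matrix of the metric, `P` the matrix of the projector. -/

section Coordinates

variable {n : ℕ}

/-- The coordinate space `ℝⁿ`. -/
abbrev Coord (n : ℕ) : Type := EuclideanSpace ℝ (Fin n)

/-- The components of a covariant rank-two tensor as functions of the coordinates. -/
abbrev CoordTensor (n : ℕ) : Type := Coord n → Matrix (Fin n) (Fin n) ℝ

/-- The `a`-th vector `∂_a` of the standard basis of `ℝⁿ`. -/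
def basisVec (a : Fin n) : Coord n := EuclideanSpace.single a 1

/-- The partial derivative `∂_a f` at `y`. -/
def partialDeriv (a : Fin n) (f : Coord n → ℝ) (y : Coord n) : ℝ :=
  fderiv ℝ f y (basisVec a)

/-- The Christoffel symbols
`Γ^a_{bc} = ½ g^{ar} (∂_b g_{cr} + ∂_c g_{rb} - ∂_r g_{bc})` of the metric `g`. -/
def christoffel (g : CoordTensor n) (y : Coord n) (a b c : Fin n) : ℝ :=
  (1 / 2) * ∑ r, (g y)⁻¹ a r *
    (partialDeriv b (fun z => g z c r) y + partialDeriv c (fun z => g z r b) y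
      - partialDeriv r (fun z => g z b c) y)

/-- The Levi-Civita covariant derivative
`∇_b P_{ac} = ∂_b P_{ac} - Γ^r_{ba} P_{rc} - Γ^r_{bc} P_{ar}`. -/
def covDeriv (g P : CoordTensor n) (y : Coord n) (b a c : Fin n) : ℝ :=
  partialDeriv b (fun z => P z a c) y
    - ∑ r, christoffel g y r b a * P y r c - ∑ r, christoffel g y r b c * P y a r

/-- `M_{abc} = ∇_b P_{ac} + ∇_c P_{ab} - ∇_a P_{bc}`. -/
def coordM (g P : CoordTensor n) (y : Coord n) (a b c : Fin n) : ℝ :=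
  covDeriv g P y b a c + covDeriv g P y c a b - covDeriv g P y a b c

/-- Both indices raised with the metric: `P^{ab} = g^{ar} P_{rs} g^{sb}`. -/
def raised (g P : CoordTensor n) (y : Coord n) : Matrix (Fin n) (Fin n) ℝ :=
  (g y)⁻¹ * P y * (g y)⁻¹

/-- `E_a = M_{acb} P^{cb}`. -/
def coordE (g P : CoordTensor n) (y : Coord n) (a : Fin n) : ℝ :=
  ∑ c, ∑ b, coordM g P y a c b * raised g P y c b

/-- `W_a = - M_{acb} Π^{cb}`, where `Π = g - P`. -/
def coordW (g P : CoordTensor n) (y : Coord n) (a : Fin n) : ℝ :=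
  - ∑ c, ∑ b, coordM g P y a c b * raised g (g - P) y c b

/-- `T_{abc} = M_{abc} + W_a Π_{bc} / (n - p) - E_a P_{bc} / p`, where `Π = g - P`. -/
def coordT (p : ℕ) (g P : CoordTensor n) (y : Coord n) (a b c : Fin n) : ℝ :=
  coordM g P y a b c + 1 / ((n : ℝ) - p) * coordW g P y a * (g y - P y) b c
    - 1 / (p : ℝ) * coordE g P y a * P y b c

/-- On the domain `D` the function `f` depends only on the first `p` coordinates `x^α`. -/
def DependsOnFirst (p : ℕ) (D : Set (Coord n)) (f : Coord n → ℝ) : Prop :=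
  ∀ y ∈ D, ∀ z ∈ D, (∀ i : Fin n, i.val < p → y i = z i) → f y = f z

/-- On the domain `D` the function `f` depends only on the last `n - p` coordinates `x^A`. -/
def DependsOnLast (p : ℕ) (D : Set (Coord n)) (f : Coord n → ℝ) : Prop :=
  ∀ y ∈ D, ∀ z ∈ D, (∀ i : Fin n, p ≤ i.val → y i = z i) → f y = f z

end Coordinates

/-! ### Tensors on a smooth manifold -/

section Manifold

variable {n : ℕ} {V : Type*} [TopologicalSpace V] [ChartedSpace (Coord n) V]

variable (n V) in
/-- A field of bilinear forms on the tangent spaces of `V` (a covariant rank-two tensor). -/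
abbrev BilinField : Type _ :=
  ∀ x : V, TangentSpace (𝓡 n) x →L[ℝ] TangentSpace (𝓡 n) x →L[ℝ] ℝ

/-- The tensor field `P` is of class `C^∞` on the set `U`. -/
def SmoothOn [IsManifold (𝓡 n) ∞ V] (P : BilinField n V) (U : Set V) : Prop :=
  ContMDiffOn (𝓡 n) ((𝓡 n).prod 𝓘(ℝ, Coord n →L[ℝ] Coord n →L[ℝ] ℝ)) ∞
    (fun x => Bundle.TotalSpace.mk' (Coord n →L[ℝ] Coord n →L[ℝ] ℝ)
      (E := fun x : V => TangentSpace (𝓡 n) x →L[ℝ] TangentSpace (𝓡 n) x →L[ℝ] ℝ) x (P x)) U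

variable (n V) in
/-- A smooth pseudo-Riemannian metric, of arbitrary signature. -/
structure PseudoMetric [IsManifold (𝓡 n) ∞ V] where
  form : BilinField n V
  symm : ∀ x u v, form x u v = form x v u
  nondegenerate : ∀ x u, (∀ v, form x u v = 0) → u = 0
  smooth : SmoothOn form Set.univ

/-- The components `P_{ij} = P(∂_i, ∂_j)` of a tensor in the chart `e`, as functions of the
coordinates; the coordinate vectors `∂_i` are the images of the standard basis vectors under the
differential of `e⁻¹`. -/
def components (e : OpenPartialHomeomorph V (Coord n)) (P : BilinField n V) : CoordTensor n :=
  fun y => Matrix.of fun i j =>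
    P (e.symm y) (mfderiv (𝓡 n) (𝓡 n) e.symm y (basisVec i))
      (mfderiv (𝓡 n) (𝓡 n) e.symm y (basisVec j))

/-- The 1-form `η_a dx^a` at the point `x`, where `x^a` are the coordinates of the chart `e`. -/
def covectorOf (e : OpenPartialHomeomorph V (Coord n)) (x : V) (η : Fin n → ℝ) :
    TangentSpace (𝓡 n) x →L[ℝ] ℝ :=
  ∑ a, η a • (EuclideanSpace.proj a : Coord n →L[ℝ] ℝ).comp (mfderiv (𝓡 n) (𝓡 n) e x)

variable [IsManifold (𝓡 n) ∞ V]

/-- On `U`, `P_{ab}` is a smooth orthogonal projector of rank `p` for the metric `g`: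
`P_{ab} = P_{ba}`, `P_{ar} P^r_b = P_{ab}` and `P^a_a = p`. The complementary
projector is `Π_{ab} = g_{ab} - P_{ab}`. The pointwise identities are written with the components
in the preferred chart at each point. -/
structure IsOrthogonalProjector (g : PseudoMetric n V) (P : BilinField n V) (p : ℕ)
    (U : Set V) : Prop where
  smooth : SmoothOn P U
  symm : ∀ x ∈ U, ∀ u v, P x u v = P x v u
  idem : ∀ x ∈ U,
    components (chartAt (Coord n) x) P (chartAt (Coord n) x x)
      * (components (chartAt (Coord n) x) g.form (chartAt (Coord n) x x))⁻¹
      * components (chartAt (Coord n) x) P (chartAt (Coord n) x x)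
      = components (chartAt (Coord n) x) P (chartAt (Coord n) x x)
  trace_eq : ∀ x ∈ U,
    Matrix.trace ((components (chartAt (Coord n) x) g.form (chartAt (Coord n) x x))⁻¹
      * components (chartAt (Coord n) x) P (chartAt (Coord n) x x)) = p

/-- The components at `x`, in the preferred chart at `x`, of the tensor `T_{abc}` built from the
metric `g` and the projector `P` of rank `p`. -/
def tensorT (g : PseudoMetric n V) (P : BilinField n V) (p : ℕ) (x : V) (a b c : Fin n) : ℝ :=
  coordT p (components (chartAt (Coord n) x) g.form) (components (chartAt (Coord n) x) P)
    (chartAt (Coord n) x x) a b c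

/-- The 1-form `E_a` at the point `x`. -/
def formE (g : PseudoMetric n V) (P : BilinField n V) (x : V) : TangentSpace (𝓡 n) x →L[ℝ] ℝ :=
  covectorOf (chartAt (Coord n) x) x
    (coordE (components (chartAt (Coord n) x) g.form) (components (chartAt (Coord n) x) P)
      (chartAt (Coord n) x x))

/-- The 1-form `W_a` at the point `x`. -/
def formW (g : PseudoMetric n V) (P : BilinField n V) (x : V) : TangentSpace (𝓡 n) x →L[ℝ] ℝ :=
  covectorOf (chartAt (Coord n) x) x
    (coordW (components (chartAt (Coord n) x) g.form) (components (chartAt (Coord n) x) P)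
      (chartAt (Coord n) x x))

/-- The 1-form `u_a = E_a / (2p) + W_a / (2(n-p))` at the point `x`. -/
def formU (g : PseudoMetric n V) (P : BilinField n V) (p : ℕ) (x : V) :
    TangentSpace (𝓡 n) x →L[ℝ] ℝ :=
  (1 / (2 * (p : ℝ))) • formE g P x + (1 / (2 * ((n : ℝ) - p))) • formW g P x

/-- The 1-form `η` vanishes in a neighbourhood of `q`. -/
def VanishesNear (q : V) (η : ∀ x : V, TangentSpace (𝓡 n) x →L[ℝ] ℝ) : Prop :=
  ∃ N : Set V, IsOpen N ∧ q ∈ N ∧ ∀ x ∈ N, η x = 0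

/-- The 1-form `η` is exact in a neighbourhood of `q`: there it is the differential of a smooth
function. -/
def ExactNear (q : V) (η : ∀ x : V, TangentSpace (𝓡 n) x →L[ℝ] ℝ) : Prop :=
  ∃ N : Set V, IsOpen N ∧ q ∈ N ∧ ∃ f : V → ℝ, ContMDiffOn (𝓡 n) 𝓘(ℝ) ∞ f N ∧
    ∀ x ∈ N, η x = mvfderiv (𝓡 n) f x

/-- In the smooth chart `e`, with coordinates `x^α` (the first `p`) and `x^A` (the others), the
metric is `Ξ₁(x) G_{αβ}(x^γ) dx^α dx^β + Ξ₂(x) G_{AB}(x^C) dx^A dx^B`, and the leaf metrics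
`Ξ₁ G_{αβ}` and `Ξ₂ G_{AB}` are `P` and `Π = g - P`. The functions `Ξ₁`, `Ξ₂` and `G` are `C²`. -/
structure IsSeparation (g : PseudoMetric n V) (P : BilinField n V) (p : ℕ)
    (e : OpenPartialHomeomorph V (Coord n)) (Ξ₁ Ξ₂ : Coord n → ℝ) (G : CoordTensor n) : Prop where
  mem_atlas : e ∈ IsManifold.maximalAtlas (𝓡 n) ∞ V
  contDiff_fst : ContDiffOn ℝ 2 Ξ₁ e.target
  contDiff_snd : ContDiffOn ℝ 2 Ξ₂ e.target
  block_fst : ∀ i j : Fin n, i.val < p → j.val < p →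
    ContDiffOn ℝ 2 (fun y => G y i j) e.target ∧ DependsOnFirst p e.target (fun y => G y i j)
  block_snd : ∀ i j : Fin n, p ≤ i.val → p ≤ j.val →
    ContDiffOn ℝ 2 (fun y => G y i j) e.target ∧ DependsOnLast p e.target (fun y => G y i j)
  metric_eq : ∀ y ∈ e.target, ∀ i j : Fin n, components e g.form y i j =
    if i.val < p ∧ j.val < p then Ξ₁ y * G y i j
    else if p ≤ i.val ∧ p ≤ j.val then Ξ₂ y * G y i j
    else 0
  leaf_eq : ∀ y ∈ e.target, ∀ i j : Fin n, components e P y i j =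
    if i.val < p ∧ j.val < p then Ξ₁ y * G y i j else 0

/-- Near `q` the metric is decomposable (reducible), with leaf metrics `P` and `Π`:
`ds² = G_{αβ}(x^ε) dx^α dx^β + G_{AB}(x^C) dx^A dx^B`. -/
def IsReducibleAt (g : PseudoMetric n V) (P : BilinField n V) (p : ℕ) (q : V) : Prop :=
  ∃ e Ξ₁ Ξ₂ G, q ∈ e.source ∧ IsSeparation g P p e Ξ₁ Ξ₂ G ∧
    (∀ y ∈ e.target, Ξ₁ y = 1) ∧ (∀ y ∈ e.target, Ξ₂ y = 1)

/-- Near `q` the metric is a warped product, with leaf metrics `P` and `Π`: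
`ds² = G_{αβ}(x^ε) dx^α dx^β + Ξ(x^ε) G_{AB}(x^C) dx^A dx^B`. -/
def IsWarpedAt (g : PseudoMetric n V) (P : BilinField n V) (p : ℕ) (q : V) : Prop :=
  ∃ e Ξ₁ Ξ₂ G, q ∈ e.source ∧ IsSeparation g P p e Ξ₁ Ξ₂ G ∧
    (∀ y ∈ e.target, Ξ₁ y = 1) ∧ DependsOnFirst p e.target Ξ₂

/-- Near `q` the metric is a double warped product, with leaf metrics `P` and `Π`:
`ds² = Ξ₁(x^C) G_{αβ}(x^ε) dx^α dx^β + Ξ₂(x^ε) G_{AB}(x^C) dx^A dx^B`. -/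
def IsDoubleWarpedAt (g : PseudoMetric n V) (P : BilinField n V) (p : ℕ) (q : V) : Prop :=
  ∃ e Ξ₁ Ξ₂ G, q ∈ e.source ∧ IsSeparation g P p e Ξ₁ Ξ₂ G ∧
    DependsOnLast p e.target Ξ₁ ∧ DependsOnFirst p e.target Ξ₂

/-- Near `q` the metric is a twisted product, with leaf metrics `P` and `Π`:
`ds² = G_{αβ}(x^ε) dx^α dx^β + Ξ₂(x) G_{AB}(x^C) dx^A dx^B`. -/
def IsTwistedAt (g : PseudoMetric n V) (P : BilinField n V) (p : ℕ) (q : V) : Prop :=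
  ∃ e Ξ₁ Ξ₂ G, q ∈ e.source ∧ IsSeparation g P p e Ξ₁ Ξ₂ G ∧
    (∀ y ∈ e.target, Ξ₁ y = 1)

/-- Near `q` the metric is conformally reducible, with leaf metrics `P` and `Π`:
`ds² = Ξ(x) (G_{αβ}(x^ε) dx^α dx^β + G_{AB}(x^C) dx^A dx^B)`. -/
def IsConformallyReducibleAt (g : PseudoMetric n V) (P : BilinField n V) (p : ℕ) (q : V) : Prop :=
  ∃ e Ξ₁ Ξ₂ G, q ∈ e.source ∧ IsSeparation g P p e Ξ₁ Ξ₂ G ∧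
    (∀ y ∈ e.target, Ξ₁ y = Ξ₂ y)

end Manifold

end BiConformal

end

/-!
The five statements reduce to one local normal form. Write `A = g⁻¹ P` for the projector, `K_S` for
the first-kind Christoffel expression `K_S(u; v, w) = D_v S(u, w) + D_w S(u, v) - D_u S(v, w)` of a
symmetric tensor `S`, and read everything in a chart. The Christoffel symbols of `g` enter `M` only
through `M(u; v, w) = K_P(u; v, w) - K_g(A u; v, w)` (`coordM_eq`), so that `T = 0` becomes the
first-order identity `SeparationIdentity`. Under a change of coordinates the second derivatives
contribute `2 P(u, ·)` to `K_P` and `2 g(A u, ·)` to `K_g`, which cancel; hence the identity holds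
in every chart (`separationIdentity_pull`).

Its mixed components say that the range and the kernel of `A` are involutive
(`involutive_of_separationIdentity`). Both distributions are therefore integrable, and there are
charts in which the leaves are coordinate slices (`exists_adapted_coordinates`,
`exists_adapted_chart`). The Frobenius theorem needed here is obtained as follows: `A` is replaced
by a projector `C` with the same range whose kernel is constant; the equation `y' = C(y) v` is
solved, with smooth dependence on `v` and on the initial value, by the inverse function theorem in
a space of continuous paths; and the endpoints of the paths sweep out the leaves, because
involutivity makes `t ↦ t C(y(t)) w` solve the linearised equation.

In an adapted chart the remaining components of the identity say that `E_α = 0`, `W_A = 0`,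
`∂_A P_{αβ} = - E_A P_{αβ} / p` and `∂_α Π_{AB} = - W_α Π_{AB} / (n - p)`
(`umbilical_of_separationIdentity`). So functions `Ξ₁`, `Ξ₂` without zeros are the conformal
factors of a separation in this chart if and only if `∂_A Ξ₁ = - E_A Ξ₁ / p` and
`∂_α Ξ₂ = - W_α Ξ₂ / (n - p)` (`IsSeparation.fderiv_fst`, `IsSeparation.fderiv_snd`,
`exists_isSeparation`). From left to right, `E`, `W` and `u` have the potentials `- p log |Ξ₁|`,
`- (n - p) log |Ξ₂|` and `- log |Ξ| / 2`; these are smooth, although the factors are only `C²`,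
because their differentials are smooth. From right to left, the factors are constants,
exponentials of the potentials, or, for a twisted product, a component of `Π` without zeros.
-/

noncomputable section

namespace BiConformal

/-! ### Smooth local inverses and smooth cutoffs -/

section LocalInverse

variable {E F : Type*} [NormedAddCommGroup E] [NormedSpace ℝ E] [NormedAddCommGroup F]
  [NormedSpace ℝ F]

/-- The inverse function theorem with an inverse that is `C^∞` on a whole neighbourhood: for
`n = ∞`, `ContDiffAt` at the centre alone would give a neighbourhood depending on the order of
differentiation, so the source is shrunk to the points where the derivative is invertible. -/
theorem exists_smooth_localInverse [CompleteSpace E] {f : E → F} {U : Set E} (hU : IsOpen U)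
    (hf : ContDiffOn ℝ ∞ f U) {a : E} (ha : a ∈ U) (f' : E ≃L[ℝ] F)
    (hf' : HasFDerivAt f (f' : E →L[ℝ] F) a) :
    ∃ e : OpenPartialHomeomorph E F, a ∈ e.source ∧ e.source ⊆ U ∧ (⇑e = f) ∧
      ContDiffOn ℝ ∞ e.symm e.target ∧
      ∀ x ∈ e.source, ∃ L : E ≃L[ℝ] F, HasFDerivAt f (L : E →L[ℝ] F) x := by
  have hfa : ContDiffAt ℝ ∞ f a := hf.contDiffAt (hU.mem_nhds ha)
  have hne : (∞ : ℕ∞ω) ≠ 0 := by simp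
  set R : Set (E →L[ℝ] F) := Set.range ContinuousLinearEquiv.toContinuousLinearMap with hR
  have hRo : IsOpen R := ContinuousLinearEquiv.isOpen
  have hS : IsOpen (U ∩ fderiv ℝ f ⁻¹' R) :=
    (hf.continuousOn_fderiv_of_isOpen hU (by simp)).isOpen_inter_preimage hU hRo
  set e₀ := hfa.toOpenPartialHomeomorph f hf' hne
  have hdiff : ∀ x ∈ U ∩ fderiv ℝ f ⁻¹' R, ∃ L : E ≃L[ℝ] F,
      HasFDerivAt f (L : E →L[ℝ] F) x := by
    rintro x ⟨hxU, L, hL⟩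
    refine ⟨L, ?_⟩
    rw [show (L : E →L[ℝ] F) = fderiv ℝ f x from hL]
    exact ((hf.contDiffAt (hU.mem_nhds hxU)).differentiableAt hne).hasFDerivAt
  refine ⟨e₀.restrOpen _ hS, ?_, ?_, rfl, ?_, ?_⟩
  · refine ⟨hfa.mem_toOpenPartialHomeomorph_source hf' hne, ha, ?_⟩
    exact ⟨f', hf'.fderiv.symm⟩
  · exact fun x hx => hx.2.1
  · intro y hy
    have hx := (e₀.restrOpen _ hS).map_target hy
    obtain ⟨L, hL⟩ := hdiff _ hx.2
    exact ((e₀.restrOpen _ hS).contDiffAt_symm hy hL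
      (hf.contDiffAt (hU.mem_nhds hx.2.1))).contDiffWithinAt
  · exact fun x hx => hdiff x hx.2

/-- A smooth map on an open set agrees near each point with a globally smooth one; this allows the
operators on path spaces to be defined on the whole space. -/
theorem exists_contDiff_eqOn_nhds [FiniteDimensional ℝ E] {f : E → F} {U : Set E}
    (hU : IsOpen U) (hf : ContDiffOn ℝ ∞ f U) {a : E} (ha : a ∈ U) :
    ∃ (f₁ : E → F) (N : Set E), IsOpen N ∧ a ∈ N ∧ N ⊆ U ∧ ContDiff ℝ ∞ f₁ ∧
      Set.EqOn f₁ f N := by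
  obtain ⟨r, hr, hrU⟩ := Metric.isOpen_iff.1 hU a ha
  let χ : ContDiffBump a := ⟨r / 4, r / 2, by positivity, by linarith⟩
  refine ⟨fun x => χ x • f x, Metric.ball a (r / 4), Metric.isOpen_ball,
    Metric.mem_ball_self (by positivity), ?_, ?_, ?_⟩
  · exact (Metric.ball_subset_ball (by linarith)).trans hrU
  · rw [contDiff_iff_contDiffAt]
    intro x
    by_cases hx : x ∈ U
    · exact χ.contDiffAt.smul (hf.contDiffAt (hU.mem_nhds hx))
    · have hx' : x ∉ tsupport χ := by
        rw [χ.tsupport_eq]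
        intro h
        apply hx (hrU (lt_of_le_of_lt (Metric.mem_closedBall.1 h) _))
        simp only [χ]; linarith
      have h0 : (fun x => χ x • f x) =ᶠ[nhds x] fun _ => 0 := by
        filter_upwards [notMem_tsupport_iff_eventuallyEq.1 hx'] with y hy
        simp [hy]
      exact contDiffAt_const.congr_of_eventuallyEq h0
  · intro x hx
    simp [χ.one_of_mem_closedBall (Metric.ball_subset_closedBall hx)]

end LocalInverse

/-! ### Calculus in spaces of continuous paths -/

section Nemytskii

universe u

variable {K : Type*} [TopologicalSpace K] [CompactSpace K]

/-- The bilinear map `(δ, γ) ↦ (s ↦ B (δ s) (γ s))` on continuous paths. -/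
def pathBilin {G E F : Type*} [NormedAddCommGroup G] [NormedSpace ℝ G]
    [NormedAddCommGroup E] [NormedSpace ℝ E] [NormedAddCommGroup F] [NormedSpace ℝ F]
    (B : G →L[ℝ] E →L[ℝ] F) : C(K, G) →L[ℝ] C(K, E) →L[ℝ] C(K, F) :=
  LinearMap.mkContinuous₂
    (LinearMap.mk₂ ℝ (fun (T : C(K, G)) (γ : C(K, E)) =>
        (⟨fun s => B (T s) (γ s), (B.continuous.comp T.continuous).clm_apply γ.continuous⟩ :
          C(K, F)))
      (fun _ _ _ => by ext; simp) (fun _ _ _ => by ext; simp)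
      (fun _ _ _ => by ext; simp) (fun _ _ _ => by ext; simp)) ‖B‖ (by
    intro T γ
    refine (ContinuousMap.norm_le _ (by positivity)).2 fun s => ?_
    refine (B.le_opNorm₂ _ _).trans ?_
    gcongr
    · exact T.norm_coe_le_norm s
    · exact γ.norm_coe_le_norm s)

@[simp] theorem pathBilin_apply {G E F : Type*} [NormedAddCommGroup G] [NormedSpace ℝ G]
    [NormedAddCommGroup E] [NormedSpace ℝ E] [NormedAddCommGroup F] [NormedSpace ℝ F]
    (B : G →L[ℝ] E →L[ℝ] F) (T : C(K, G)) (γ : C(K, E)) (s : K) :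
    pathBilin B T γ s = B (T s) (γ s) := rfl

/-- Pointwise application `(T, γ) ↦ (s ↦ T s (γ s))` of continuous families of operators. -/
def pathApply (K : Type*) [TopologicalSpace K] [CompactSpace K] (E F : Type*)
    [NormedAddCommGroup E] [NormedSpace ℝ E] [NormedAddCommGroup F] [NormedSpace ℝ F] :
    C(K, E →L[ℝ] F) →L[ℝ] C(K, E) →L[ℝ] C(K, F) :=
  pathBilin (ContinuousLinearMap.id ℝ (E →L[ℝ] F))

@[simp] theorem pathApply_apply {E F : Type*}
    [NormedAddCommGroup E] [NormedSpace ℝ E] [NormedAddCommGroup F] [NormedSpace ℝ F]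
    (T : C(K, E →L[ℝ] F)) (γ : C(K, E)) (s : K) : pathApply K E F T γ s = T s (γ s) := rfl

/-- The superposition (Nemytskii) operator `γ ↦ f ∘ γ` on continuous paths. -/
def superposition {K : Type*} [TopologicalSpace K] {E F : Type*} [TopologicalSpace E]
    [TopologicalSpace F] (f : E → F) (hf : Continuous f) (γ : C(K, E)) : C(K, F) :=
  (⟨f, hf⟩ : C(E, F)).comp γ

@[simp] theorem superposition_apply {K : Type*} [TopologicalSpace K] {E F : Type*}
    [TopologicalSpace E] [TopologicalSpace F] (f : E → F) (hf : Continuous f) (γ : C(K, E))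
    (s : K) : superposition f hf γ s = f (γ s) := rfl

/-- The derivative of `γ ↦ f ∘ γ` is pointwise application of `f' ∘ γ`; the remainder is uniform
in the parameter because `f'` is uniformly continuous along the compact image of `γ`. -/
theorem hasFDerivAt_superposition {E F : Type*} [NormedAddCommGroup E] [NormedSpace ℝ E]
    [NormedAddCommGroup F] [NormedSpace ℝ F] {f : E → F} {f' : E → E →L[ℝ] F}
    (hf : ∀ x, HasFDerivAt f (f' x) x) (hc : Continuous f) (hc' : Continuous f') (γ : C(K, E)) :
    HasFDerivAt (superposition f hc : C(K, E) → C(K, F))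
      (pathApply K E F (superposition f' hc' γ)) γ := by
  rw [hasFDerivAt_iff_isLittleO_nhds_zero, Asymptotics.isLittleO_iff]
  intro ε hε
  have hK : IsCompact (Set.range γ) := isCompact_range γ.continuous
  have hunif := hK.uniformContinuousAt_of_continuousAt f' (fun a _ => hc'.continuousAt)
    (Metric.dist_mem_uniformity hε)
  obtain ⟨δ, hδ, hδε⟩ := Metric.mem_uniformity_dist.1 hunif
  filter_upwards [Metric.ball_mem_nhds (0 : C(K, E)) hδ] with h hh
  have hh' : ‖h‖ < δ := by simpa using hh
  refine (ContinuousMap.norm_le _ (by positivity)).2 fun s => ?_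
  have hs : ‖h s‖ ≤ ‖h‖ := h.norm_coe_le_norm s
  have key := Convex.norm_image_sub_le_of_norm_hasFDerivWithin_le' (f := f) (f' := f')
    (φ := f' (γ s)) (s := Metric.ball (γ s) δ) (x := γ s) (y := γ s + h s) (C := ε)
    (fun x _ => (hf x).hasFDerivWithinAt) (fun x hx => by
      have := @hδε (γ s) x (by rw [dist_comm]; exact hx) (Set.mem_range_self s)
      rw [← dist_eq_norm, dist_comm]
      exact le_of_lt this)
    (convex_ball _ _) (Metric.mem_ball_self hδ) (by simpa using hs.trans_lt hh')
  simp only [add_sub_cancel_left] at key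
  exact key.trans (mul_le_mul_of_nonneg_left hs hε.le)

set_option synthInstance.maxHeartbeats 200000 in
/-- Induction on the order, over all targets at once: the derivative is a superposition operator
with values in the operators `E →L[ℝ] F`, which is why `E` and `F` share a universe. -/
theorem contDiff_superposition_nat {E : Type u} [NormedAddCommGroup E] [NormedSpace ℝ E] (m : ℕ) :
    ∀ {F : Type u} [NormedAddCommGroup F] [NormedSpace ℝ F] {f : E → F} (hc : Continuous f),
      ContDiff ℝ ∞ f → ContDiff ℝ m (superposition f hc : C(K, E) → C(K, F)) := by
  induction m with
  | zero =>
    intro F _ _ f hc _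
    exact contDiff_zero.2 (ContinuousMap.continuous_postcomp _)
  | succ m ih =>
    intro F _ _ f hc hf
    have hf' : ContDiff ℝ ∞ (fderiv ℝ f) := hf.fderiv_right (by simp)
    rw [Nat.cast_succ, contDiff_succ_iff_hasFDerivAt]
    refine ⟨fun γ => pathApply K E F (superposition (fderiv ℝ f) hf'.continuous γ),
      ?_, fun γ => ?_⟩
    · have h : ContDiff ℝ m fun T => pathApply K E F T := ContinuousLinearMap.contDiff _
      exact h.comp (ih hf'.continuous hf')
    · exact hasFDerivAt_superposition
        (fun x => (hf.differentiable (by simp) x).hasFDerivAt) hc hf'.continuous γ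

theorem contDiff_superposition {E F : Type u} [NormedAddCommGroup E] [NormedSpace ℝ E]
    [NormedAddCommGroup F] [NormedSpace ℝ F] {f : E → F} (hf : ContDiff ℝ ∞ f) :
    ContDiff ℝ ∞ (superposition f hf.continuous : C(K, E) → C(K, F)) :=
  contDiff_infty.2 fun m => contDiff_superposition_nat m hf.continuous hf

end Nemytskii

section Volterra

variable {E : Type*} [NormedAddCommGroup E] [NormedSpace ℝ E]

/-- The primitive `t ↦ ∫₀ᵗ γ` of a path on the unit interval that vanishes at `0`. -/
def volterra (E : Type*) [NormedAddCommGroup E] [NormedSpace ℝ E] :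
    C(unitInterval, E) →L[ℝ] C(unitInterval, E) :=
  LinearMap.mkContinuous
    { toFun := fun γ => ⟨fun t => ∫ s in (0 : ℝ)..t, Set.IccExtend zero_le_one γ s, by
        have h : Continuous (Set.IccExtend (zero_le_one' ℝ) γ) := γ.continuous.Icc_extend'
        exact (intervalIntegral.continuous_primitive
          (fun a b => h.intervalIntegrable a b) 0).comp continuous_subtype_val⟩
      map_add' := fun γ δ => by
        ext t
        have h : ∀ γ : C(unitInterval, E), Continuous (Set.IccExtend (zero_le_one' ℝ) γ) :=
          fun γ => γ.continuous.Icc_extend'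
        exact intervalIntegral.integral_add ((h γ).intervalIntegrable _ _)
          ((h δ).intervalIntegrable _ _)
      map_smul' := fun c γ => by
        ext t
        exact intervalIntegral.integral_smul c _ } 1 (by
    intro γ
    refine (ContinuousMap.norm_le _ (by positivity)).2 fun t => ?_
    have := intervalIntegral.norm_integral_le_of_norm_le_const (a := (0 : ℝ)) (b := t)
      (f := Set.IccExtend (zero_le_one' ℝ) γ) (C := ‖γ‖) (fun s _ => γ.norm_coe_le_norm _)
    refine this.trans ?_
    rw [sub_zero, abs_of_nonneg t.2.1, mul_comm]
    exact mul_le_mul_of_nonneg_right t.2.2 (norm_nonneg _))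

theorem volterra_apply (γ : C(unitInterval, E)) (t : unitInterval) :
    volterra E γ t = ∫ s in (0 : ℝ)..t, Set.IccExtend (zero_le_one' ℝ) γ s := rfl

theorem hasDerivAt_volterra [CompleteSpace E] (γ : C(unitInterval, E)) (t : ℝ) :
    HasDerivAt (fun t : ℝ => ∫ s in (0 : ℝ)..t, Set.IccExtend (zero_le_one' ℝ) γ s)
      (Set.IccExtend (zero_le_one' ℝ) γ t) t := by
  have h : Continuous (Set.IccExtend (zero_le_one' ℝ) γ) := γ.continuous.Icc_extend'
  exact intervalIntegral.integral_hasDerivAt_right (h.intervalIntegrable _ _)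
    (h.stronglyMeasurableAtFilter _ _) h.continuousAt

/-- A path is the primitive of its derivative, in terms of the Volterra operator. -/
theorem volterra_eq_of_hasDerivAt [CompleteSpace E] (γ : C(unitInterval, E)) (ξ : ℝ → E)
    (h0 : ξ 0 = 0)
    (hξ : ∀ t : unitInterval, HasDerivWithinAt ξ (γ t) (Set.Icc 0 1) t) (t : unitInterval) :
    volterra E γ t = ξ t := by
  have h : Continuous (Set.IccExtend (zero_le_one' ℝ) γ) := γ.continuous.Icc_extend'
  rw [volterra_apply, intervalIntegral.integral_eq_sub_of_hasDeriv_right_of_le t.2.1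
    (f := ξ) (f' := Set.IccExtend (zero_le_one' ℝ) γ), h0, sub_zero]
  · intro s hs
    exact ((hξ ⟨s, hs.1, hs.2.trans t.2.2⟩).continuousWithinAt).mono
      (Set.Icc_subset_Icc_right t.2.2)
  · intro s hs
    have hs' : s ∈ Set.Icc (0 : ℝ) 1 := ⟨hs.1.le, hs.2.le.trans t.2.2⟩
    rw [Set.IccExtend_of_mem _ _ hs']
    refine ((hξ ⟨s, hs'⟩).hasDerivAt ?_).hasDerivWithinAt
    exact Icc_mem_nhds hs.1 (hs.2.trans_le t.2.2)
  · exact h.intervalIntegrable _ _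

end Volterra

/-! ### The Frobenius theorem for fields of projectors -/

section Flow

universe u

variable {E : Type u} [NormedAddCommGroup E] [NormedSpace ℝ E]

/-- The constant path, as a continuous linear map. -/
def constPath (E : Type*) [NormedAddCommGroup E] [NormedSpace ℝ E] :
    E →L[ℝ] C(unitInterval, E) :=
  LinearMap.mkContinuous
    { toFun := fun v => ContinuousMap.const _ v
      map_add' := fun _ _ => rfl
      map_smul' := fun _ _ => rfl } 1 (by
    intro v
    refine (ContinuousMap.norm_le _ (by positivity)).2 fun s => ?_
    rw [one_mul]
    exact le_refl ‖v‖)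

@[simp] theorem constPath_apply (v : E) (t : unitInterval) : constPath E v t = v := rfl

/-- The map whose zeros `(v, z, γ)` in the second component are the integral curves `γ` on `[0, 1]`
of `y' = C(y) v` starting at `z`; the parameters `(v, z)` are carried along in the first
component. -/
def flowMap (C : E → E →L[ℝ] E) (hC : Continuous C) (x : (E × E) × C(unitInterval, E)) :
    (E × E) × C(unitInterval, E) :=
  (x.1, x.2 - constPath E x.1.2
    - volterra E (pathApply unitInterval E E (superposition C hC x.2) (constPath E x.1.1)))

theorem contDiff_flowMap {C : E → E →L[ℝ] E} (hC : ContDiff ℝ ∞ C) :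
    ContDiff ℝ ∞ (flowMap C hC.continuous) := by
  have h1 : ContDiff ℝ ∞ fun x : (E × E) × C(unitInterval, E) =>
      superposition C hC.continuous x.2 := (contDiff_superposition hC).comp contDiff_snd
  have h2 : ContDiff ℝ ∞ fun T => pathApply unitInterval E E T := ContinuousLinearMap.contDiff _
  have h3 : ContDiff ℝ ∞ fun x : (E × E) × C(unitInterval, E) => constPath E x.1.1 :=
    (constPath E).contDiff.comp (contDiff_fst.comp contDiff_fst)
  have h4 : ContDiff ℝ ∞ fun x : (E × E) × C(unitInterval, E) => constPath E x.1.2 :=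
    (constPath E).contDiff.comp (contDiff_snd.comp contDiff_fst)
  have h5 := (h2.comp h1).clm_apply h3
  exact contDiff_fst.prodMk ((contDiff_snd.sub h4).sub ((volterra E).contDiff.comp h5))

set_option synthInstance.maxHeartbeats 200000 in
/-- The linearisation of `flowMap`. -/
theorem fderiv_flowMap_apply {C : E → E →L[ℝ] E} (hC : ContDiff ℝ ∞ C)
    (hC' : Continuous (fderiv ℝ C)) (x y : (E × E) × C(unitInterval, E)) :
    fderiv ℝ (flowMap C hC.continuous) x y =
      (y.1, y.2 - constPath E y.1.2
        - volterra E (pathApply unitInterval E E (superposition C hC.continuous x.2)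
            (constPath E y.1.1) +
          pathApply unitInterval E E (pathApply unitInterval E (E →L[ℝ] E)
            (superposition (fderiv ℝ C) hC' x.2) y.2) (constPath E x.1.1))) := by
  have hd : ∀ y, HasFDerivAt C (fderiv ℝ C y) y :=
    fun y => (hC.differentiable (by simp) y).hasFDerivAt
  have h1 := (hasFDerivAt_superposition (K := unitInterval) hd hC.continuous hC' x.2).comp x
    hasFDerivAt_snd
  have h3 : HasFDerivAt (fun x : (E × E) × C(unitInterval, E) => constPath E x.1.1)
      ((constPath E).comp ((ContinuousLinearMap.fst ℝ E E).comp
        (ContinuousLinearMap.fst ℝ (E × E) C(unitInterval, E)))) x :=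
    ContinuousLinearMap.hasFDerivAt ((constPath E).comp ((ContinuousLinearMap.fst ℝ E E).comp
        (ContinuousLinearMap.fst ℝ (E × E) C(unitInterval, E))))
  have h4 : HasFDerivAt (fun x : (E × E) × C(unitInterval, E) => constPath E x.1.2)
      ((constPath E).comp ((ContinuousLinearMap.snd ℝ E E).comp
        (ContinuousLinearMap.fst ℝ (E × E) C(unitInterval, E)))) x :=
    ContinuousLinearMap.hasFDerivAt ((constPath E).comp ((ContinuousLinearMap.snd ℝ E E).comp
        (ContinuousLinearMap.fst ℝ (E × E) C(unitInterval, E))))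
  have h5 := (pathApply unitInterval E E).hasFDerivAt_of_bilinear h1 h3
  have h6 := hasFDerivAt_fst.prodMk ((hasFDerivAt_snd.sub h4).sub
    ((volterra E).hasFDerivAt.comp x h5))
  have h7 : fderiv ℝ (flowMap C hC.continuous) x = _ := h6.fderiv
  rw [h7]
  rfl

/-- Local flow of the fields `y ↦ C(y) v` that commute along `N`: the time-one map `Y(v, z)`
is smooth in the velocity `v` and the starting point `z`. The derivative in `v` is `C(Y)` because
both `D_v γ · w` and `t ↦ t C(γ(t)) w` solve the linearised integral equation. -/
theorem exists_flow [CompleteSpace E] {C : E → E →L[ℝ] E} (hC : ContDiff ℝ ∞ C) {N : Set E}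
    (hN : IsOpen N) {q : E} (hq : q ∈ N)
    (hcomm : ∀ y ∈ N, ∀ v w, fderiv ℝ C y (C y v) w = fderiv ℝ C y (C y w) v) :
    ∃ (D : Set (E × E)) (Y : E × E → E), IsOpen D ∧ (0, q) ∈ D ∧ ContDiffOn ℝ ∞ Y D ∧
      (∀ p ∈ D, Y p ∈ N) ∧ (∀ p ∈ D, ∀ w, fderiv ℝ Y p (w, 0) = C (Y p) w) ∧
      ∀ᶠ z in nhds q, Y (0, z) = z := by
  have hC' : ContDiff ℝ ∞ (fderiv ℝ C) := hC.fderiv_right (by simp)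
  set Φ := flowMap C hC.continuous with hΦdef
  have hΦ : ContDiff ℝ ∞ Φ := contDiff_flowMap hC
  set x₀ : (E × E) × C(unitInterval, E) := ((0, q), constPath E q) with hx₀
  have hbase : ∀ z : E, Φ ((0, z), constPath E z) = ((0, z), 0) := by
    intro z
    simp [hΦdef, flowMap]
  -- At the base point the velocity vanishes, so the linearisation is block triangular.
  let L₀ : ((E × E) × C(unitInterval, E)) ≃L[ℝ] ((E × E) × C(unitInterval, E)) :=
    (ContinuousLinearEquiv.refl ℝ (E × E)).skewProd (ContinuousLinearEquiv.refl ℝ _)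
      (-((constPath E).comp (ContinuousLinearMap.snd ℝ E E) +
        (volterra E).comp ((pathApply unitInterval E E
          (superposition C hC.continuous (constPath E q))).comp ((constPath E).comp
            (ContinuousLinearMap.fst ℝ E E)))))
  have hL₀ : HasFDerivAt Φ (L₀ : _ →L[ℝ] _) x₀ := by
    have h : fderiv ℝ Φ x₀ = (L₀ : _ →L[ℝ] _) := by
      refine ContinuousLinearMap.ext fun y => ?_
      rw [hΦdef, fderiv_flowMap_apply hC hC'.continuous]
      refine Prod.ext rfl ?_
      simp [L₀, hx₀]
      abel
    rw [← h]
    exact (hΦ.differentiable (by simp) _).hasFDerivAt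
  obtain ⟨e, hx₀e, -, hef, hesymm, heinv⟩ :=
    exists_smooth_localInverse isOpen_univ hΦ.contDiffOn (Set.mem_univ x₀) L₀ hL₀
  have hefx : ∀ x, e x = Φ x := fun x => by rw [hef]
  let Γ : E × E → C(unitInterval, E) := fun p => (e.symm (p, 0)).2
  let D₁ : Set (E × E) := (fun p => ((p, 0) : (E × E) × C(unitInterval, E))) ⁻¹' e.target
  have hιc : Continuous fun p : E × E => ((p, 0) : (E × E) × C(unitInterval, E)) := by fun_prop
  have hD₁ : IsOpen D₁ := e.open_target.preimage hιc
  have hΓ : ContDiffOn ℝ ∞ Γ D₁ := by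
    refine contDiff_snd.comp_contDiffOn (hesymm.comp ?_ fun p hp => hp)
    exact (contDiff_id.prodMk contDiff_const).contDiffOn
  have hfst : ∀ p ∈ D₁, e.symm (p, 0) = (p, Γ p) := by
    intro p hp
    have h : e (e.symm (p, 0)) = (p, 0) := e.right_inv hp
    rw [hefx] at h
    have h1 : (e.symm (p, 0)).1 = p := congrArg Prod.fst h
    exact Prod.ext h1 rfl
  have hΦΓ : ∀ p ∈ D₁, Φ (p, Γ p) = (p, 0) := by
    intro p hp
    rw [← hfst p hp, ← hefx]
    exact e.right_inv hp
  have hbaseΓ : ∀ z, ((0, z), constPath E z) ∈ e.source → Γ (0, z) = constPath E z := by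
    intro z hz
    have h := e.left_inv hz
    rw [hefx, hbase] at h
    exact congrArg (fun x : (E × E) × C(unitInterval, E) => x.2) h
  let W : Set C(unitInterval, E) := {γ | Set.MapsTo γ Set.univ N}
  have hW : IsOpen W := ContinuousMap.isOpen_setOfPred_mapsTo isCompact_univ hN
  have hD : IsOpen (D₁ ∩ Γ ⁻¹' W) := hΓ.continuousOn.isOpen_inter_preimage hD₁ hW
  let ev : C(unitInterval, E) →L[ℝ] E := ContinuousMap.evalCLM ℝ (1 : unitInterval)
  refine ⟨D₁ ∩ Γ ⁻¹' W, fun p => ev (Γ p), hD, ⟨?_, ?_⟩, ?_, ?_, ?_, ?_⟩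
  · have := e.map_source hx₀e
    rwa [hefx, hx₀, hbase] at this
  · change Set.MapsTo (Γ (0, q)) Set.univ N
    rw [hbaseΓ q hx₀e]
    intro t _
    exact hq
  · exact ev.contDiff.comp_contDiffOn (hΓ.mono Set.inter_subset_left)
  · intro p hp
    exact hp.2 (Set.mem_univ _)
  · rintro ⟨v, z⟩ ⟨hp, hpW⟩ w
    set γ := Γ (v, z) with hγ
    have hγN : ∀ t, γ t ∈ N := fun t => hpW (Set.mem_univ t)
    have hΓd : HasFDerivAt Γ (fderiv ℝ Γ (v, z)) (v, z) :=
      ((hΓ.contDiffAt (hD₁.mem_nhds hp)).differentiableAt (by simp)).hasFDerivAt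
    -- the linearised equation for the derivative of the flow
    have hlin : fderiv ℝ Φ ((v, z), γ) ((w, 0), fderiv ℝ Γ (v, z) (w, 0)) = ((w, 0), 0) := by
      have h0 : HasFDerivAt (fun p => (p, Γ p))
          ((ContinuousLinearMap.id ℝ (E × E)).prod (fderiv ℝ Γ (v, z))) (v, z) :=
        (hasFDerivAt_id (v, z)).prodMk hΓd
      have h1 := HasFDerivAt.comp (g := Φ) (v, z)
        ((hΦ.differentiable (by simp) ((v, z), γ)).hasFDerivAt) h0
      have h2 : HasFDerivAt (fun p : E × E => ((p, 0) : (E × E) × C(unitInterval, E)))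
          ((ContinuousLinearMap.id ℝ (E × E)).prod 0) (v, z) :=
        (hasFDerivAt_id (v, z)).prodMk (hasFDerivAt_const _ _)
      have h3 := h1.unique (h2.congr_of_eventuallyEq (by
        filter_upwards [hD₁.mem_nhds hp] with p hp using hΦΓ p hp))
      have h4 := congrArg (fun T => T (w, 0)) h3
      simpa using h4
    let ξ : C(unitInterval, E) := ⟨fun t => (t : ℝ) • C (γ t) w, by
      have h := hC.continuous
      fun_prop⟩
    have hγeq : ∀ t : unitInterval, γ t = z + ∫ s in (0 : ℝ)..t, Set.IccExtend (zero_le_one' ℝ)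
        (pathApply unitInterval E E (superposition C hC.continuous γ) (constPath E v)) s := by
      intro t
      have h := congrArg (fun x : (E × E) × C(unitInterval, E) => x.2 t) (hΦΓ _ hp)
      simp only [hΦdef, flowMap, ← hγ, ContinuousMap.sub_apply, constPath_apply,
        ContinuousMap.zero_apply] at h
      rw [volterra_apply, sub_sub, sub_eq_zero] at h
      exact h
    -- the candidate solves the same linear equation, because the fields commute
    have hlin' : fderiv ℝ Φ ((v, z), γ) ((w, 0), ξ) = ((w, 0), 0) := by
      rw [hΦdef, fderiv_flowMap_apply hC hC'.continuous]
      refine Prod.ext rfl ?_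
      simp only [map_zero, sub_zero]
      rw [sub_eq_zero]
      ext1 t
      symm
      set δ : ℝ → E := fun t => z + ∫ s in (0 : ℝ)..t, Set.IccExtend (zero_le_one' ℝ)
        (pathApply unitInterval E E (superposition C hC.continuous γ) (constPath E v)) s with hδ
      have hδd : ∀ t : unitInterval, HasDerivAt δ (C (γ t) v) t := by
        intro t
        have h := (hasDerivAt_volterra (pathApply unitInterval E E
          (superposition C hC.continuous γ) (constPath E v)) (t : ℝ)).const_add z
        rwa [Set.IccExtend_val] at h
      have hδγ : ∀ t : unitInterval, δ t = γ t := fun t => (hγeq t).symm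
      have hmain := volterra_eq_of_hasDerivAt
        (pathApply unitInterval E E (superposition C hC.continuous γ) (constPath E w) +
          pathApply unitInterval E E (pathApply unitInterval E (E →L[ℝ] E)
            (superposition (fderiv ℝ C) hC'.continuous γ) ξ) (constPath E v))
        (fun t => t • C (δ t) w) (by simp) (fun t => by
          have h1 : HasDerivAt (fun t => C (δ t)) (fderiv ℝ C (δ t) (C (γ t) v)) t :=
            ((hC.differentiable (by simp) _).hasFDerivAt).comp_hasDerivAt _ (hδd t)
          have h2 := (hasDerivAt_id (t : ℝ)).smul (h1.clm_apply (hasDerivAt_const (t : ℝ) w))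
          refine (h2.congr_deriv ?_).hasDerivWithinAt
          rw [hδγ]
          simp only [ContinuousMap.add_apply, pathApply_apply, superposition_apply,
            constPath_apply, map_zero, add_zero, id, one_smul, ξ, ContinuousMap.coe_mk,
            map_smul, smul_apply]
          rw [hcomm _ (hγN t) v w]
          abel) t
      refine hmain.trans ?_
      simp only [hδγ]
      rfl
    obtain ⟨L, hL⟩ := heinv ((v, z), γ) (by
      have h := e.map_target (show ((v, z), (0 : C(unitInterval, E))) ∈ e.target from hp)
      rwa [hfst _ hp] at h)
    have hinj : ((w, 0), fderiv ℝ Γ (v, z) (w, 0)) = (((w, 0), ξ) : (E × E) × _) := by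
      apply L.injective
      have h5 := hlin.trans hlin'.symm
      rw [hL.fderiv] at h5
      exact h5
    have hξ : fderiv ℝ Γ (v, z) (w, 0) = ξ :=
      congrArg (fun x : (E × E) × C(unitInterval, E) => x.2) hinj
    have hYd : HasFDerivAt (fun p => ev (Γ p)) (ev.comp (fderiv ℝ Γ (v, z))) (v, z) :=
      ev.hasFDerivAt.comp _ hΓd
    rw [hYd.fderiv, ContinuousLinearMap.comp_apply, hξ]
    change ((1 : unitInterval) : ℝ) • C (γ 1) w = C (γ 1) w
    simp
  · have hcont : Continuous fun z : E => (((0, z), constPath E z) : (E × E) × _) := by fun_prop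
    filter_upwards [hcont.continuousAt.preimage_mem_nhds (e.open_source.mem_nhds hx₀e)] with z hz
    rw [hbaseΓ z hz]
    rfl

end Flow

section Frobenius

universe u

variable {E : Type u} [NormedAddCommGroup E] [NormedSpace ℝ E]

/-- Algebra of idempotents: with `n = a p + (1 - p)` and `s = p a + (1 - p)(1 - a)` invertible,
`c = n p n⁻¹` is the projector onto the range of `a` along the kernel of `p`. -/
theorem idempotent_transport {R : Type*} [Ring R] {a p m t : R} (ha : a * a = a) (hp : p * p = p)
    (hnm : (a * p + (1 - p)) * m = 1) (hmn : m * (a * p + (1 - p)) = 1)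
    (hts : t * (p * a + (1 - p) * (1 - a)) = 1) :
    let c := (a * p + (1 - p)) * p * m
    a * c = c ∧ c * a = a ∧ c * p = c ∧ p * c = p := by
  intro c
  have hnp : (a * p + (1 - p)) * p = a * p := by
    rw [add_mul, mul_assoc, hp, sub_mul, hp, one_mul, sub_self, add_zero]
  have hnq : (a * p + (1 - p)) * (1 - p) = 1 - p := by
    simp only [add_mul, mul_sub, mul_one, mul_assoc, hp, sub_mul, one_mul]
    abel
  have hc : c = a * p * m := by rw [← hnp]
  have hac : a * c = c := by rw [hc, ← mul_assoc, ← mul_assoc, ha]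
  have hmq : m * (1 - p) = 1 - p := by
    calc m * (1 - p) = m * ((a * p + (1 - p)) * (1 - p)) := by rw [hnq]
      _ = 1 - p := by rw [← mul_assoc, hmn, one_mul]
  have hcp : c * p = c := by
    have h : c * (1 - p) = 0 := by
      rw [hc, mul_assoc, hmq, mul_sub, mul_one, mul_assoc, hp, sub_self]
    rw [mul_sub, mul_one, sub_eq_zero] at h
    exact h.symm
  have h1c : 1 - c = (1 - p) * m := by
    calc 1 - c = (a * p + (1 - p)) * m - a * p * m := by rw [hnm, hc]
      _ = (1 - p) * m := by rw [add_mul, add_sub_cancel_left]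
  have hpc0 : p * (1 - c) = 0 := by
    rw [h1c, ← mul_assoc, mul_sub, hp, mul_one, sub_self, zero_mul]
  have hpc : p * c = p := by
    rw [mul_sub, mul_one, sub_eq_zero] at hpc0
    exact hpc0.symm
  refine ⟨hac, ?_, hcp, hpc⟩
  have hak : a * ((1 - c) * a) = (1 - c) * a := by
    rw [← mul_assoc, mul_sub, mul_one, hac, sub_mul, ha, sub_mul, one_mul]
  have hs : (p * a + (1 - p) * (1 - a)) * ((1 - c) * a) = 0 := by
    rw [add_mul, mul_assoc, hak, mul_assoc (1 - p), sub_mul 1 a, hak, one_mul, sub_self,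
      mul_zero, add_zero, ← mul_assoc, hpc0, zero_mul]
  have hk : (1 - c) * a = 0 := by
    calc (1 - c) * a = t * (p * a + (1 - p) * (1 - a)) * ((1 - c) * a) := by rw [hts, one_mul]
      _ = 0 := by rw [mul_assoc, hs, mul_zero]
  rw [sub_mul, one_mul, sub_eq_zero] at hk
  exact hk.symm

/-- Near a point, an involutive field of projectors `A` can be replaced by a globally smooth field
`C` of projectors with the same range and a constant kernel; then the fields `y ↦ C(y) v`
commute. -/
theorem exists_commuting_projector [FiniteDimensional ℝ E] {A : E → E →L[ℝ] E} {Ω : Set E}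
    (hΩ : IsOpen Ω) (hA : ContDiffOn ℝ ∞ A Ω) (hidem : ∀ y ∈ Ω, A y * A y = A y)
    (hint : ∀ y ∈ Ω, ∀ u v,
      fderiv ℝ A y (A y u) (A y v) = fderiv ℝ A y (A y v) (A y u)) {q : E} (hq : q ∈ Ω) :
    ∃ (C : E → E →L[ℝ] E) (N : Set E), IsOpen N ∧ q ∈ N ∧ N ⊆ Ω ∧ ContDiff ℝ ∞ C ∧
      C q = A q ∧ (∀ y ∈ N, C y * A y = A y) ∧ (∀ y ∈ N, C y * A q = C y) ∧
      ∀ y ∈ N, ∀ v w, fderiv ℝ C y (C y v) w = fderiv ℝ C y (C y w) v := by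
  have : CompleteSpace E := FiniteDimensional.complete ℝ E
  set p := A q with hp
  have hpp : p * p = p := hidem q hq
  let n : E → E →L[ℝ] E := fun y => A y * p + (1 - p)
  let s : E → E →L[ℝ] E := fun y => p * A y + (1 - p) * (1 - A y)
  have hn : ContDiffOn ℝ ∞ n Ω := (hA.mul contDiffOn_const).add contDiffOn_const
  have hs : ContDiffOn ℝ ∞ s Ω :=
    (contDiffOn_const.mul hA).add (contDiffOn_const.mul (contDiffOn_const.sub hA))
  have hnq : n q = 1 := by simp [n, ← hp, hpp]
  have hsq : s q = 1 := by
    simp only [s, ← hp, mul_sub, mul_one, sub_mul, hpp, one_mul]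
    abel
  have hU : IsOpen {x : E →L[ℝ] E | IsUnit x} := Units.isOpen
  have hΩ₁ : IsOpen ((Ω ∩ n ⁻¹' {x | IsUnit x}) ∩ (Ω ∩ s ⁻¹' {x | IsUnit x})) :=
    (hn.continuousOn.isOpen_inter_preimage hΩ hU).inter
      (hs.continuousOn.isOpen_inter_preimage hΩ hU)
  set Ω₁ := (Ω ∩ n ⁻¹' {x | IsUnit x}) ∩ (Ω ∩ s ⁻¹' {x | IsUnit x})
  have hqΩ₁ : q ∈ Ω₁ := by
    refine ⟨⟨hq, ?_⟩, hq, ?_⟩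
    · change IsUnit (n q); rw [hnq]; exact isUnit_one
    · change IsUnit (s q); rw [hsq]; exact isUnit_one
  let C₁ : E → E →L[ℝ] E := fun y => n y * p * Ring.inverse (n y)
  have hC₁ : ContDiffOn ℝ ∞ C₁ Ω₁ := by
    intro y hy
    obtain ⟨x, hx⟩ := hy.1.2
    have h1 : ContDiffAt ℝ ∞ n y := hn.contDiffAt (hΩ.mem_nhds hy.1.1)
    have h2 : ContDiffAt ℝ ∞ (fun y => Ring.inverse (n y)) y := by
      have h3 : ContDiffAt ℝ ∞ (Ring.inverse : (E →L[ℝ] E) → (E →L[ℝ] E)) (n y) := by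
        rw [← hx]
        exact contDiffAt_ringInverse ℝ x
      exact h3.comp y h1
    exact ((h1.mul contDiffAt_const).mul h2).contDiffWithinAt
  have halg : ∀ y ∈ Ω₁, A y * C₁ y = C₁ y ∧ C₁ y * A y = A y ∧ C₁ y * p = C₁ y ∧
      p * C₁ y = p := fun y hy =>
    idempotent_transport (t := Ring.inverse (s y)) (hidem y hy.1.1) hpp
      (Ring.mul_inverse_cancel _ hy.1.2) (Ring.inverse_mul_cancel _ hy.1.2)
      (Ring.inverse_mul_cancel _ hy.2.2)
  obtain ⟨C, N, hN, hqN, hNΩ, hC, hCeq⟩ := exists_contDiff_eqOn_nhds hΩ₁ hC₁ hqΩ₁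
  have halg' : ∀ y ∈ N, A y * C y = C y ∧ C y * A y = A y ∧ C y * p = C y ∧ p * C y = p := by
    intro y hy
    rw [hCeq hy]
    exact halg y (hNΩ hy)
  refine ⟨C, N, hN, hqN, fun y hy => (hNΩ hy).1.1, hC, ?_, fun y hy => (halg' y hy).2.1,
    fun y hy => (halg' y hy).2.2.1, ?_⟩
  · rw [hCeq hqN]
    simp [C₁, hnq]
  · intro y hy v w
    have hCd : HasFDerivAt C (fderiv ℝ C y) y := (hC.differentiable (by simp) y).hasFDerivAt
    have hAd : HasFDerivAt A (fderiv ℝ A y) y :=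
      ((hA.contDiffAt (hΩ.mem_nhds (hNΩ hy).1.1)).differentiableAt (by simp)).hasFDerivAt
    obtain ⟨hAC, -, -, hpC⟩ := halg' y hy
    -- derivative of `C p = C`
    have hd1 : ∀ u x, fderiv ℝ C y u (p x) = fderiv ℝ C y u x := by
      intro u x
      have h1 : HasFDerivAt (fun y => C y (p x)) _ y :=
        hCd.clm_apply (hasFDerivAt_const (p x) y)
      have h2 : HasFDerivAt (fun y => C y x) _ y := hCd.clm_apply (hasFDerivAt_const x y)
      have h3 := h1.unique (h2.congr_of_eventuallyEq (by
        filter_upwards [hN.mem_nhds hy] with z hz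
        exact congrArg (fun T => T x) (halg' z hz).2.2.1))
      simpa using congrArg (fun T => T u) h3
    -- derivative of `C A = A`
    have hd2 : ∀ u x, fderiv ℝ C y u (A y x) + C y (fderiv ℝ A y u x) = fderiv ℝ A y u x := by
      intro u x
      have h0 : HasFDerivAt (fun y => A y x) _ y := hAd.clm_apply (hasFDerivAt_const x y)
      have h1 : HasFDerivAt (fun y => C y (A y x)) _ y := hCd.clm_apply h0
      have h3 := h1.unique (h0.congr_of_eventuallyEq (by
        filter_upwards [hN.mem_nhds hy] with z hz
        exact congrArg (fun T => T x) (halg' z hz).2.1))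
      have h4 := congrArg (fun T => T u) h3
      simp at h4
      rw [add_comm]
      exact h4
    have hAC' : ∀ x, A y (C y x) = C y x := fun x => congrArg (fun T => T x) hAC
    have hpC' : ∀ x, p (C y x) = p x := fun x => congrArg (fun T => T x) hpC
    have hkey : ∀ v w, fderiv ℝ C y (C y v) w =
        fderiv ℝ A y (A y (C y v)) (A y (C y w))
          - C y (fderiv ℝ A y (A y (C y v)) (A y (C y w))) := by
      intro v w
      rw [← hd1, ← hpC' w, hd1, eq_sub_iff_add_eq, hAC', hAC']
      have := hd2 (C y v) (C y w)
      rwa [hAC'] at this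
    rw [hkey v w, hkey w v, hint y (hNΩ hy).1.1]

/-- **Frobenius theorem** for the range of an involutive field of projectors `A`: near `q` there
is a smooth map `h`, constant along the range of `A`, with values in the kernel of `A q` and with
derivative `1 - A q` at `q`. -/
theorem exists_first_integral [FiniteDimensional ℝ E] {A : E → E →L[ℝ] E} {Ω : Set E}
    (hΩ : IsOpen Ω) (hA : ContDiffOn ℝ ∞ A Ω) (hidem : ∀ y ∈ Ω, A y * A y = A y)
    (hint : ∀ y ∈ Ω, ∀ u v,
      fderiv ℝ A y (A y u) (A y v) = fderiv ℝ A y (A y v) (A y u)) {q : E} (hq : q ∈ Ω) :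
    ∃ (h : E → E) (N : Set E), IsOpen N ∧ q ∈ N ∧ N ⊆ Ω ∧ ContDiffOn ℝ ∞ h N ∧
      (∀ y ∈ N, ∀ v, fderiv ℝ h y (A y v) = 0) ∧ fderiv ℝ h q = 1 - A q ∧
      ∀ y, A q (h y) = 0 := by
  have : CompleteSpace E := FiniteDimensional.complete ℝ E
  obtain ⟨C, N, hN, hqN, hNΩ, hC, hCq, hCA, hCp, hcomm⟩ :=
    exists_commuting_projector hΩ hA hidem hint hq
  set p := A q with hp
  have hpp : ∀ x, p (p x) = p x := fun x => congrArg (fun T => T x) (hidem q hq)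
  obtain ⟨D, Y, hD, hqD, hY, hYN, hYv, hYz⟩ := exists_flow hC hN hqN hcomm
  -- `x ↦ Y (p x, q + (1 - p) x)` straightens the leaves: it sends the slices parallel to the range
  -- of `p` to them, and `h` is `1 - p` of its inverse.
  let ι : E → E × E := fun x => (p x, q + (x - p x))
  let ι' : E →L[ℝ] E × E := p.prod (ContinuousLinearMap.id ℝ E - p)
  have hι : ContDiff ℝ ∞ ι :=
    p.contDiff.prodMk (contDiff_const.add (contDiff_id.sub p.contDiff))
  have hιd : ∀ x, HasFDerivAt ι ι' x := fun x =>
    p.hasFDerivAt.prodMk (((hasFDerivAt_id x).sub p.hasFDerivAt).const_add q)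
  have hι0 : ι 0 = (0, q) := by simp [ι]
  have hD' : IsOpen (ι ⁻¹' D) := hD.preimage hι.continuous
  have hYd : ∀ x ∈ D, HasFDerivAt Y (fderiv ℝ Y x) x := fun x hx =>
    ((hY.contDiffAt (hD.mem_nhds hx)).differentiableAt (by simp)).hasFDerivAt
  have hΘ : ContDiffOn ℝ ∞ (fun x => Y (ι x)) (ι ⁻¹' D) :=
    hY.comp hι.contDiffOn fun x hx => hx
  have hΘd : ∀ x ∈ ι ⁻¹' D,
      HasFDerivAt (fun x => Y (ι x)) ((fderiv ℝ Y (ι x)).comp ι') x :=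
    fun x hx => (hYd _ hx).comp x (hιd x)
  have hYq : ∀ z, fderiv ℝ Y (0, q) (0, z) = z := by
    intro z
    have h1 : HasFDerivAt (fun z : E => Y (0, z)) _ q :=
      (hYd _ hqD).comp q ((hasFDerivAt_const (0 : E) q).prodMk (hasFDerivAt_id q))
    have h2 := h1.unique ((hasFDerivAt_id q).congr_of_eventuallyEq hYz)
    simpa using congrArg (fun T => T z) h2
  have h0D : (0 : E) ∈ ι ⁻¹' D := by
    change ι 0 ∈ D
    rw [hι0]
    exact hqD
  have hYq0 : Y (0, q) = q := hYz.self_of_nhds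
  have hΘ0 : HasFDerivAt (fun x => Y (ι x))
      ((ContinuousLinearEquiv.refl ℝ E : E ≃L[ℝ] E) : E →L[ℝ] E) 0 := by
    have h : (fderiv ℝ Y (ι 0)).comp ι' =
        ((ContinuousLinearEquiv.refl ℝ E : E ≃L[ℝ] E) : E →L[ℝ] E) := by
      refine ContinuousLinearMap.ext fun x => ?_
      have hsplit : ι' x = (p x, 0) + (0, x - p x) := by simp [ι']
      rw [ContinuousLinearMap.comp_apply, hι0, hsplit, map_add, hYv _ hqD, hYq, hYq0, hCq, hpp]
      simp
    rw [← h]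
    exact hΘd 0 h0D
  obtain ⟨e, h0e, heD, hef, hesymm, heinv⟩ := exists_smooth_localInverse hD' hΘ h0D _ hΘ0
  have hefx : ∀ x, e x = Y (ι x) := fun x => by rw [hef]
  have he0 : e 0 = q := by rw [hefx, hι0, hYq0]
  have hsub : ∀ y ∈ e.target, y ∈ N := by
    intro y hy
    rw [← e.right_inv hy, hefx]
    exact hYN _ (heD (e.map_target hy))
  have hsymm0 : e.symm q = 0 := by rw [← he0, e.left_inv h0e]
  have hesd : ∀ y ∈ e.target, HasFDerivAt e.symm (fderiv ℝ e.symm y) y := fun y hy =>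
    ((hesymm.contDiffAt (e.open_target.mem_nhds hy)).differentiableAt (by simp)).hasFDerivAt
  have hqT : q ∈ e.target := by rw [← he0]; exact e.map_source h0e
  have hhd : ∀ y ∈ e.target, HasFDerivAt (fun y => e.symm y - p (e.symm y))
      ((1 - p).comp (fderiv ℝ e.symm y)) y := fun y hy =>
    (hesd y hy).sub (p.hasFDerivAt.comp y (hesd y hy))
  refine ⟨fun y => e.symm y - p (e.symm y), e.target, e.open_target, hqT,
    fun y hy => hNΩ (hsub y hy), hesymm.sub (p.contDiff.comp_contDiffOn hesymm), ?_, ?_, ?_⟩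
  · intro y hy v
    obtain ⟨L, hL⟩ := heinv _ (e.map_target hy)
    have hLe : HasFDerivAt e (L : E →L[ℝ] E) (e.symm y) := by rw [hef]; exact hL
    have hs := e.hasFDerivAt_symm hy hLe
    have hx := heD (e.map_target hy)
    have hΘx := (hΘd _ hx).unique hL
    have hYy : Y (ι (e.symm y)) = y := by rw [← hefx, e.right_inv hy]
    have hLp : L (p (A y v)) = A y v := by
      have h := congrArg (fun T => T (p (A y v))) hΘx
      have hι'p : ι' (p (A y v)) = (p (A y v), 0) := by simp [ι', hpp]
      simp only [ContinuousLinearMap.comp_apply, hι'p, hYv _ hx, hYy] at h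
      have h1 : C y (p (A y v)) = C y (A y v) := congrArg (fun T => T (A y v)) (hCp y (hsub y hy))
      have h2 : C y (A y v) = A y v := congrArg (fun T => T v) (hCA y (hsub y hy))
      rw [h1, h2] at h
      exact h.symm
    rw [(hhd y hy).fderiv, hs.fderiv]
    have h3 : L.symm (A y v) = p (A y v) := L.symm_apply_eq.2 hLp.symm
    simp only [ContinuousLinearMap.comp_apply, ContinuousLinearEquiv.coe_coe, h3]
    simp [hpp]
  · have hLe : HasFDerivAt e ((ContinuousLinearEquiv.refl ℝ E : E ≃L[ℝ] E) : E →L[ℝ] E)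
        (e.symm q) := by
      rw [hef, hsymm0]; exact hΘ0
    have hs := e.hasFDerivAt_symm hqT hLe
    rw [(hhd q hqT).fderiv, hs.fderiv]
    ext x
    simp
  · intro y
    rw [map_sub, hpp, sub_self]

end Frobenius

/-! ### Coordinates adapted to a pair of complementary foliations -/

section AdaptedCoordinates

variable {n p : ℕ}

/-- A linear change of coordinates that turns a projector of trace `p` into the projector onto the
first `p` coordinates. -/
theorem exists_adapted_frame (hpn : p ≤ n) (A : Coord n →L[ℝ] Coord n) (hA : A * A = A)
    (htr : LinearMap.trace ℝ (Coord n) (A : Coord n →ₗ[ℝ] Coord n) = p) :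
    ∃ L : Coord n ≃L[ℝ] Coord n, ∀ i : Fin n,
      (i.val < p → A (L.symm (basisVec i)) = L.symm (basisVec i)) ∧
      (p ≤ i.val → A (L.symm (basisVec i)) = 0) := by
  obtain ⟨m, rfl⟩ := Nat.exists_eq_add_of_le hpn
  set f : Coord (p + m) →ₗ[ℝ] Coord (p + m) := (A : Coord (p + m) →ₗ[ℝ] Coord (p + m)) with hf
  have hfi : IsIdempotentElem f := by
    ext1 x
    exact congrArg (fun T => T x) hA
  have hc : IsCompl (LinearMap.range f) (LinearMap.ker f) := LinearMap.IsIdempotentElem.isCompl hfi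
  have hr : Module.finrank ℝ (LinearMap.range f) = p := by
    have h := (LinearMap.IsIdempotentElem.isProj_range f hfi).trace
    rw [htr] at h
    exact_mod_cast h.symm
  have hk : Module.finrank ℝ (LinearMap.ker f) = m := by
    have h := LinearMap.finrank_range_add_finrank_ker f
    rw [hr, finrank_euclideanSpace_fin] at h
    omega
  let b : Module.Basis (Fin (p + m)) ℝ (Coord (p + m)) :=
    (((Module.finBasisOfFinrankEq ℝ _ hr).prod (Module.finBasisOfFinrankEq ℝ _ hk)).map
      (Submodule.prodEquivOfIsCompl _ _ hc)).reindex finSumFinEquiv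
  let L : Coord (p + m) ≃L[ℝ] Coord (p + m) :=
    (b.equivFun.trans (WithLp.linearEquiv 2 ℝ (Fin (p + m) → ℝ)).symm).toContinuousLinearEquiv
  have hL : ∀ i, L.symm (basisVec i) = b i := by
    intro i
    rw [L.symm_apply_eq]
    ext j
    simp [L, basisVec, Finsupp.single_apply, eq_comm]
  refine ⟨L, fun i => ?_⟩
  rw [hL]
  refine Fin.addCases (fun j => ?_) (fun j => ?_) i
  · refine ⟨fun _ => ?_, fun h => absurd h (by simp)⟩
    have hb : b (Fin.castAdd m j) = (Module.finBasisOfFinrankEq ℝ _ hr j : Coord (p + m)) := by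
      simp [b]
    rw [hb]
    obtain ⟨x, hx⟩ := (Module.finBasisOfFinrankEq ℝ _ hr j).2
    rw [← hx]
    exact congrArg (fun T => T x) hA
  · refine ⟨fun h => absurd h (by simp), fun _ => ?_⟩
    have hb : b (Fin.natAdd p j) = (Module.finBasisOfFinrankEq ℝ _ hk j : Coord (p + m)) := by
      simp [b]
    rw [hb]
    exact (Module.finBasisOfFinrankEq ℝ _ hk j).2

/-- If the range and the kernel of a field of projectors of rank `p` are both involutive, there are
coordinates whose first `p` coordinate fields span the range and whose other coordinate fields
span the kernel: the first integrals of the two foliations together. -/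
theorem exists_adapted_coordinates (hpn : p ≤ n) {A : Coord n → Coord n →L[ℝ] Coord n}
    {Ω : Set (Coord n)} (hΩ : IsOpen Ω) (hA : ContDiffOn ℝ ∞ A Ω)
    (hidem : ∀ y ∈ Ω, A y * A y = A y)
    (hrange : ∀ y ∈ Ω, ∀ u v, A y u = u → A y v = v →
      fderiv ℝ A y u v = fderiv ℝ A y v u)
    (hker : ∀ y ∈ Ω, ∀ u v, A y u = 0 → A y v = 0 →
      fderiv ℝ A y u v = fderiv ℝ A y v u) {q : Coord n} (hq : q ∈ Ω)
    (htr : LinearMap.trace ℝ (Coord n) (A q : Coord n →ₗ[ℝ] Coord n) = p) :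
    ∃ φ : OpenPartialHomeomorph (Coord n) (Coord n), q ∈ φ.source ∧ φ.source ⊆ Ω ∧
      ContDiffOn ℝ ∞ φ φ.source ∧ ContDiffOn ℝ ∞ φ.symm φ.target ∧
      ∀ z ∈ φ.target, ∀ i : Fin n,
        (i.val < p → A (φ.symm z) (fderiv ℝ φ.symm z (basisVec i)) =
          fderiv ℝ φ.symm z (basisVec i)) ∧
        (p ≤ i.val → A (φ.symm z) (fderiv ℝ φ.symm z (basisVec i)) = 0) := by
  have hAA : ∀ y ∈ Ω, ∀ x, A y (A y x) = A y x :=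
    fun y hy x => congrArg (fun T => T x) (hidem y hy)
  obtain ⟨L, hL⟩ := exists_adapted_frame hpn (A q) (hidem q hq) htr
  obtain ⟨h₁, N₁, hN₁, hq₁, hN₁Ω, hs₁, hd₁, hdq₁, hv₁⟩ := exists_first_integral hΩ hA hidem
    (fun y hy u v => hrange y hy _ _ (hAA y hy u) (hAA y hy v)) hq
  have hB : ContDiffOn ℝ ∞ (fun y => 1 - A y) Ω := contDiffOn_const.sub hA
  have hBd : ∀ y ∈ Ω, fderiv ℝ (fun y => 1 - A y) y = - fderiv ℝ A y := fun y _ =>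
    fderiv_const_sub _
  obtain ⟨h₂, N₂, hN₂, hq₂, hN₂Ω, hs₂, hd₂, hdq₂, hv₂⟩ := exists_first_integral hΩ hB
    (fun y hy => (IsIdempotentElem.one_sub (hidem y hy) : _)) (fun y hy u v => by
      rw [hBd y hy]
      simp only [neg_apply]
      rw [hker y hy _ _ (by simp [hAA y hy]) (by simp [hAA y hy])]) hq
  have hf₁ : ∀ y ∈ N₁ ∩ N₂, HasFDerivAt h₁ (fderiv ℝ h₁ y) y := fun y hy =>
    ((hs₁.contDiffAt (hN₁.mem_nhds hy.1)).differentiableAt (by simp)).hasFDerivAt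
  have hf₂ : ∀ y ∈ N₁ ∩ N₂, HasFDerivAt h₂ (fderiv ℝ h₂ y) y := fun y hy =>
    ((hs₂.contDiffAt (hN₂.mem_nhds hy.2)).differentiableAt (by simp)).hasFDerivAt
  set f : Coord n → Coord n := fun y => L (h₁ y + h₂ y) with hf
  have hfs : ContDiffOn ℝ ∞ f (N₁ ∩ N₂) := L.contDiff.comp_contDiffOn
    ((hs₁.mono Set.inter_subset_left).add (hs₂.mono Set.inter_subset_right))
  have hfd : ∀ y ∈ N₁ ∩ N₂, HasFDerivAt f
      ((L : Coord n →L[ℝ] Coord n).comp (fderiv ℝ h₁ y + fderiv ℝ h₂ y)) y := fun y hy =>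
    (L : Coord n →L[ℝ] Coord n).hasFDerivAt.comp y ((hf₁ y hy).add (hf₂ y hy))
  have hfq : HasFDerivAt f (L : Coord n →L[ℝ] Coord n) q := by
    have h := hfd q ⟨hq₁, hq₂⟩
    have h1 : fderiv ℝ h₁ q + fderiv ℝ h₂ q = ContinuousLinearMap.id ℝ (Coord n) := by
      rw [hdq₁, hdq₂]
      ext x
      simp
    rwa [h1, ContinuousLinearMap.comp_id] at h
  obtain ⟨e, hqe, heN, hef, hesymm, heinv⟩ :=
    exists_smooth_localInverse (hN₁.inter hN₂) hfs ⟨hq₁, hq₂⟩ L hfq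
  refine ⟨e, hqe, fun y hy => hN₁Ω (heN hy).1, by rw [hef]; exact hfs.mono heN, hesymm, ?_⟩
  intro z hz i
  have hy := e.map_target hz
  set y := e.symm z with hydef
  have hyN := heN hy
  have hyΩ := hN₁Ω hyN.1
  obtain ⟨M, hM⟩ := heinv y hy
  have hMe : HasFDerivAt e (M : Coord n →L[ℝ] Coord n) (e.symm z) := by rw [hef]; exact hM
  rw [(e.hasFDerivAt_symm hz hMe).fderiv]
  set u : Coord n := M.symm (basisVec i) with hu
  have hMap : ∀ x, M x = L (fderiv ℝ h₁ y x + fderiv ℝ h₂ y x) := fun x =>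
    congrArg (fun T => T x) (hM.unique (hfd y hyN))
  have hval₁ : ∀ x, A q (fderiv ℝ h₁ y x) = 0 := by
    intro x
    have h1 : HasFDerivAt (fun y => A q (h₁ y)) _ y := (A q).hasFDerivAt.comp y (hf₁ y hyN)
    have h2 := h1.unique ((hasFDerivAt_const (0 : Coord n) y).congr_of_eventuallyEq
      (Filter.Eventually.of_forall hv₁))
    exact congrArg (fun T => T x) h2
  have hval₂ : ∀ x, A q (fderiv ℝ h₂ y x) = fderiv ℝ h₂ y x := by
    intro x
    have h1 : HasFDerivAt (fun y => (1 - A q) (h₂ y)) _ y :=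
      (1 - A q).hasFDerivAt.comp y (hf₂ y hyN)
    have h2 := h1.unique ((hasFDerivAt_const (0 : Coord n) y).congr_of_eventuallyEq
      (Filter.Eventually.of_forall hv₂))
    have h3 : (1 - A q) (fderiv ℝ h₂ y x) = 0 := congrArg (fun T => T x) h2
    simp only [sub_apply, one_apply_eq_self, sub_eq_zero] at h3
    exact h3.symm
  have hA₂ : ∀ x, fderiv ℝ h₂ y (A y x) = fderiv ℝ h₂ y x := by
    intro x
    have h := hd₂ y hyN.2 x
    simp only [sub_apply, one_apply_eq_self, map_sub, sub_eq_zero] at h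
    exact h.symm
  have hA₁ := hd₁ y hyN.1
  have hsum : fderiv ℝ h₁ y u + fderiv ℝ h₂ y u = L.symm (basisVec i) := by
    rw [L.eq_symm_apply, ← hMap, hu, M.apply_symm_apply]
  have hsum' : fderiv ℝ h₂ y u = A q (L.symm (basisVec i)) := by
    rw [← hsum, map_add, hval₁, hval₂, zero_add]
  refine ⟨fun hi => ?_, fun hi => ?_⟩
  · rw [(hL i).1 hi] at hsum'
    rw [hsum', add_eq_right] at hsum
    apply M.injective
    change M (A y u) = M u
    rw [hMap, hMap, hA₁, hA₂, hsum]
  · rw [(hL i).2 hi] at hsum'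
    apply M.injective
    change M (A y u) = M 0
    rw [hMap, hA₁, hA₂, hsum', map_zero]
    simp

end AdaptedCoordinates

/-! ### Tensor fields and 1-forms read in charts -/

section Charts

variable {n : ℕ} {V : Type*} [TopologicalSpace V] [ChartedSpace (Coord n) V]

/-- The differential at `y` of the inverse of the chart `e`, as an endomorphism of `ℝⁿ`: every
tangent space of `V` is modelled on `ℝⁿ`. -/
def chartDeriv (e : OpenPartialHomeomorph V (Coord n)) (y : Coord n) : Coord n →L[ℝ] Coord n :=
  mfderiv (𝓡 n) (𝓡 n) e.symm y

/-- The value at `x` of a field of bilinear forms, as a bilinear form on `ℝⁿ`. -/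
def bilinAt (B : BilinField n V) (x : V) : Coord n →L[ℝ] Coord n →L[ℝ] ℝ := B x

/-- The value at `x` of a 1-form, as a linear form on `ℝⁿ`. -/
def formAt (η : ∀ x : V, TangentSpace (𝓡 n) x →L[ℝ] ℝ) (x : V) : Coord n →L[ℝ] ℝ := η x

/-- A covariant rank-two tensor read in the chart `e`, as a function with values in the bilinear
forms on `ℝⁿ`; `components` is its matrix in the standard basis. -/
def pull (e : OpenPartialHomeomorph V (Coord n)) (B : BilinField n V) (y : Coord n) :
    Coord n →L[ℝ] Coord n →L[ℝ] ℝ :=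
  (bilinAt B (e.symm y)).bilinearComp (chartDeriv e y) (chartDeriv e y)

/-- A 1-form read in the chart `e`. -/
def pullForm (e : OpenPartialHomeomorph V (Coord n)) (η : ∀ x : V, TangentSpace (𝓡 n) x →L[ℝ] ℝ)
    (y : Coord n) : Coord n →L[ℝ] ℝ :=
  (formAt η (e.symm y)).comp (chartDeriv e y)

theorem components_apply (e : OpenPartialHomeomorph V (Coord n)) (B : BilinField n V)
    (y : Coord n) (i j : Fin n) :
    components e B y i j = pull e B y (basisVec i) (basisVec j) := rfl

theorem mdifferentiable_of_mem_maximalAtlas {e : OpenPartialHomeomorph V (Coord n)}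
    (he : e ∈ IsManifold.maximalAtlas (𝓡 n) ∞ V) : e.MDifferentiable (𝓡 n) (𝓡 n) :=
  ⟨(contMDiffOn_of_mem_maximalAtlas he).mdifferentiableOn (by simp),
    (contMDiffOn_symm_of_mem_maximalAtlas he).mdifferentiableOn (by simp)⟩

theorem chartDeriv_bijective {e : OpenPartialHomeomorph V (Coord n)}
    (he : e ∈ IsManifold.maximalAtlas (𝓡 n) ∞ V) {y : Coord n} (hy : y ∈ e.target) :
    Function.Bijective (chartDeriv e y) :=
  (mdifferentiable_of_mem_maximalAtlas he).symm.mfderiv_bijective hy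

omit [ChartedSpace (Coord n) V] in
theorem isOpen_chart_preimage (e : OpenPartialHomeomorph V (Coord n)) {U : Set V}
    (hU : IsOpen U) : IsOpen (e.target ∩ e.symm ⁻¹' U) :=
  e.symm.isOpen_inter_preimage hU

theorem contDiffOn_pull [IsManifold (𝓡 n) ∞ V] {e : OpenPartialHomeomorph V (Coord n)}
    (he : e ∈ IsManifold.maximalAtlas (𝓡 n) ∞ V) {B : BilinField n V} {U : Set V}
    (hB : SmoothOn B U) (hU : IsOpen U) :
    ContDiffOn ℝ ∞ (pull e B) (e.target ∩ e.symm ⁻¹' U) := by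
  have hD := isOpen_chart_preimage e hU
  rw [contDiffOn_clm_apply]
  intro u
  rw [contDiffOn_clm_apply]
  intro v y hy
  have hes : ContMDiffAt (𝓡 n) (𝓡 n) ∞ e.symm y :=
    contMDiffAt_symm_of_mem_maximalAtlas he hy.1
  have hvec : ∀ u : Coord n, ContMDiffAt (𝓡 n) ((𝓡 n).prod 𝓘(ℝ, Coord n)) ∞
      (fun y => Bundle.TotalSpace.mk' (Coord n) (E := fun x : V => TangentSpace (𝓡 n) x)
        (e.symm y) (mfderiv (𝓡 n) (𝓡 n) e.symm y u)) y := by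
    intro u
    have h1 : ContMDiffAt (𝓡 n) (𝓡 n).tangent ∞
        (fun y : Coord n => (⟨y, u⟩ : TangentBundle (𝓡 n) (Coord n))) y := by
      rw [Bundle.contMDiffAt_totalSpace]
      refine ⟨contMDiffAt_id, ?_⟩
      simpa using contMDiffAt_const
    have h2 : ContMDiffOn (𝓡 n).tangent (𝓡 n).tangent ∞
        (tangentMapWithin (𝓡 n) (𝓡 n) e.symm e.target)
        (Bundle.TotalSpace.proj ⁻¹' e.target) :=
      (contMDiffOn_symm_of_mem_maximalAtlas he).contMDiffOn_tangentMapWithin (by simp)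
        e.open_target.uniqueMDiffOn
    have h3 : ContMDiffAt (𝓡 n).tangent (𝓡 n).tangent ∞
        (tangentMapWithin (𝓡 n) (𝓡 n) e.symm e.target)
        (⟨y, u⟩ : TangentBundle (𝓡 n) (Coord n)) :=
      h2.contMDiffAt ((e.open_target.preimage
        (FiberBundle.continuous_proj (Coord n) _)).mem_nhds hy.1)
    have h4 := ContMDiffAt.comp y h3 h1
    refine h4.congr_of_eventuallyEq ?_
    filter_upwards [e.open_target.mem_nhds hy.1] with z hz
    simp only [Function.comp, tangentMapWithin]
    rw [mfderivWithin_of_isOpen e.open_target hz]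
  have hBy : ContMDiffAt (𝓡 n) ((𝓡 n).prod 𝓘(ℝ, Coord n →L[ℝ] Coord n →L[ℝ] ℝ)) ∞
      (fun y => Bundle.TotalSpace.mk' (Coord n →L[ℝ] Coord n →L[ℝ] ℝ)
        (E := fun x : V => TangentSpace (𝓡 n) x →L[ℝ] TangentSpace (𝓡 n) x →L[ℝ] ℝ)
        (e.symm y) (B (e.symm y))) y :=
    ContMDiffAt.comp y (hB.contMDiffAt (hU.mem_nhds hy.2)) hes
  have key : ContMDiffAt (𝓡 n) ((𝓡 n).prod 𝓘(ℝ, ℝ)) ∞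
      (fun y => Bundle.TotalSpace.mk' ℝ (E := Bundle.Trivial V ℝ) (e.symm y)
        (B (e.symm y) (mfderiv (𝓡 n) (𝓡 n) e.symm y u) (mfderiv (𝓡 n) (𝓡 n) e.symm y v))) y := by
    apply ContMDiffAt.clm_bundle_apply₂ (F₁ := Coord n) (F₂ := Coord n)
    · exact hBy
    · exact hvec u
    · exact hvec v
  rw [Bundle.contMDiffAt_totalSpace] at key
  exact (contMDiffAt_iff_contDiffAt.1 key.2).contDiffWithinAt

/-! ### Changes of coordinates -/

theorem contDiffOn_transition {e₁ e₂ : OpenPartialHomeomorph V (Coord n)}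
    (he₁ : e₁ ∈ IsManifold.maximalAtlas (𝓡 n) ∞ V)
    (he₂ : e₂ ∈ IsManifold.maximalAtlas (𝓡 n) ∞ V) :
    ContDiffOn ℝ ∞ (fun y => e₂ (e₁.symm y)) (e₁.target ∩ e₁.symm ⁻¹' e₂.source) := by
  rw [← contMDiffOn_iff_contDiffOn]
  exact (contMDiffOn_of_mem_maximalAtlas he₂).comp
    ((contMDiffOn_symm_of_mem_maximalAtlas he₁).mono Set.inter_subset_left) fun y hy => hy.2

theorem chartDeriv_transition {e₁ e₂ : OpenPartialHomeomorph V (Coord n)}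
    (he₁ : e₁ ∈ IsManifold.maximalAtlas (𝓡 n) ∞ V)
    (he₂ : e₂ ∈ IsManifold.maximalAtlas (𝓡 n) ∞ V) {y : Coord n}
    (hy : y ∈ e₁.target ∩ e₁.symm ⁻¹' e₂.source) :
    chartDeriv e₁ y = (chartDeriv e₂ (e₂ (e₁.symm y))).comp
        (fderiv ℝ (fun y => e₂ (e₁.symm y)) y) := by
  have hD := isOpen_chart_preimage e₁ e₂.open_source
  have h1 : MDifferentiableAt (𝓡 n) (𝓡 n) (fun y => e₂ (e₁.symm y)) y :=
    (((contDiffOn_transition he₁ he₂).contDiffAt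
      (hD.mem_nhds hy)).differentiableAt (by simp)).mdifferentiableAt
  have h2 : MDifferentiableAt (𝓡 n) (𝓡 n) e₂.symm (e₂ (e₁.symm y)) :=
    (mdifferentiable_of_mem_maximalAtlas he₂).mdifferentiableAt_symm (e₂.map_source hy.2)
  have h3 := mfderiv_comp y h2 h1
  rw [mfderiv_eq_fderiv] at h3
  have h4 : (e₂.symm ∘ fun y => e₂ (e₁.symm y)) =ᶠ[nhds y] e₁.symm := by
    filter_upwards [hD.mem_nhds hy] with z hz
    exact e₂.left_inv hz.2
  exact (h4.mfderiv_eq (I := 𝓡 n) (I' := 𝓡 n)).symm.trans h3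

theorem pull_transition {e₁ e₂ : OpenPartialHomeomorph V (Coord n)}
    (he₁ : e₁ ∈ IsManifold.maximalAtlas (𝓡 n) ∞ V)
    (he₂ : e₂ ∈ IsManifold.maximalAtlas (𝓡 n) ∞ V) (B : BilinField n V) {y : Coord n}
    (hy : y ∈ e₁.target ∩ e₁.symm ⁻¹' e₂.source) :
    pull e₁ B y = (pull e₂ B (e₂ (e₁.symm y))).bilinearComp
      (fderiv ℝ (fun y => e₂ (e₁.symm y)) y) (fderiv ℝ (fun y => e₂ (e₁.symm y)) y) := by
  have hpt : e₂.symm (e₂ (e₁.symm y)) = e₁.symm y := e₂.left_inv hy.2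
  have hB := congrArg (bilinAt B) hpt
  unfold pull
  rw [chartDeriv_transition he₁ he₂ hy, hB]
  rfl

theorem pullForm_transition {e₁ e₂ : OpenPartialHomeomorph V (Coord n)}
    (he₁ : e₁ ∈ IsManifold.maximalAtlas (𝓡 n) ∞ V)
    (he₂ : e₂ ∈ IsManifold.maximalAtlas (𝓡 n) ∞ V) (η : ∀ x : V, TangentSpace (𝓡 n) x →L[ℝ] ℝ)
    {y : Coord n} (hy : y ∈ e₁.target ∩ e₁.symm ⁻¹' e₂.source) :
    pullForm e₁ η y = (pullForm e₂ η (e₂ (e₁.symm y))).comp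
      (fderiv ℝ (fun y => e₂ (e₁.symm y)) y) := by
  have hpt : e₂.symm (e₂ (e₁.symm y)) = e₁.symm y := e₂.left_inv hy.2
  have hη := congrArg (formAt η) hpt
  unfold pullForm
  rw [chartDeriv_transition he₁ he₂ hy, hη]
  rfl

theorem fderiv_transition_surjective {e₁ e₂ : OpenPartialHomeomorph V (Coord n)}
    (he₁ : e₁ ∈ IsManifold.maximalAtlas (𝓡 n) ∞ V)
    (he₂ : e₂ ∈ IsManifold.maximalAtlas (𝓡 n) ∞ V) {y : Coord n}
    (hy : y ∈ e₁.target ∩ e₁.symm ⁻¹' e₂.source) :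
    Function.Surjective (fderiv ℝ (fun y => e₂ (e₁.symm y)) y) := by
  intro z
  obtain ⟨u, hu⟩ := (chartDeriv_bijective he₁ hy.1).2
    (chartDeriv e₂ (e₂ (e₁.symm y)) z)
  refine ⟨u, (chartDeriv_bijective he₂ (e₂.map_source hy.2)).1 ?_⟩
  rw [← hu]
  exact (congrArg (fun T : Coord n →L[ℝ] Coord n => T u)
    (chartDeriv_transition he₁ he₂ hy)).symm

theorem pull_symm {e : OpenPartialHomeomorph V (Coord n)} {B : BilinField n V} {U : Set V}
    (hB : ∀ x ∈ U, ∀ u v, B x u v = B x v u) {y : Coord n} (hy : e.symm y ∈ U) (u v : Coord n) :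
    pull e B y u v = pull e B y v u := hB _ hy _ _

theorem pull_nondegenerate [IsManifold (𝓡 n) ∞ V] {e : OpenPartialHomeomorph V (Coord n)}
    (he : e ∈ IsManifold.maximalAtlas (𝓡 n) ∞ V) (g : PseudoMetric n V) {y : Coord n}
    (hy : y ∈ e.target) {u : Coord n} (hu : ∀ v, pull e g.form y u v = 0) : u = 0 := by
  have hbij := chartDeriv_bijective he hy
  apply hbij.1
  rw [map_zero (chartDeriv e y)]
  apply g.nondegenerate
  intro v
  obtain ⟨w, rfl⟩ := hbij.2 v
  exact hu w

end Charts

/-! ### The tensor `M` through Christoffel expressions of the first kind -/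

section FirstKind

variable {E : Type*} [NormedAddCommGroup E] [NormedSpace ℝ E]

/-- Twice the Christoffel symbol of the first kind of a field `S` of bilinear forms:
`∂_v S(u, w) + ∂_w S(u, v) - ∂_u S(v, w)`. -/
def firstKind (S : E → E →L[ℝ] E →L[ℝ] ℝ) (y u v w : E) : ℝ :=
  fderiv ℝ S y v u w + fderiv ℝ S y w u v - fderiv ℝ S y u v w

theorem fderiv_symm_of_symm {S : E → E →L[ℝ] E →L[ℝ] ℝ} {y : E} (hS : DifferentiableAt ℝ S y)
    (hsymm : ∀ᶠ z in nhds y, ∀ u v, S z u v = S z v u) (w u v : E) :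
    fderiv ℝ S y w u v = fderiv ℝ S y w v u := by
  have hd : ∀ u v, HasFDerivAt (fun z => S z u v) _ y := fun u v =>
    (hS.hasFDerivAt.clm_apply (hasFDerivAt_const u y)).clm_apply (hasFDerivAt_const v y)
  have h := (hd u v).unique ((hd v u).congr_of_eventuallyEq (by
    filter_upwards [hsymm] with z hz using hz u v))
  simpa using congrArg (fun T => T w) h

theorem fderiv_clm_apply₂ {S : E → E →L[ℝ] E →L[ℝ] ℝ} {y : E} (hS : DifferentiableAt ℝ S y)
    (w u v : E) : fderiv ℝ (fun z => S z u v) y w = fderiv ℝ S y w u v := by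
  have h : HasFDerivAt (fun z => S z u v) _ y :=
    (hS.hasFDerivAt.clm_apply (hasFDerivAt_const u y)).clm_apply (hasFDerivAt_const v y)
  rw [h.fderiv]
  simp

set_option synthInstance.maxHeartbeats 200000 in
/-- Transformation law of the Christoffel symbols of the first kind under a change of
coordinates. -/
theorem firstKind_transition {S₁ S₂ : E → E →L[ℝ] E →L[ℝ] ℝ} {φ : E → E} {y : E}
    (hφ : ContDiffAt ℝ ∞ φ y) (hS₂ : DifferentiableAt ℝ S₂ (φ y))
    (hS₁ : DifferentiableAt ℝ S₁ y)
    (hpull : ∀ᶠ z in nhds y, ∀ u v, S₁ z u v = S₂ (φ z) (fderiv ℝ φ z u) (fderiv ℝ φ z v))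
    (hsymm : ∀ u v, S₂ (φ y) u v = S₂ (φ y) v u) (u v w : E) :
    firstKind S₁ y u v w = firstKind S₂ (φ y) (fderiv ℝ φ y u) (fderiv ℝ φ y v) (fderiv ℝ φ y w)
      + 2 * S₂ (φ y) (fderiv ℝ φ y u) (fderiv ℝ (fderiv ℝ φ) y v w) := by
  have hφd : HasFDerivAt φ (fderiv ℝ φ y) y := (hφ.differentiableAt (by simp)).hasFDerivAt
  have hφ' : ContDiffAt ℝ ∞ (fderiv ℝ φ) y := hφ.fderiv_right (by simp)
  have hφ'd : HasFDerivAt (fderiv ℝ φ) (fderiv ℝ (fderiv ℝ φ) y) y :=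
    (hφ'.differentiableAt (by simp)).hasFDerivAt
  have hsnd : ∀ a b, fderiv ℝ (fderiv ℝ φ) y a b = fderiv ℝ (fderiv ℝ φ) y b a :=
    hφ.isSymmSndFDerivAt (by
      rw [minSmoothness_of_isRCLikeNormedField]
      exact WithTop.coe_le_coe.2 le_top)
  have hd : ∀ c a b, fderiv ℝ S₁ y c a b =
      fderiv ℝ S₂ (φ y) (fderiv ℝ φ y c) (fderiv ℝ φ y a) (fderiv ℝ φ y b)
        + S₂ (φ y) (fderiv ℝ (fderiv ℝ φ) y c a) (fderiv ℝ φ y b)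
        + S₂ (φ y) (fderiv ℝ φ y a) (fderiv ℝ (fderiv ℝ φ) y c b) := by
    intro c a b
    have hv : ∀ a, HasFDerivAt (fun z => fderiv ℝ φ z a) _ y := fun a =>
      hφ'd.clm_apply (hasFDerivAt_const a y)
    have h1 : HasFDerivAt (fun z => S₂ (φ z)) ((fderiv ℝ S₂ (φ y)).comp (fderiv ℝ φ y)) y :=
      HasFDerivAt.comp (g := S₂) (g' := fderiv ℝ S₂ (φ y)) y hS₂.hasFDerivAt hφd
    have h2 : HasFDerivAt (fun z => S₂ (φ z) (fderiv ℝ φ z a) (fderiv ℝ φ z b)) _ y :=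
      (h1.clm_apply (hv a)).clm_apply (hv b)
    rw [← fderiv_clm_apply₂ hS₁, (h2.congr_of_eventuallyEq (by
      filter_upwards [hpull] with z hz using hz a b)).fderiv]
    simp
    ring
  unfold firstKind
  rw [hd, hd, hd, hsnd w v, hsnd v u, hsnd w u, hsymm (fderiv ℝ (fderiv ℝ φ) y u w),
    hsymm (fderiv ℝ (fderiv ℝ φ) y u v)]
  ring

end FirstKind

section Coordinates

variable {n : ℕ}

theorem sum_smul_basisVec (x : Coord n) : ∑ i, x i • basisVec i = x := by
  ext j
  simp [basisVec, Pi.single_apply]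

/-- A linear function that vanishes on the basis vectors vanishes. -/
theorem eq_zero_of_basisVec {f : Coord n → ℝ} (hadd : ∀ x y, f (x + y) = f x + f y)
    (hsmul : ∀ (c : ℝ) x, f (c • x) = c * f x) (h : ∀ i, f (basisVec i) = 0) (x : Coord n) :
    f x = 0 := by
  let F : Coord n →ₗ[ℝ] ℝ := ⟨⟨f, hadd⟩, fun c x => hsmul c x⟩
  change F x = 0
  rw [← sum_smul_basisVec x, map_sum]
  refine Finset.sum_eq_zero fun i _ => ?_
  rw [map_smul]
  change x i • f (basisVec i) = 0
  rw [h, smul_zero]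

variable {G S : Coord n → Coord n →L[ℝ] Coord n →L[ℝ] ℝ}

/-- The matrix of a field of bilinear forms in the standard basis. -/
def matrixOf (S : Coord n → Coord n →L[ℝ] Coord n →L[ℝ] ℝ) : CoordTensor n :=
  fun y => Matrix.of fun i j => S y (basisVec i) (basisVec j)

/-- `M_{abc}` is the Christoffel expression of the first kind of `P` minus that of the metric,
the latter with its first index contracted with `P_a^s`: the two remaining Christoffel terms
cancel by symmetry. -/
theorem coordM_eq {y : Coord n} (hG : DifferentiableAt ℝ G y) (hS : DifferentiableAt ℝ S y)
    (hGs : ∀ᶠ z in nhds y, ∀ u v, G z u v = G z v u)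
    (hSs : ∀ u v, S y u v = S y v u) (a b c : Fin n) :
    coordM (matrixOf G) (matrixOf S) y a b c =
      firstKind S y (basisVec a) (basisVec b) (basisVec c) -
      ∑ s, (matrixOf S y * (matrixOf G y)⁻¹) a s *
        firstKind G y (basisVec s) (basisVec b) (basisVec c) := by
  have hp : ∀ {S : Coord n → Coord n →L[ℝ] Coord n →L[ℝ] ℝ}, DifferentiableAt ℝ S y →
      ∀ i j k : Fin n, partialDeriv i (fun z => matrixOf S z j k) y =
        fderiv ℝ S y (basisVec i) (basisVec j) (basisVec k) :=
    fun hS i j k => fderiv_clm_apply₂ hS _ _ _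
  have hGd := fderiv_symm_of_symm hG hGs
  have hchr : ∀ r b c, christoffel (matrixOf G) y r b c =
      (1 / 2) * ∑ s, (matrixOf G y)⁻¹ r s *
        firstKind G y (basisVec s) (basisVec b) (basisVec c) := by
    intro r b c
    unfold christoffel firstKind
    congr 1
    refine Finset.sum_congr rfl fun s _ => ?_
    rw [hp hG, hp hG, hp hG, hGd _ (basisVec c) (basisVec s)]
  have hsym : ∀ r b c, christoffel (matrixOf G) y r b c = christoffel (matrixOf G) y r c b := by
    intro r b c
    rw [hchr, hchr]
    congr 1
    refine Finset.sum_congr rfl fun s _ => ?_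
    unfold firstKind
    rw [hGd (basisVec s) (basisVec b)]
    ring
  have hPs : ∀ i j, matrixOf S y i j = matrixOf S y j i := fun i j => hSs _ _
  have h1 : coordM (matrixOf G) (matrixOf S) y a b c =
      firstKind S y (basisVec a) (basisVec b) (basisVec c) -
        2 * ∑ r, christoffel (matrixOf G) y r b c * matrixOf S y a r := by
    unfold coordM covDeriv firstKind
    rw [hp hS, hp hS, hp hS]
    have e1 : ∑ r, christoffel (matrixOf G) y r a b * matrixOf S y r c =
        ∑ r, christoffel (matrixOf G) y r b a * matrixOf S y r c :=
      Finset.sum_congr rfl fun r _ => by rw [hsym]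
    have e2 : ∑ r, christoffel (matrixOf G) y r a c * matrixOf S y b r =
        ∑ r, christoffel (matrixOf G) y r c a * matrixOf S y r b :=
      Finset.sum_congr rfl fun r _ => by rw [hsym, hPs]
    have e3 : ∑ r, christoffel (matrixOf G) y r c b * matrixOf S y a r =
        ∑ r, christoffel (matrixOf G) y r b c * matrixOf S y a r :=
      Finset.sum_congr rfl fun r _ => by rw [hsym]
    rw [e1, e2, e3]
    ring
  rw [h1]
  congr 1
  simp only [Matrix.mul_apply, hchr, Finset.sum_mul, Finset.mul_sum]
  rw [Finset.sum_comm]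
  refine Finset.sum_congr rfl fun s _ => Finset.sum_congr rfl fun r _ => ?_
  ring

/-- The matrix of a nondegenerate bilinear form is invertible. -/
theorem isUnit_det_matrixOf {y : Coord n} (hGs : ∀ u v, G y u v = G y v u)
    (hnd : ∀ u, (∀ v, G y u v = 0) → u = 0) : IsUnit (matrixOf G y).det := by
  rw [isUnit_iff_ne_zero]
  intro h0
  obtain ⟨v, hv, hMv⟩ := Matrix.exists_mulVec_eq_zero_iff.2 h0
  apply hv
  have hx : WithLp.toLp 2 v = (0 : Coord n) := by
    apply hnd
    intro w
    refine eq_zero_of_basisVec (f := fun w => G y (WithLp.toLp 2 v) w) (by simp) (by simp) ?_ w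
    intro i
    have h := congrFun hMv i
    change G y (WithLp.toLp 2 v) (basisVec i) = 0
    rw [hGs, ← sum_smul_basisVec (WithLp.toLp 2 v : Coord n), map_sum]
    rw [Matrix.mulVec, dotProduct] at h
    simp only [Pi.zero_apply] at h
    rw [← h]
    refine Finset.sum_congr rfl fun j _ => ?_
    rw [map_smul, smul_eq_mul, mul_comm]
    rfl
  funext i
  exact congrArg (fun x : Coord n => x i) hx

/-- The endomorphism `u ↦ u'` with `g(u', ·) = P(u, ·)`, in matrix form `P_a^s = P_{ar} g^{rs}`. -/
theorem exists_raised {y : Coord n} (hdet : IsUnit (matrixOf G y).det) :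
    ∃ B : Coord n →ₗ[ℝ] Coord n,
      (∀ a, B (basisVec a) = ∑ s, (matrixOf S y * (matrixOf G y)⁻¹) a s • basisVec s) ∧
      ∀ u z, G y (B u) z = S y u z := by
  let B : Coord n →ₗ[ℝ] Coord n :=
    { toFun := fun u => ∑ a, u a • ∑ s, (matrixOf S y * (matrixOf G y)⁻¹) a s • basisVec s
      map_add' := fun x z => by
        simp only [PiLp.add_apply, add_smul, Finset.sum_add_distrib]
      map_smul' := fun c x => by
        simp only [PiLp.smul_apply, smul_eq_mul, Finset.smul_sum, mul_smul, RingHom.id_apply] }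
  have hBb : ∀ a, B (basisVec a) = ∑ s, (matrixOf S y * (matrixOf G y)⁻¹) a s • basisVec s := by
    intro a
    simp only [B, LinearMap.coe_mk, AddHom.coe_mk, basisVec, PiLp.single_apply, ite_smul, one_smul,
      zero_smul, Finset.sum_ite_eq', Finset.mem_univ, if_true]
  refine ⟨B, hBb, fun u z => ?_⟩
  rw [← sub_eq_zero]
  refine eq_zero_of_basisVec (f := fun u => G y (B u) z - S y u z) ?_ ?_ (fun a => ?_) u
  · intro x x'; simp; ring
  · intro c x; simp; ring
  refine eq_zero_of_basisVec (f := fun z => G y (B (basisVec a)) z - S y (basisVec a) z)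
    ?_ ?_ (fun t => ?_) z
  · intro x x'; simp; ring
  · intro c x; simp; ring
  have h : (matrixOf S y * (matrixOf G y)⁻¹ * matrixOf G y) a t = matrixOf S y a t := by
    rw [Matrix.mul_assoc, Matrix.nonsing_inv_mul _ hdet, Matrix.mul_one]
  rw [sub_eq_zero]
  change _ = matrixOf S y a t
  rw [← h, hBb, Matrix.mul_apply]
  simp only [map_sum, map_smul, sum_apply, smul_apply, smul_eq_mul]
  rfl

/-- The identity `M_{abc} = E_a P_{bc} / p - W_a Π_{bc} / (n - p)`, free of indices. The vector
`u'` is `u` with its index moved through the projector, `g(u', ·) = P(u, ·)`. -/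
def SeparationIdentity (p : ℕ) (G S : Coord n → Coord n →L[ℝ] Coord n →L[ℝ] ℝ)
    (E W : Coord n →L[ℝ] ℝ) (y : Coord n) : Prop :=
  ∀ u u' v w, (∀ z, G y u' z = S y u z) →
    firstKind S y u v w - firstKind G y u' v w =
      1 / (p : ℝ) * E u * S y v w - 1 / ((n : ℝ) - p) * W u * (G y v w - S y v w)

set_option synthInstance.maxHeartbeats 200000 in
set_option maxHeartbeats 1000000 in
/-- The components of `T = 0` in one chart; multilinearity passes from the basis vectors to
arbitrary vectors. -/
theorem separationIdentity_of_coordT {p : ℕ} {y : Coord n} (hG : DifferentiableAt ℝ G y)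
    (hS : DifferentiableAt ℝ S y) (hGs : ∀ᶠ z in nhds y, ∀ u v, G z u v = G z v u)
    (hSs : ∀ u v, S y u v = S y v u)
    (hnd : ∀ u, (∀ v, G y u v = 0) → u = 0) {E W : Coord n →L[ℝ] ℝ}
    (hE : ∀ a, E (basisVec a) = coordE (matrixOf G) (matrixOf S) y a)
    (hW : ∀ a, W (basisVec a) = coordW (matrixOf G) (matrixOf S) y a)
    (hT : ∀ a b c, coordT p (matrixOf G) (matrixOf S) y a b c = 0) :
    SeparationIdentity p G S E W y := by
  have hGsy := hGs.self_of_nhds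
  have hdet := isUnit_det_matrixOf hGsy hnd
  obtain ⟨B, hBb, hBG⟩ := exists_raised (S := S) hdet
  intro u u' v w hu
  have huB : u' = B u := by
    rw [← sub_eq_zero]
    apply hnd
    intro z
    rw [map_sub, sub_apply, hu, hBG, sub_self]
  rw [huB, ← sub_eq_zero]
  refine eq_zero_of_basisVec (f := fun u => firstKind S y u v w - firstKind G y (B u) v w -
    (1 / (p : ℝ) * E u * S y v w - 1 / ((n : ℝ) - p) * W u * (G y v w - S y v w)))
    ?_ ?_ (fun a => ?_) u
  · intro x x'; simp only [firstKind, map_add, add_apply]; ring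
  · intro c x; simp only [firstKind, map_smul, smul_apply, smul_eq_mul]; ring
  refine eq_zero_of_basisVec (f := fun v => firstKind S y (basisVec a) v w -
    firstKind G y (B (basisVec a)) v w - (1 / (p : ℝ) * E (basisVec a) * S y v w -
      1 / ((n : ℝ) - p) * W (basisVec a) * (G y v w - S y v w))) ?_ ?_ (fun b => ?_) v
  · intro x x'; simp only [firstKind, map_add, add_apply]; ring
  · intro c x; simp only [firstKind, map_smul, smul_apply, smul_eq_mul]; ring
  refine eq_zero_of_basisVec (f := fun w => firstKind S y (basisVec a) (basisVec b) w -
    firstKind G y (B (basisVec a)) (basisVec b) w - (1 / (p : ℝ) * E (basisVec a) *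
      S y (basisVec b) w - 1 / ((n : ℝ) - p) * W (basisVec a) *
        (G y (basisVec b) w - S y (basisVec b) w))) ?_ ?_ (fun c => ?_) w
  · intro x x'; simp only [firstKind, map_add, add_apply]; ring
  · intro c x; simp only [firstKind, map_smul, smul_apply, smul_eq_mul]; ring
  have h := hT a b c
  rw [coordT, coordM_eq hG hS hGs hSs, ← hE, ← hW] at h
  have hfk : firstKind G y (B (basisVec a)) (basisVec b) (basisVec c) =
      ∑ s, (matrixOf S y * (matrixOf G y)⁻¹) a s *
        firstKind G y (basisVec s) (basisVec b) (basisVec c) := by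
    rw [hBb]
    simp only [firstKind, map_sum, map_smul, sum_apply,
      smul_apply, smul_eq_mul, mul_add, mul_sub, Finset.sum_add_distrib,
      Finset.sum_sub_distrib]
  rw [hfk]
  have e1 : matrixOf S y b c = S y (basisVec b) (basisVec c) := rfl
  have e2 : (matrixOf G y - matrixOf S y) b c =
      G y (basisVec b) (basisVec c) - S y (basisVec b) (basisVec c) := rfl
  rw [e1, e2] at h
  linarith

end Coordinates

/-! ### Geometric content of the identity: involutive, umbilical distributions -/

section Umbilical

variable {n p : ℕ} {G S : Coord n → Coord n →L[ℝ] Coord n →L[ℝ] ℝ} {E W : Coord n →L[ℝ] ℝ}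
  {y : Coord n}

/-- The field `A = g⁻¹ P` of endomorphisms is smooth. -/
theorem exists_projector_field {Ω : Set (Coord n)}
    (hG : ContDiffOn ℝ ∞ G Ω) (hS : ContDiffOn ℝ ∞ S Ω)
    (hnd : ∀ y ∈ Ω, ∀ u, (∀ v, G y u v = 0) → u = 0) :
    ∃ A : Coord n → Coord n →L[ℝ] Coord n, ContDiffOn ℝ ∞ A Ω ∧
      ∀ y ∈ Ω, ∀ u v, G y (A y u) v = S y u v := by
  have hequiv : ∀ y ∈ Ω, ∃ L : Coord n ≃L[ℝ] (Coord n →L[ℝ] ℝ),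
      (L : Coord n →L[ℝ] (Coord n →L[ℝ] ℝ)) = G y := by
    intro y hy
    have hinj : Function.Injective (G y : Coord n →ₗ[ℝ] (Coord n →L[ℝ] ℝ)) := by
      rw [injective_iff_map_eq_zero]
      intro u hu
      exact hnd y hy u fun v => congrArg (fun T => T v) hu
    have hdim : Module.finrank ℝ (Coord n) = Module.finrank ℝ (Coord n →L[ℝ] ℝ) := by
      rw [← (LinearMap.toContinuousLinearMap (𝕜 := ℝ) (E := Coord n) (F' := ℝ)).finrank_eq]
      exact (Subspace.dual_finrank_eq (K := ℝ) (V := Coord n)).symm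
    refine ⟨(LinearEquiv.ofInjectiveOfFinrankEq _ hinj hdim).toContinuousLinearEquiv, ?_⟩
    ext u v
    rfl
  refine ⟨fun y => (ContinuousLinearMap.inverse (G y)).comp (S y), ?_, ?_⟩
  · intro y hy
    obtain ⟨L, hL⟩ := hequiv y hy
    have h1 : ContDiffAt ℝ ∞ (ContinuousLinearMap.inverse :
        (Coord n →L[ℝ] (Coord n →L[ℝ] ℝ)) → _) (G y) := by
      rw [← hL]
      exact contDiffAt_map_inverse L
    exact (h1.comp_contDiffWithinAt y (hG y hy)).clm_comp (hS y hy)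
  · intro y hy u v
    obtain ⟨L, hL⟩ := hequiv y hy
    have h1 : ∀ f, G y (ContinuousLinearMap.inverse (G y) f) = f := by
      intro f
      rw [← hL, ContinuousLinearMap.inverse_equiv]
      exact L.apply_symm_apply f
    exact congrArg (fun T => T v) (h1 (S y u))

/-- The trace of `A = g⁻¹ P` is the trace of the matrix product. -/
theorem trace_raised (hdet : IsUnit (matrixOf G y).det)
    (hnd : ∀ u, (∀ v, G y u v = 0) → u = 0) {A : Coord n →L[ℝ] Coord n}
    (hA : ∀ u v, G y (A u) v = S y u v) :
    LinearMap.trace ℝ (Coord n) (A : Coord n →ₗ[ℝ] Coord n) =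
      Matrix.trace ((matrixOf G y)⁻¹ * matrixOf S y) := by
  obtain ⟨B, hBb, hBG⟩ := exists_raised (S := S) hdet
  have hAB : ∀ u, A u = B u := by
    intro u
    rw [← sub_eq_zero]
    apply hnd
    intro v
    rw [map_sub, sub_apply, hA, hBG, sub_self]
  rw [LinearMap.trace_eq_matrix_trace ℝ (EuclideanSpace.basisFun (Fin n) ℝ).toBasis,
    Matrix.trace_mul_comm]
  refine Finset.sum_congr rfl fun a _ => ?_
  have h : (A : Coord n →ₗ[ℝ] Coord n) (basisVec a) =
      ∑ s, (matrixOf S y * (matrixOf G y)⁻¹) a s • basisVec s := (hAB _).trans (hBb a)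
  rw [Matrix.diag_apply, LinearMap.toMatrix_apply]
  simp only [OrthonormalBasis.coe_toBasis, EuclideanSpace.basisFun_apply]
  change ((EuclideanSpace.basisFun (Fin n) ℝ).toBasis.repr
    ((A : Coord n →ₗ[ℝ] Coord n) (basisVec a))) a = _
  rw [h]
  simp [basisVec]

set_option synthInstance.maxHeartbeats 200000 in
theorem firstKind_zero : ∀ v w, firstKind G y 0 v w = 0 := by
  intro v w
  simp only [firstKind, map_zero, zero_apply]
  ring

/-- The mixed components of the identity say that the range and the kernel of the projector
`A = g⁻¹ P` are involutive. -/
theorem involutive_of_separationIdentity {Ω : Set (Coord n)} (hΩ : IsOpen Ω)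
    (hG : ContDiffOn ℝ ∞ G Ω) (hS : ContDiffOn ℝ ∞ S Ω)
    (hGs : ∀ y ∈ Ω, ∀ u v, G y u v = G y v u) (hSs : ∀ y ∈ Ω, ∀ u v, S y u v = S y v u)
    (hnd : ∀ y ∈ Ω, ∀ u, (∀ v, G y u v = 0) → u = 0)
    {A : Coord n → Coord n →L[ℝ] Coord n} (hA : ContDiffOn ℝ ∞ A Ω)
    (hAG : ∀ y ∈ Ω, ∀ u v, G y (A y u) v = S y u v) (hAA : ∀ y ∈ Ω, A y * A y = A y)
    (hy : y ∈ Ω) (hid : SeparationIdentity p G S E W y) :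
    (∀ u v, A y u = u → A y v = v → fderiv ℝ A y u v = fderiv ℝ A y v u) ∧
    (∀ u v, A y u = 0 → A y v = 0 → fderiv ℝ A y u v = fderiv ℝ A y v u) := by
  have hyn := hΩ.mem_nhds hy
  have hGd : DifferentiableAt ℝ G y := (hG.contDiffAt hyn).differentiableAt (by simp)
  have hSd : DifferentiableAt ℝ S y := (hS.contDiffAt hyn).differentiableAt (by simp)
  have hAd : HasFDerivAt A (fderiv ℝ A y) y :=
    ((hA.contDiffAt hyn).differentiableAt (by simp)).hasFDerivAt
  have hAs : ∀ u v, G y (A y u) v = G y u (A y v) := by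
    intro u v
    rw [hAG y hy, hSs y hy, ← hAG y hy, hGs y hy]
  have hA1 : ∀ u, HasFDerivAt (fun z => A z u) _ y := fun u =>
    hAd.clm_apply (hasFDerivAt_const u y)
  -- the product rule for `P = g(A ·, ·)`
  have hDS : ∀ w u v, fderiv ℝ S y w u v =
      fderiv ℝ G y w (A y u) v + G y (fderiv ℝ A y w u) v := by
    intro w u v
    have h2 : HasFDerivAt (fun z => G z (A z u) v) _ y :=
      (hGd.hasFDerivAt.clm_apply (hA1 u)).clm_apply (hasFDerivAt_const v y)
    have h3 : HasFDerivAt (fun z => S z u v) _ y :=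
      (hSd.hasFDerivAt.clm_apply (hasFDerivAt_const u y)).clm_apply (hasFDerivAt_const v y)
    have h4 := h3.unique (h2.congr_of_eventuallyEq (by
      filter_upwards [hyn] with z hz using (hAG z hz u v).symm))
    have h5 := congrArg (fun T => T w) h4
    simp at h5
    rw [h5]
    ring
  -- the product rule for `A A = A`
  have hDA : ∀ w x, A y (fderiv ℝ A y w x) + fderiv ℝ A y w (A y x) = fderiv ℝ A y w x := by
    intro w x
    have h2 : HasFDerivAt (fun z => A z (A z x)) _ y := hAd.clm_apply (hA1 x)
    have h4 := h2.unique ((hA1 x).congr_of_eventuallyEq (by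
      filter_upwards [hyn] with z hz using congrArg (fun T => T x) (hAA z hz)))
    have h5 := congrArg (fun T => T w) h4
    simpa using h5
  have hAAx : ∀ x, A y (A y x) = A y x := fun x => congrArg (fun T => T x) (hAA y hy)
  constructor
  · intro u v hu hv
    have hr : ∀ w, ∀ x, A y x = x → A y (fderiv ℝ A y w x) = 0 := by
      intro w x hx
      have h := hDA w x
      rw [hx] at h
      exact add_eq_right.1 h
    have key : ∀ w, A y w = 0 → G y (fderiv ℝ A y u v - fderiv ℝ A y v u) w = 0 := by
      intro w hw
      have h := hid u u v w (fun z => by rw [← hAG y hy, hu])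
      have e1 : S y v w = 0 := by rw [← hAG y hy, hAs, hw, map_zero]
      have e2 : G y v w = 0 := by rw [← hv, hAs, hw, map_zero]
      have e3 : G y (fderiv ℝ A y w u) v = 0 := by
        rw [← hv, ← hAs, hr w u hu, map_zero, zero_apply]
      simp only [firstKind, hDS, hu, hv, e1, e2, e3, sub_zero, mul_zero, add_zero] at h
      rw [map_sub, sub_apply]
      linarith
    rw [← sub_eq_zero]
    apply hnd y hy
    intro w
    have h1 : A y (fderiv ℝ A y u v - fderiv ℝ A y v u) = 0 := by
      rw [map_sub, hr u v hv, hr v u hu, sub_zero]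
    have h2 := key (w - A y w) (by rw [map_sub, hAAx, sub_self])
    rw [map_sub, ← hAs, h1, map_zero, zero_apply, sub_zero] at h2
    exact h2
  · intro u v hu hv
    have hr : ∀ w, ∀ x, A y x = 0 → A y (fderiv ℝ A y w x) = fderiv ℝ A y w x := by
      intro w x hx
      have h := hDA w x
      rw [hx, map_zero, add_zero] at h
      exact h
    have key : ∀ w, A y w = w → G y (fderiv ℝ A y u v - fderiv ℝ A y v u) w = 0 := by
      intro w hw
      have h := hid u 0 v w (fun z => by rw [← hAG y hy, hu])
      have e1 : S y v w = 0 := by rw [← hAG y hy, hv, map_zero, zero_apply]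
      have e2 : G y v w = 0 := by rw [← hw, ← hAs, hv, map_zero, zero_apply]
      have e3 : G y (fderiv ℝ A y w u) v = 0 := by
        rw [← hr w u hu, hAs, hv, map_zero]
      rw [firstKind_zero] at h
      simp only [firstKind, hDS, hu, hv, e1, e2, e3, sub_zero, mul_zero, add_zero, map_zero,
        zero_apply, zero_add] at h
      rw [map_sub, sub_apply]
      linarith
    rw [← sub_eq_zero]
    apply hnd y hy
    intro w
    have h1 : A y (fderiv ℝ A y u v - fderiv ℝ A y v u) =
        fderiv ℝ A y u v - fderiv ℝ A y v u := by
      rw [map_sub, hr u v hv, hr v u hu]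
    have h2 := key (A y w) (hAAx w)
    rw [← hAs, h1] at h2
    exact h2

/-- At `y`, the first `p` coordinate vectors lie in the range of the projector `g⁻¹ P` and the
others in its kernel. -/
structure IsAdaptedAt (p : ℕ) (G S : Coord n → Coord n →L[ℝ] Coord n →L[ℝ] ℝ) (y : Coord n) :
    Prop where
  fst : ∀ i : Fin n, i.val < p → ∀ v, S y (basisVec i) v = G y (basisVec i) v
  snd : ∀ i : Fin n, p ≤ i.val → ∀ v, S y (basisVec i) v = 0

theorem IsAdaptedAt.mixed (h : IsAdaptedAt p G S y) (hSs : ∀ u v, S y u v = S y v u)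
    {i j : Fin n} (hi : i.val < p) (hj : p ≤ j.val) : G y (basisVec i) (basisVec j) = 0 := by
  rw [← h.fst i hi, hSs, h.snd j hj]

theorem IsAdaptedAt.exists_fst_ne_zero (h : IsAdaptedAt p G S y)
    (hSs : ∀ u v, S y u v = S y v u) (hnd : ∀ u, (∀ v, G y u v = 0) → u = 0)
    {i : Fin n} (hi : i.val < p) :
    ∃ j : Fin n, j.val < p ∧ G y (basisVec i) (basisVec j) ≠ 0 := by
  by_contra! hcon
  have h0 : (basisVec i : Coord n) = 0 := by
    apply hnd
    refine eq_zero_of_basisVec (by simp) (by simp) fun j => ?_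
    rcases lt_or_ge j.val p with hj | hj
    · exact hcon j hj
    · exact h.mixed hSs hi hj
  have := congrArg (fun x : Coord n => x i) h0
  simp [basisVec] at this

theorem IsAdaptedAt.exists_snd_ne_zero (h : IsAdaptedAt p G S y)
    (hGs : ∀ u v, G y u v = G y v u)
    (hSs : ∀ u v, S y u v = S y v u) (hnd : ∀ u, (∀ v, G y u v = 0) → u = 0)
    {i : Fin n} (hi : p ≤ i.val) :
    ∃ j : Fin n, p ≤ j.val ∧ G y (basisVec i) (basisVec j) ≠ 0 := by
  by_contra! hcon
  have h0 : (basisVec i : Coord n) = 0 := by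
    apply hnd
    refine eq_zero_of_basisVec (by simp) (by simp) fun j => ?_
    rcases lt_or_ge j.val p with hj | hj
    · rw [hGs]
      exact h.mixed hSs hj hi
    · exact hcon j hj
  have := congrArg (fun x : Coord n => x i) h0
  simp [basisVec] at this

/-- In adapted coordinates the identity says: `E_α = 0`, `W_A = 0`,
`∂_A P_{αβ} = - E_A P_{αβ} / p` and `∂_α Π_{AB} = - W_α Π_{AB} / (n - p)`. -/
theorem umbilical_of_separationIdentity (hp : 0 < p) (hpn : p < n) {Ω : Set (Coord n)}
    (hΩ : IsOpen Ω) (hG : DifferentiableAt ℝ G y) (hS : DifferentiableAt ℝ S y)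
    (hGs : ∀ y ∈ Ω, ∀ u v, G y u v = G y v u) (hSs : ∀ y ∈ Ω, ∀ u v, S y u v = S y v u)
    (hnd : ∀ u, (∀ v, G y u v = 0) → u = 0) (had : ∀ y ∈ Ω, IsAdaptedAt p G S y)
    (hy : y ∈ Ω) (hid : SeparationIdentity p G S E W y) :
    (∀ i : Fin n, i.val < p → E (basisVec i) = 0) ∧
    (∀ i : Fin n, p ≤ i.val → W (basisVec i) = 0) ∧
    (∀ i j k : Fin n, p ≤ i.val → j.val < p → k.val < p →
      fderiv ℝ S y (basisVec i) (basisVec j) (basisVec k) =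
        -(1 / (p : ℝ)) * E (basisVec i) * S y (basisVec j) (basisVec k)) ∧
    (∀ i j k : Fin n, i.val < p → p ≤ j.val → p ≤ k.val →
      fderiv ℝ G y (basisVec i) (basisVec j) (basisVec k) =
        -(1 / ((n : ℝ) - p)) * W (basisVec i) * G y (basisVec j) (basisVec k)) := by
  have hyn := hΩ.mem_nhds hy
  have hSsym := fderiv_symm_of_symm hS (by filter_upwards [hyn] with z hz using hSs z hz)
  have hGsym := fderiv_symm_of_symm hG (by filter_upwards [hyn] with z hz using hGs z hz)
  have hSy := hSs y hy
  have hGy := hGs y hy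
  have hp0 : (p : ℝ) ≠ 0 := by exact_mod_cast hp.ne'
  have hnp0 : (n : ℝ) - p ≠ 0 := sub_ne_zero.2 (by exact_mod_cast hpn.ne')
  have hd : ∀ {T : Coord n → Coord n →L[ℝ] Coord n →L[ℝ] ℝ}, DifferentiableAt ℝ T y →
      ∀ u v, HasFDerivAt (fun z => T z u v) _ y := fun hT u v =>
    (hT.hasFDerivAt.clm_apply (hasFDerivAt_const u y)).clm_apply (hasFDerivAt_const v y)
  have hSsnd : ∀ i : Fin n, p ≤ i.val → ∀ w v, fderiv ℝ S y w (basisVec i) v = 0 := by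
    intro i hi w v
    have h := (hd hS (basisVec i) v).unique ((hasFDerivAt_const (0 : ℝ) y).congr_of_eventuallyEq
      (by filter_upwards [hyn] with z hz using (had z hz).snd i hi v))
    simpa using congrArg (fun T => T w) h
  have hSfst : ∀ i : Fin n, i.val < p → ∀ w v,
      fderiv ℝ S y w (basisVec i) v = fderiv ℝ G y w (basisVec i) v := by
    intro i hi w v
    have h := (hd hS (basisVec i) v).unique ((hd hG (basisVec i) v).congr_of_eventuallyEq
      (by filter_upwards [hyn] with z hz using (had z hz).fst i hi v))
    simpa using congrArg (fun T => T w) h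
  have ha := had y hy
  have hlast : ∀ i j k : Fin n, p ≤ i.val →
      -fderiv ℝ S y (basisVec i) (basisVec j) (basisVec k) =
      1 / (p : ℝ) * E (basisVec i) * S y (basisVec j) (basisVec k)
        - 1 / ((n : ℝ) - p) * W (basisVec i) *
          (G y (basisVec j) (basisVec k) - S y (basisVec j) (basisVec k)) := by
    intro i j k hi
    have h := hid (basisVec i) 0 (basisVec j) (basisVec k) (fun z => by
      rw [ha.snd i hi, map_zero, zero_apply])
    rw [← h, firstKind_zero, firstKind, hSsnd i hi, hSsnd i hi]
    ring
  have hfirst : ∀ i j k : Fin n, i.val < p →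
      fderiv ℝ G y (basisVec i) (basisVec j) (basisVec k)
        - fderiv ℝ S y (basisVec i) (basisVec j) (basisVec k) =
      1 / (p : ℝ) * E (basisVec i) * S y (basisVec j) (basisVec k)
        - 1 / ((n : ℝ) - p) * W (basisVec i) *
          (G y (basisVec j) (basisVec k) - S y (basisVec j) (basisVec k)) := by
    intro i j k hi
    have h := hid (basisVec i) (basisVec i) (basisVec j) (basisVec k) (fun z => by
      rw [ha.fst i hi])
    rw [← h, firstKind, firstKind, hSfst i hi, hSfst i hi]
    ring
  refine ⟨fun i hi => ?_, fun i hi => ?_, fun i j k hi hj hk => ?_, fun i j k hi hj hk => ?_⟩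
  · obtain ⟨k, hk, hne⟩ := ha.exists_fst_ne_zero hSy hnd hi
    have h := hfirst i i k hi
    rw [hSfst i hi, ha.fst i hi, sub_self, sub_self, mul_zero, sub_zero] at h
    have h1 : 1 / (p : ℝ) * E (basisVec i) * G y (basisVec i) (basisVec k) = 0 := h.symm
    simpa [hp0, hne] using h1
  · obtain ⟨k, hk, hne⟩ := ha.exists_snd_ne_zero hGy hSy hnd hi
    have h := hlast i i k hi
    rw [hSsnd i hi, ha.snd i hi, mul_zero, sub_zero, zero_sub, neg_zero] at h
    have h1 : 1 / ((n : ℝ) - p) * W (basisVec i) * G y (basisVec i) (basisVec k) = 0 := by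
      linarith
    simpa [hnp0, hne] using h1
  · have h := hlast i j k hi
    rw [ha.fst j hj, sub_self, mul_zero, sub_zero] at h
    rw [ha.fst j hj]
    linarith
  · have h := hfirst i j k hi
    rw [hSsnd j hj, ha.snd j hj, mul_zero, sub_zero, sub_zero, zero_sub] at h
    rw [h]
    ring

end Umbilical

/-! ### The identity in every chart, and adapted charts -/

section ManifoldIdentity

variable {n p : ℕ} {V : Type*} [TopologicalSpace V] [ChartedSpace (Coord n) V]
  [IsManifold (𝓡 n) ∞ V]

omit [IsManifold (𝓡 n) ∞ V] in
theorem components_eq (e : OpenPartialHomeomorph V (Coord n)) (B : BilinField n V) :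
    components e B = matrixOf (pull e B) := rfl

omit [IsManifold (𝓡 n) ∞ V] in
/-- The coordinate components of the 1-form `η_a dx^a` are the `η_a`. -/
theorem covectorOf_chartDeriv {c : OpenPartialHomeomorph V (Coord n)}
    (hc : c ∈ IsManifold.maximalAtlas (𝓡 n) ∞ V) {y : Coord n} (hy : y ∈ c.target)
    (w : Fin n → ℝ) (a : Fin n) :
    formAt (fun x => covectorOf c x w) (c.symm y) (chartDeriv c y (basisVec a)) = w a := by
  let D : Coord n →L[ℝ] Coord n := mfderiv (𝓡 n) (𝓡 n) c (c.symm y)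
  have h : D.comp (chartDeriv c y) = ContinuousLinearMap.id ℝ (Coord n) :=
    (mdifferentiable_of_mem_maximalAtlas hc).comp_symm_deriv hy
  have h1 : D (chartDeriv c y (basisVec a)) = basisVec a := congrArg (fun T => T (basisVec a)) h
  have h2 : formAt (fun x => covectorOf c x w) (c.symm y) =
      ∑ b, w b • (EuclideanSpace.proj b : Coord n →L[ℝ] ℝ).comp D := rfl
  rw [h2]
  simp only [sum_apply, smul_apply, ContinuousLinearMap.comp_apply, h1]
  simp [basisVec]

omit [IsManifold (𝓡 n) ∞ V] in
theorem pullForm_covectorOf {c : OpenPartialHomeomorph V (Coord n)}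
    (hc : c ∈ IsManifold.maximalAtlas (𝓡 n) ∞ V) {x : V} (hx : x ∈ c.source)
    {η : ∀ x : V, TangentSpace (𝓡 n) x →L[ℝ] ℝ} {w : Fin n → ℝ} (hη : η x = covectorOf c x w)
    (a : Fin n) : pullForm c η (c x) (basisVec a) = w a := by
  have hpt : c.symm (c x) = x := c.left_inv hx
  have h1 : formAt η (c.symm (c x)) = formAt (fun x => covectorOf c x w) (c.symm (c x)) := by
    rw [congrArg (formAt η) hpt, congrArg (formAt fun x => covectorOf c x w) hpt]
    exact hη
  rw [pullForm, ContinuousLinearMap.comp_apply, h1]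
  exact covectorOf_chartDeriv hc (c.map_source hx) w a

theorem pullForm_formE_chartAt (g : PseudoMetric n V) (P : BilinField n V) (x : V) (a : Fin n) :
    pullForm (chartAt (Coord n) x) (formE g P) (chartAt (Coord n) x x) (basisVec a) =
      coordE (components (chartAt (Coord n) x) g.form) (components (chartAt (Coord n) x) P)
        (chartAt (Coord n) x x) a :=
  pullForm_covectorOf (IsManifold.chart_mem_maximalAtlas x) (mem_chart_source _ x)
    (by rw [formE]) a

theorem pullForm_formW_chartAt (g : PseudoMetric n V) (P : BilinField n V) (x : V) (a : Fin n) :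
    pullForm (chartAt (Coord n) x) (formW g P) (chartAt (Coord n) x x) (basisVec a) =
      coordW (components (chartAt (Coord n) x) g.form) (components (chartAt (Coord n) x) P)
        (chartAt (Coord n) x x) a :=
  pullForm_covectorOf (IsManifold.chart_mem_maximalAtlas x) (mem_chart_source _ x)
    (by rw [formW]) a

theorem contDiffOn_pull_metric {e : OpenPartialHomeomorph V (Coord n)}
    (he : e ∈ IsManifold.maximalAtlas (𝓡 n) ∞ V) (g : PseudoMetric n V) :
    ContDiffOn ℝ ∞ (pull e g.form) e.target := by
  have h := contDiffOn_pull he g.smooth isOpen_univ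
  rwa [Set.preimage_univ, Set.inter_univ] at h

/-- The tensor identity `T = 0` holds in every chart, because the inhomogeneous terms in the
transformation laws of the two Christoffel expressions cancel. -/
theorem separationIdentity_pull {g : PseudoMetric n V} {P : BilinField n V} {U : Set V}
    (hU : IsOpen U) (hP : IsOrthogonalProjector g P p U)
    (hT : ∀ x ∈ U, ∀ a b c, tensorT g P p x a b c = 0)
    {e : OpenPartialHomeomorph V (Coord n)} (he : e ∈ IsManifold.maximalAtlas (𝓡 n) ∞ V)
    {y : Coord n} (hy : y ∈ e.target) (hyU : e.symm y ∈ U) :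
    SeparationIdentity p (pull e g.form) (pull e P) (pullForm e (formE g P) y)
      (pullForm e (formW g P) y) y := by
  set x := e.symm y with hx
  set c := chartAt (Coord n) x with hc
  have hcA : c ∈ IsManifold.maximalAtlas (𝓡 n) ∞ V := IsManifold.chart_mem_maximalAtlas x
  have hxc : x ∈ c.source := mem_chart_source _ x
  have hpt : c.symm (c x) = x := c.left_inv hxc
  have hcx : c x ∈ c.target := c.map_source hxc
  have hdiffG : ∀ {e : OpenPartialHomeomorph V (Coord n)} {y : Coord n},
      e ∈ IsManifold.maximalAtlas (𝓡 n) ∞ V → y ∈ e.target →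
      DifferentiableAt ℝ (pull e g.form) y := fun he hy =>
    ((contDiffOn_pull_metric he g).contDiffAt
      (OpenPartialHomeomorph.open_target _ |>.mem_nhds hy)).differentiableAt (by simp)
  have hdiffP : ∀ {e : OpenPartialHomeomorph V (Coord n)} {y : Coord n},
      e ∈ IsManifold.maximalAtlas (𝓡 n) ∞ V → y ∈ e.target → e.symm y ∈ U →
      DifferentiableAt ℝ (pull e P) y := fun {e y} he hy hyU =>
    ((contDiffOn_pull he hP.smooth hU).contDiffAt
      ((isOpen_chart_preimage e hU).mem_nhds ⟨hy, hyU⟩)).differentiableAt (by simp)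
  have hGs : ∀ (e : OpenPartialHomeomorph V (Coord n)) (z u v : Coord n),
      pull e g.form z u v = pull e g.form z v u := fun e z u v => g.symm _ _ _
  have hbase : SeparationIdentity p (pull c g.form) (pull c P) (pullForm c (formE g P) (c x))
      (pullForm c (formW g P) (c x)) (c x) := by
    refine separationIdentity_of_coordT (hdiffG hcA hcx) (hdiffP hcA hcx (by rwa [hpt]))
      (Filter.Eventually.of_forall (hGs c)) (pull_symm hP.symm (by rwa [hpt]))
      (fun u hu => pull_nondegenerate hcA g hcx hu)
      (fun a => by rw [← components_eq, ← components_eq, hc, pullForm_formE_chartAt g P x a])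
      (fun a => by rw [← components_eq, ← components_eq, hc, pullForm_formW_chartAt g P x a]) ?_
    simpa only [tensorT, components_eq] using hT x hyU
  have hyc : y ∈ e.target ∩ e.symm ⁻¹' c.source := ⟨hy, hxc⟩
  set φ : Coord n → Coord n := fun y => c (e.symm y) with hφ
  have hDo := isOpen_chart_preimage e c.open_source
  have hφs : ContDiffAt ℝ ∞ φ y := (contDiffOn_transition he hcA).contDiffAt (hDo.mem_nhds hyc)
  have hev : ∀ B : BilinField n V, ∀ᶠ z in nhds y, ∀ u v,
      pull e B z u v = pull c B (φ z) (fderiv ℝ φ z u) (fderiv ℝ φ z v) := by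
    intro B
    filter_upwards [hDo.mem_nhds hyc] with z hz u v
    rw [pull_transition he hcA B hz]
    rfl
  intro u u' v w hu
  have hu2 : ∀ z, pull c g.form (φ y) (fderiv ℝ φ y u') z =
      pull c P (φ y) (fderiv ℝ φ y u) z := by
    intro z
    obtain ⟨z, rfl⟩ := fderiv_transition_surjective he hcA hyc z
    have h := hu z
    rwa [(hev g.form).self_of_nhds, (hev P).self_of_nhds] at h
  -- the second derivatives of `φ` contribute `2 P(u, ·)` and `2 g(u', ·)`, which agree by `hu2`
  rw [firstKind_transition hφs (hdiffP hcA hcx (by rwa [hpt])) (hdiffP he hy hyU) (hev P)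
      (pull_symm hP.symm (by rwa [hpt])),
    firstKind_transition hφs (hdiffG hcA hcx) (hdiffG he hy) (hev g.form) (hGs c _),
    hu2, (hev g.form).self_of_nhds, (hev P).self_of_nhds,
    pullForm_transition he hcA _ hyc, pullForm_transition he hcA _ hyc]
  have h := hbase (fderiv ℝ φ y u) (fderiv ℝ φ y u') (fderiv ℝ φ y v) (fderiv ℝ φ y w) hu2
  simp only [ContinuousLinearMap.comp_apply]
  rw [← h]
  ring

/-- The projector identity `P_{ar} P^r_b = P_{ab}` without indices, in every chart. -/
theorem idem_pull {g : PseudoMetric n V} {P : BilinField n V} {U : Set V}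
    (hP : IsOrthogonalProjector g P p U) {e : OpenPartialHomeomorph V (Coord n)}
    (he : e ∈ IsManifold.maximalAtlas (𝓡 n) ∞ V) {y : Coord n} (hy : y ∈ e.target)
    (hyU : e.symm y ∈ U) {u u' : Coord n} (hu : ∀ z, pull e g.form y u' z = pull e P y u z)
    (z : Coord n) : pull e P y u' z = pull e P y u z := by
  set x := e.symm y with hx
  set c := chartAt (Coord n) x with hc
  have hcA : c ∈ IsManifold.maximalAtlas (𝓡 n) ∞ V := IsManifold.chart_mem_maximalAtlas x
  have hxc : x ∈ c.source := mem_chart_source _ x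
  have hcx : c x ∈ c.target := c.map_source hxc
  have hyc : y ∈ e.target ∩ e.symm ⁻¹' c.source := ⟨hy, hxc⟩
  have hnd : ∀ u, (∀ v, pull c g.form (c x) u v = 0) → u = 0 :=
    fun u hu => pull_nondegenerate hcA g hcx hu
  have hdet := isUnit_det_matrixOf (fun u v => g.symm _ _ _) hnd
  obtain ⟨B, hBb, hBG⟩ := exists_raised (S := pull c P) hdet
  have hid : matrixOf (pull c P) (c x) * (matrixOf (pull c g.form) (c x))⁻¹ *
      matrixOf (pull c P) (c x) = matrixOf (pull c P) (c x) := by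
    simpa only [components_eq] using hP.idem x hyU
  have hBP : ∀ u z, pull c P (c x) (B u) z - pull c P (c x) u z = 0 := by
    intro u z
    refine eq_zero_of_basisVec (f := fun u => pull c P (c x) (B u) z - pull c P (c x) u z)
      ?_ ?_ (fun a => ?_) u
    · intro x x'; simp; ring
    · intro c x; simp; ring
    refine eq_zero_of_basisVec (f := fun z => pull c P (c x) (B (basisVec a)) z
      - pull c P (c x) (basisVec a) z) ?_ ?_ (fun t => ?_) z
    · intro x x'; simp; ring
    · intro c x; simp; ring
    rw [sub_eq_zero]
    change _ = matrixOf (pull c P) (c x) a t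
    rw [← hid, hBb, Matrix.mul_apply]
    simp only [map_sum, map_smul, sum_apply, smul_apply, smul_eq_mul]
    rfl
  rw [pull_transition he hcA P hyc]
  simp only [pull_transition he hcA _ hyc, ContinuousLinearMap.bilinearComp_apply] at hu ⊢
  set D := fderiv ℝ (fun y => c (e.symm y)) y
  have hBu : D u' = B (D u) := by
    rw [← sub_eq_zero]
    apply hnd
    intro v
    obtain ⟨v, rfl⟩ := fderiv_transition_surjective he hcA hyc v
    rw [map_sub, sub_apply, hBG, sub_eq_zero]
    exact hu v
  rw [hBu]
  exact sub_eq_zero.1 (hBP _ _)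

omit [IsManifold (𝓡 n) ∞ V] in
theorem pull_congr {e e' : OpenPartialHomeomorph V (Coord n)}
    (h : (e'.symm : Coord n → V) = e.symm) (B : BilinField n V) : pull e' B = pull e B := by
  funext y
  unfold pull chartDeriv
  rw [h]

/-- A chart can be restricted to one whose target is a small ball. Its inverse is the same function
on `ℝⁿ`, so that tensors read in the two charts are literally equal. -/
theorem exists_restricted_chart {e : OpenPartialHomeomorph V (Coord n)}
    (he : e ∈ IsManifold.maximalAtlas (𝓡 n) ∞ V) {q : V} (hq : q ∈ e.source) {D : Set (Coord n)}
    (hD : IsOpen D) (hqD : e q ∈ D) :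
    ∃ e' ∈ IsManifold.maximalAtlas (𝓡 n) ∞ V, q ∈ e'.source ∧ e'.source ⊆ e.source ∧
      e'.target ⊆ e.target ∩ D ∧ Convex ℝ e'.target ∧ (e'.symm : Coord n → V) = e.symm := by
  obtain ⟨r, hr, hrT⟩ := Metric.isOpen_iff.1 (e.open_target.inter hD) _ ⟨e.map_source hq, hqD⟩
  -- restricting the inverse makes the target, rather than the source, the prescribed ball
  set e' := (e.symm.restrOpen (Metric.ball (e q) r) Metric.isOpen_ball).symm with he'
  have heT : e'.target = Metric.ball (e q) r := by
    change e.target ∩ Metric.ball (e q) r = _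
    exact Set.inter_eq_right.2 fun y hy => (hrT hy).1
  have hsymm : ∀ y, e'.symm y = e.symm y := fun y => rfl
  have hsub : e'.target ⊆ e.target ∩ D := by rw [heT]; exact hrT
  have hsrc : e'.source ⊆ e.source := by
    intro x hx
    rw [← e'.left_inv hx, hsymm]
    exact e.map_target (hsub (e'.map_source hx)).1
  refine ⟨e', ?_, ?_, hsrc, hsub, ?_, rfl⟩
  · rw [IsManifold.mem_maximalAtlas_iff_contMDiffOn]
    exact ⟨(contMDiffOn_of_mem_maximalAtlas he).mono hsrc,
      (contMDiffOn_symm_of_mem_maximalAtlas he).mono fun y hy => (hsub hy).1⟩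
  · have h : e q ∈ e'.target := by rw [heT]; exact Metric.mem_ball_self hr
    have h1 := e'.map_target h
    rwa [hsymm, e.left_inv hq] at h1
  · rw [heT]
    exact convex_ball _ _

/-- Near `q` there is a chart adapted to the two foliations tangent to the range and to the kernel
of the projector. -/
theorem exists_adapted_chart (hpn : p < n) {g : PseudoMetric n V} {P : BilinField n V}
    {q : V} {U : Set V} (hU : IsOpen U) (hq : q ∈ U) (hP : IsOrthogonalProjector g P p U)
    (hT : ∀ x ∈ U, ∀ a b c, tensorT g P p x a b c = 0) :
    ∃ e ∈ IsManifold.maximalAtlas (𝓡 n) ∞ V, q ∈ e.source ∧ e.source ⊆ U ∧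
      ∀ y ∈ e.target, IsAdaptedAt p (pull e g.form) (pull e P) y := by
  set c := chartAt (Coord n) q with hc
  have hcA : c ∈ IsManifold.maximalAtlas (𝓡 n) ∞ V := IsManifold.chart_mem_maximalAtlas q
  have hqc : q ∈ c.source := mem_chart_source _ q
  have hcq : c q ∈ c.target := c.map_source hqc
  have hpt : c.symm (c q) = q := c.left_inv hqc
  set Ω := c.target ∩ c.symm ⁻¹' U with hΩdef
  have hΩ : IsOpen Ω := isOpen_chart_preimage c hU
  have hqΩ : c q ∈ Ω := ⟨hcq, by rwa [Set.mem_preimage, hpt]⟩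
  have hG : ContDiffOn ℝ ∞ (pull c g.form) Ω :=
    (contDiffOn_pull_metric hcA g).mono Set.inter_subset_left
  have hS : ContDiffOn ℝ ∞ (pull c P) Ω := contDiffOn_pull hcA hP.smooth hU
  have hnd : ∀ y ∈ Ω, ∀ u, (∀ v, pull c g.form y u v = 0) → u = 0 :=
    fun y hy u hu => pull_nondegenerate hcA g hy.1 hu
  have hGs : ∀ y ∈ Ω, ∀ u v, pull c g.form y u v = pull c g.form y v u :=
    fun y _ u v => g.symm _ _ _
  have hSs : ∀ y ∈ Ω, ∀ u v, pull c P y u v = pull c P y v u :=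
    fun y hy u v => pull_symm hP.symm hy.2 u v
  obtain ⟨A, hA, hAG⟩ := exists_projector_field hG hS hnd
  have hAA : ∀ y ∈ Ω, A y * A y = A y := by
    intro y hy
    ext1 u
    rw [← sub_eq_zero]
    apply hnd y hy
    intro v
    rw [mul_apply_eq_comp, map_sub, sub_apply, hAG y hy, hAG y hy, sub_eq_zero]
    exact idem_pull hP hcA hy.1 hy.2 (hAG y hy u) v
  have hinv := fun y (hy : y ∈ Ω) => involutive_of_separationIdentity hΩ hG hS hGs hSs hnd hA hAG
    hAA hy (separationIdentity_pull hU hP hT hcA hy.1 hy.2)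
  have htr : LinearMap.trace ℝ (Coord n) (A (c q) : Coord n →ₗ[ℝ] Coord n) = p := by
    rw [trace_raised (isUnit_det_matrixOf (hGs _ hqΩ) (hnd _ hqΩ)) (hnd _ hqΩ) (hAG _ hqΩ)]
    simpa only [components_eq] using hP.trace_eq q hq
  obtain ⟨φ, hqφ, hφΩ, hφs, hφs', hφA⟩ := exists_adapted_coordinates hpn.le hΩ hA hAA
    (fun y hy => (hinv y hy).1) (fun y hy => (hinv y hy).2) hqΩ htr
  have hφT : ∀ z ∈ φ.target, φ.symm z ∈ Ω := fun z hz => hφΩ (φ.map_target hz)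
  set e := c.trans φ with he
  have hqe : q ∈ e.source := by
    rw [he, OpenPartialHomeomorph.trans_source]
    exact ⟨hqc, hqφ⟩
  have heTφ : ∀ y ∈ e.target, y ∈ φ.target := by
    intro y hy
    rw [he, OpenPartialHomeomorph.trans_target] at hy
    exact hy.1
  have hsymm : ∀ y, e.symm y = c.symm (φ.symm y) := fun y => rfl
  have hfun : ∀ x, e x = φ (c x) := fun x => rfl
  have hsrc : ∀ x ∈ e.source, x ∈ c.source ∧ c x ∈ φ.source := by
    intro x hx
    have h1 := e.map_source hx
    have h2 := e.left_inv hx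
    have h3 := hφT _ (heTφ _ h1)
    rw [hsymm] at h2
    rw [← h2]
    refine ⟨c.map_target h3.1, ?_⟩
    rw [c.right_inv h3.1]
    exact φ.map_target (heTφ _ h1)
  have heA : e ∈ IsManifold.maximalAtlas (𝓡 n) ∞ V := by
    rw [IsManifold.mem_maximalAtlas_iff_contMDiffOn]
    constructor
    · exact (contMDiffOn_iff_contDiffOn.2 hφs).comp
        ((contMDiffOn_of_mem_maximalAtlas hcA).mono fun x hx => (hsrc x hx).1)
        fun x hx => (hsrc x hx).2
    · exact (contMDiffOn_symm_of_mem_maximalAtlas hcA).comp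
        ((contMDiffOn_iff_contDiffOn.2 hφs').mono heTφ)
        fun y hy => (hφT y (heTφ y hy)).1
  refine ⟨e, heA, hqe, ?_, ?_⟩
  · intro x hx
    have h1 := (hφT _ (heTφ _ (e.map_source hx))).2
    rwa [Set.mem_preimage, ← hsymm, e.left_inv hx] at h1
  · intro y hy
    have hyφ := hφT y (heTφ y hy)
    have hyc : y ∈ e.target ∩ e.symm ⁻¹' c.source := ⟨hy, c.map_target hyφ.1⟩
    have hev : (fun y => c (e.symm y)) =ᶠ[nhds y] φ.symm := by
      filter_upwards [e.open_target.mem_nhds hy] with z hz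
      exact c.right_inv (hφT z (heTφ z hz)).1
    have hpull : ∀ (B : BilinField n V) (u v : Coord n), pull e B y u v =
        pull c B (φ.symm y) (fderiv ℝ φ.symm y u) (fderiv ℝ φ.symm y v) := by
      intro B u v
      rw [pull_transition heA hcA B hyc, hev.fderiv_eq,
        show c (e.symm y) = φ.symm y from hev.self_of_nhds]
      rfl
    have hAy := hφA y (heTφ y hy)
    refine ⟨fun i hi v => ?_, fun i hi v => ?_⟩
    · rw [hpull, hpull, ← hAG _ hyφ, (hAy i).1 hi]
    · rw [hpull, ← hAG _ hyφ, (hAy i).2 hi, map_zero, zero_apply]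

end ManifoldIdentity

/-! ### Functions of some of the coordinates, and potentials -/

section Potentials

variable {n p : ℕ}

theorem clm_ext_basisVec {T T' : Coord n →L[ℝ] ℝ}
    (h : ∀ i, T (basisVec i) = T' (basisVec i)) : T = T' := by
  ext x
  rw [← sub_eq_zero]
  refine eq_zero_of_basisVec (f := fun x => T x - T' x) ?_ ?_ (fun i => sub_eq_zero.2 (h i)) x
  · intro x y; simp only [map_add]; ring
  · intro c x; simp only [map_smul, smul_eq_mul]; ring

/-- On a convex open set, a function takes the same value at two points if its partial derivatives
vanish in the coordinates in which they differ. -/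
theorem eq_of_fderiv_basisVec {D : Set (Coord n)} (hD : IsOpen D) (hc : Convex ℝ D)
    {f : Coord n → ℝ} (hf : DifferentiableOn ℝ f D) {y z : Coord n} (hy : y ∈ D) (hz : z ∈ D)
    (h : ∀ i, y i ≠ z i → ∀ x ∈ D, fderiv ℝ f x (basisVec i) = 0) : f y = f z := by
  obtain ⟨x, hx, hxe⟩ := domain_mvt (f := f) (f' := fderiv ℝ f)
    (fun x hx => ((hf x hx).differentiableAt (hD.mem_nhds hx)).hasFDerivAt.hasFDerivWithinAt)
    hc hz hy
  have hxD : x ∈ D := hc.segment_subset hz hy hx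
  have h0 : fderiv ℝ f x (y - z) = 0 := by
    rw [← sum_smul_basisVec (y - z), map_sum]
    refine Finset.sum_eq_zero fun i _ => ?_
    rw [map_smul]
    by_cases hi : y i = z i
    · simp [hi]
    · rw [h i hi x hxD, smul_zero]
  rw [h0] at hxe
  exact sub_eq_zero.1 hxe

theorem dependsOnFirst_of_fderiv {D : Set (Coord n)} (hD : IsOpen D) (hc : Convex ℝ D)
    {f : Coord n → ℝ} (hf : DifferentiableOn ℝ f D)
    (h : ∀ i : Fin n, p ≤ i.val → ∀ x ∈ D, fderiv ℝ f x (basisVec i) = 0) :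
    DependsOnFirst p D f := fun y hy z hz hyz =>
  eq_of_fderiv_basisVec hD hc hf hy hz fun i hi => h i (by
    by_contra hlt
    exact hi (hyz i (not_le.1 hlt)))

theorem dependsOnLast_of_fderiv {D : Set (Coord n)} (hD : IsOpen D) (hc : Convex ℝ D)
    {f : Coord n → ℝ} (hf : DifferentiableOn ℝ f D)
    (h : ∀ i : Fin n, i.val < p → ∀ x ∈ D, fderiv ℝ f x (basisVec i) = 0) :
    DependsOnLast p D f := fun y hy z hz hyz =>
  eq_of_fderiv_basisVec hD hc hf hy hz fun i hi => h i (by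
    by_contra hlt
    exact hi (hyz i (not_lt.1 hlt)))

theorem fderiv_basisVec_eq_zero {D : Set (Coord n)} (hD : IsOpen D) {f : Coord n → ℝ}
    {y : Coord n} (hy : y ∈ D) (hf : DifferentiableAt ℝ f y) (i : Fin n)
    (h : ∀ z ∈ D, (∀ j, j ≠ i → z j = y j) → f z = f y) : fderiv ℝ f y (basisVec i) = 0 := by
  have h1 : HasDerivAt (fun t : ℝ => y + t • (basisVec i : Coord n)) (basisVec i) 0 := by
    simpa using ((hasDerivAt_id (0 : ℝ)).smul_const (basisVec i : Coord n)).const_add y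
  have h2 : HasDerivAt (fun t : ℝ => f (y + t • (basisVec i : Coord n)))
      (fderiv ℝ f y (basisVec i)) 0 :=
    HasFDerivAt.comp_hasDerivAt (l := f) 0 (by simpa using hf.hasFDerivAt) h1
  have h3 : (fun t : ℝ => f (y + t • (basisVec i : Coord n))) =ᶠ[nhds 0] fun _ => f y := by
    have hc : ContinuousAt (fun t : ℝ => y + t • (basisVec i : Coord n)) 0 := h1.continuousAt
    filter_upwards [hc.preimage_mem_nhds (hD.mem_nhds (by simpa using hy))] with t ht
    refine h _ ht fun j hj => ?_
    simp [basisVec, hj]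
  exact h2.unique ((hasDerivAt_const (0 : ℝ) (f y)).congr_of_eventuallyEq h3)

theorem fderiv_eq_zero_of_dependsOnFirst {D : Set (Coord n)} (hD : IsOpen D) {f : Coord n → ℝ}
    (h : DependsOnFirst p D f) {y : Coord n} (hy : y ∈ D) (hf : DifferentiableAt ℝ f y)
    {i : Fin n} (hi : p ≤ i.val) : fderiv ℝ f y (basisVec i) = 0 :=
  fderiv_basisVec_eq_zero hD hy hf i fun z hz hzy => h z hz y hy fun j hj => hzy j fun hji => by
    rw [hji] at hj
    exact absurd hj (not_lt.2 hi)

theorem fderiv_eq_zero_of_dependsOnLast {D : Set (Coord n)} (hD : IsOpen D) {f : Coord n → ℝ}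
    (h : DependsOnLast p D f) {y : Coord n} (hy : y ∈ D) (hf : DifferentiableAt ℝ f y)
    {i : Fin n} (hi : i.val < p) : fderiv ℝ f y (basisVec i) = 0 :=
  fderiv_basisVec_eq_zero hD hy hf i fun z hz hzy => h z hz y hy fun j hj => hzy j fun hji => by
    rw [hji] at hj
    exact absurd hi (not_lt.2 hj)

end Potentials

/-! ### Vanishing and exact 1-forms in a chart -/

section FormsInCharts

variable {n : ℕ} {V : Type*} [TopologicalSpace V] [ChartedSpace (Coord n) V]
  {e : OpenPartialHomeomorph V (Coord n)}
  {q : V} {η : ∀ x : V, TangentSpace (𝓡 n) x →L[ℝ] ℝ}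

theorem formAt_eq_pullForm (he : e ∈ IsManifold.maximalAtlas (𝓡 n) ∞ V) {x : V}
    (hx : x ∈ e.source) :
    formAt η x = (pullForm e η (e x)).comp
      (mfderiv (𝓡 n) (𝓡 n) e x : TangentSpace (𝓡 n) x →L[ℝ] TangentSpace (𝓡 n) (e x)) := by
  let D : Coord n →L[ℝ] Coord n := mfderiv (𝓡 n) (𝓡 n) e x
  have h : (chartDeriv e (e x)).comp D = ContinuousLinearMap.id ℝ (Coord n) :=
    (mdifferentiable_of_mem_maximalAtlas he).symm_comp_deriv hx
  have h1 : formAt η (e.symm (e x)) = formAt η x := congrArg (formAt η) (e.left_inv hx)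
  change formAt η x = ((formAt η (e.symm (e x))).comp (chartDeriv e (e x))).comp D
  rw [ContinuousLinearMap.comp_assoc, h, h1, ContinuousLinearMap.comp_id]

theorem vanishesNear_of_chart (he : e ∈ IsManifold.maximalAtlas (𝓡 n) ∞ V) (hq : q ∈ e.source)
    {D : Set (Coord n)} (hD : IsOpen D) (hqD : e q ∈ D) (h : ∀ y ∈ D, pullForm e η y = 0) :
    VanishesNear q η := by
  refine ⟨e.source ∩ e ⁻¹' D, e.isOpen_inter_preimage hD, ⟨hq, hqD⟩, fun x hx => ?_⟩
  have h1 := formAt_eq_pullForm (η := η) he hx.1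
  rw [h _ hx.2] at h1
  exact h1.trans (ContinuousLinearMap.zero_comp _)

theorem exactNear_of_chart (he : e ∈ IsManifold.maximalAtlas (𝓡 n) ∞ V) (hq : q ∈ e.source)
    {D : Set (Coord n)} (hD : IsOpen D) (hqD : e q ∈ D) {f : Coord n → ℝ}
    (hf : ContDiffOn ℝ ∞ f D) (h : ∀ y ∈ D, fderiv ℝ f y = pullForm e η y) : ExactNear q η := by
  refine ⟨e.source ∩ e ⁻¹' D, e.isOpen_inter_preimage hD, ⟨hq, hqD⟩, fun x => f (e x), ?_,
    fun x hx => ?_⟩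
  · exact (contMDiffOn_iff_contDiffOn.2 hf).comp
      ((contMDiffOn_of_mem_maximalAtlas he).mono Set.inter_subset_left) fun x hx => hx.2
  · have h1 := formAt_eq_pullForm (η := η) he hx.1
    rw [← h _ hx.2] at h1
    have h2 : MDifferentiableAt (𝓡 n) 𝓘(ℝ) f (e x) :=
      ((hf.contDiffAt (hD.mem_nhds hx.2)).differentiableAt (by simp)).mdifferentiableAt
    have h3 : MDifferentiableAt (𝓡 n) (𝓡 n) e x :=
      (mdifferentiable_of_mem_maximalAtlas he).mdifferentiableAt hx.1
    have h4 := mfderiv_comp x h2 h3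
    rw [mfderiv_eq_fderiv] at h4
    exact h1.trans h4.symm

/-- A potential on the manifold, read in a chart, is a potential of the 1-form read there. -/
theorem fderiv_comp_symm_of_exact (he : e ∈ IsManifold.maximalAtlas (𝓡 n) ∞ V) {N : Set V}
    (hN : IsOpen N) (hsub : e.source ⊆ N) {f : V → ℝ} (hf : ContMDiffOn (𝓡 n) 𝓘(ℝ) ∞ f N)
    (h : ∀ x ∈ N, η x = mvfderiv (𝓡 n) f x) :
    ContDiffOn ℝ ∞ (fun y => f (e.symm y)) e.target ∧
      ∀ y ∈ e.target, fderiv ℝ (fun y => f (e.symm y)) y = pullForm e η y := by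
  constructor
  · rw [← contMDiffOn_iff_contDiffOn]
    exact hf.comp (contMDiffOn_symm_of_mem_maximalAtlas he)
      fun y hy => hsub (e.map_target hy)
  · intro y hy
    have hyN := hsub (e.map_target hy)
    have h2 : MDifferentiableAt (𝓡 n) 𝓘(ℝ) f (e.symm y) :=
      (hf.contMDiffAt (hN.mem_nhds hyN)).mdifferentiableAt (by simp)
    have h3 : MDifferentiableAt (𝓡 n) (𝓡 n) e.symm y :=
      (mdifferentiable_of_mem_maximalAtlas he).mdifferentiableAt_symm hy
    have h4 := mfderiv_comp y h2 h3
    have h6 : formAt η (e.symm y) = formAt (fun x => mvfderiv (𝓡 n) f x) (e.symm y) := h _ hyN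
    rw [mfderiv_eq_fderiv] at h4
    rw [pullForm, h6]
    exact h4

end FormsInCharts

/-! ### Umbilical pairs of coordinate foliations and their conformal factors -/

section UmbilicalPairs

variable {n p : ℕ} {D : Set (Coord n)}

theorem two_le_infty : (2 : WithTop ℕ∞) ≤ ∞ := by
  exact WithTop.coe_le_coe.2 le_top

theorem fderiv_div_eq_zero {f h : Coord n → ℝ} {y v : Coord n} {c : ℝ}
    (hf : DifferentiableAt ℝ f y) (hh : DifferentiableAt ℝ h y) (h0 : h y ≠ 0)
    (hfv : fderiv ℝ f y v = c * f y) (hhv : fderiv ℝ h y v = c * h y) :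
    fderiv ℝ (fun z => f z / h z) y v = 0 := by
  have h1 : HasFDerivAt (fun z => f z * (h z)⁻¹) _ y :=
    hf.hasFDerivAt.mul ((hasDerivAt_inv h0).comp_hasFDerivAt y hh.hasFDerivAt)
  simp only [div_eq_mul_inv]
  rw [h1.fderiv]
  simp only [smul_apply, add_apply, smul_eq_mul, hfv, hhv]
  field_simp
  ring

/-- If `dΞ = c Ξ η` with `Ξ` without zeros, then `η` is the differential of `log |Ξ| / c`; this
function inherits the smoothness of `η`. -/
theorem log_potential (hD : IsOpen D) {Ξ : Coord n → ℝ} {η : Coord n → Coord n →L[ℝ] ℝ} {c : ℝ}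
    (hc : c ≠ 0) (hΞ : DifferentiableOn ℝ Ξ D) (h0 : ∀ y ∈ D, Ξ y ≠ 0)
    (hη : ContDiffOn ℝ ∞ η D) (h : ∀ y ∈ D, ∀ i, fderiv ℝ Ξ y (basisVec i) =
      c * η y (basisVec i) * Ξ y) :
    ContDiffOn ℝ ∞ (fun y => Real.log (Ξ y) / c) D ∧
      ∀ y ∈ D, fderiv ℝ (fun y => Real.log (Ξ y) / c) y = η y := by
  have hd : ∀ y ∈ D, HasFDerivAt (fun y => Real.log (Ξ y) / c) (η y) y := by
    intro y hy
    have h1 : HasFDerivAt (fun y => Real.log (Ξ y) / c) (c⁻¹ • ((Ξ y)⁻¹ • fderiv ℝ Ξ y)) y := by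
      have h2 := (((hΞ y hy).differentiableAt (hD.mem_nhds hy)).hasFDerivAt.log
        (h0 y hy)).const_smul c⁻¹
      refine h2.congr_of_eventuallyEq (Filter.Eventually.of_forall fun z => ?_)
      simp [div_eq_inv_mul]
    convert h1 using 1
    refine clm_ext_basisVec fun i => ?_
    have h3 := h0 y hy
    simp only [smul_apply, smul_eq_mul, h y hy i]
    field_simp
  refine ⟨?_, fun y hy => (hd y hy).fderiv⟩
  rw [contDiffOn_infty_iff_fderiv_of_isOpen hD]
  exact ⟨fun y hy => (hd y hy).differentiableAt.differentiableWithinAt,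
    hη.congr fun y hy => (hd y hy).fderiv⟩

theorem contDiffAt_of_basisVec {T : Coord n → Coord n →L[ℝ] ℝ} {y : Coord n}
    (h : ∀ i, ContDiffAt ℝ ∞ (fun z => T z (basisVec i)) y) : ContDiffAt ℝ ∞ T y := by
  have hT : T = fun z => ∑ i, T z (basisVec i) • (EuclideanSpace.proj i : Coord n →L[ℝ] ℝ) := by
    funext z
    refine clm_ext_basisVec fun j => ?_
    simp only [sum_apply, smul_apply]
    simp [basisVec]
  rw [hT]
  exact ContDiffAt.sum fun i _ => (h i).smul contDiffAt_const

/-- On the open set `D` the two foliations by the first `p` and by the last `n - p` coordinates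
are orthogonal and umbilical for the metric `G`, the tensor `S` is the orthogonal projector
onto the first one, and the mean curvatures are given by the 1-forms `E` and `W`. -/
structure IsUmbilicalOn (p : ℕ) (G S : Coord n → Coord n →L[ℝ] Coord n →L[ℝ] ℝ)
    (E W : Coord n → Coord n →L[ℝ] ℝ) (D : Set (Coord n)) : Prop where
  isOpen : IsOpen D
  contDiff_metric : ContDiffOn ℝ ∞ G D
  contDiff_proj : ContDiffOn ℝ ∞ S D
  symm_metric : ∀ y ∈ D, ∀ u v, G y u v = G y v u
  symm_proj : ∀ y ∈ D, ∀ u v, S y u v = S y v u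
  nondegenerate : ∀ y ∈ D, ∀ u, (∀ v, G y u v = 0) → u = 0
  adapted : ∀ y ∈ D, IsAdaptedAt p G S y
  fst_eq_zero : ∀ y ∈ D, ∀ i : Fin n, i.val < p → E y (basisVec i) = 0
  snd_eq_zero : ∀ y ∈ D, ∀ i : Fin n, p ≤ i.val → W y (basisVec i) = 0
  fderiv_proj : ∀ y ∈ D, ∀ i j k : Fin n, p ≤ i.val → j.val < p → k.val < p →
    fderiv ℝ S y (basisVec i) (basisVec j) (basisVec k) =
      -(1 / (p : ℝ)) * E y (basisVec i) * S y (basisVec j) (basisVec k)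
  fderiv_metric : ∀ y ∈ D, ∀ i j k : Fin n, i.val < p → p ≤ j.val → p ≤ k.val →
    fderiv ℝ G y (basisVec i) (basisVec j) (basisVec k) =
      -(1 / ((n : ℝ) - p)) * W y (basisVec i) * G y (basisVec j) (basisVec k)

namespace IsUmbilicalOn

variable {G S : Coord n → Coord n →L[ℝ] Coord n →L[ℝ] ℝ} {E W : Coord n → Coord n →L[ℝ] ℝ}

theorem exists_proj_ne_zero (h : IsUmbilicalOn p G S E W D) (hp : 0 < p) (hpn : p < n)
    {y : Coord n} (hy : y ∈ D) :
    ∃ j k : Fin n, j.val < p ∧ k.val < p ∧ S y (basisVec j) (basisVec k) ≠ 0 := by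
  obtain ⟨k, hk, hne⟩ := (h.adapted y hy).exists_fst_ne_zero (h.symm_proj y hy)
    (h.nondegenerate y hy) (i := ⟨0, hp.trans hpn⟩) hp
  exact ⟨⟨0, hp.trans hpn⟩, k, hp, hk, by rwa [(h.adapted y hy).fst _ hp]⟩

theorem exists_metric_ne_zero (h : IsUmbilicalOn p G S E W D) (hpn : p < n)
    {y : Coord n} (hy : y ∈ D) :
    ∃ j k : Fin n, p ≤ j.val ∧ p ≤ k.val ∧ G y (basisVec j) (basisVec k) ≠ 0 := by
  obtain ⟨k, hk, hne⟩ := (h.adapted y hy).exists_snd_ne_zero (h.symm_metric y hy)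
    (h.symm_proj y hy) (h.nondegenerate y hy) (i := ⟨p, hpn⟩) le_rfl
  exact ⟨_, k, le_rfl, hk, hne⟩

/-- A logarithmic derivative of a smooth function without zeros is smooth. -/
theorem contDiffAt_logDeriv {f φ : Coord n → ℝ} {y v : Coord n} {c : ℝ}
    (hf : ContDiffAt ℝ ∞ f y) (hne : f y ≠ 0) (hc : c ≠ 0)
    (h : ∀ᶠ z in nhds y, fderiv ℝ f z v = c * φ z * f z) : ContDiffAt ℝ ∞ φ y := by
  have h1 : ContDiffAt ℝ ∞ (fun z => fderiv ℝ f z v / f z / c) y :=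
    (((hf.fderiv_right (m := ∞) (by simp)).clm_apply contDiffAt_const).div hf hne).div
      contDiffAt_const hc
  refine h1.congr_of_eventuallyEq ?_
  filter_upwards [h, hf.continuousAt.eventually_ne hne] with z hz hz0
  rw [hz]
  field_simp

theorem contDiffOn_fst (h : IsUmbilicalOn p G S E W D) (hp : 0 < p) (hpn : p < n) :
    ContDiffOn ℝ ∞ E D := by
  intro y hy
  refine (contDiffAt_of_basisVec fun i => ?_).contDiffWithinAt
  rcases lt_or_ge i.val p with hi | hi
  · refine (contDiffAt_const (c := (0 : ℝ))).congr_of_eventuallyEq ?_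
    filter_upwards [h.isOpen.mem_nhds hy] with z hz using h.fst_eq_zero z hz i hi
  · obtain ⟨j, k, hj, hk, hne⟩ := h.exists_proj_ne_zero hp hpn hy
    have hp0 : (p : ℝ) ≠ 0 := by exact_mod_cast hp.ne'
    have hS := fun z (hz : z ∈ D) => h.contDiff_proj.contDiffAt (h.isOpen.mem_nhds hz)
    refine contDiffAt_logDeriv (((hS y hy).clm_apply contDiffAt_const).clm_apply contDiffAt_const)
      hne (neg_ne_zero.2 (one_div_ne_zero hp0)) (v := basisVec i) ?_
    filter_upwards [h.isOpen.mem_nhds hy] with z hz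
    rw [fderiv_clm_apply₂ ((hS z hz).differentiableAt (by simp))]
    exact h.fderiv_proj z hz i j k hi hj hk

theorem contDiffOn_snd (h : IsUmbilicalOn p G S E W D) (hpn : p < n) :
    ContDiffOn ℝ ∞ W D := by
  intro y hy
  refine (contDiffAt_of_basisVec fun i => ?_).contDiffWithinAt
  rcases lt_or_ge i.val p with hi | hi
  · obtain ⟨j, k, hj, hk, hne⟩ := h.exists_metric_ne_zero hpn hy
    have hnp0 : (n : ℝ) - p ≠ 0 := sub_ne_zero.2 (by exact_mod_cast hpn.ne')
    have hG := fun z (hz : z ∈ D) => h.contDiff_metric.contDiffAt (h.isOpen.mem_nhds hz)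
    refine contDiffAt_logDeriv (((hG y hy).clm_apply contDiffAt_const).clm_apply contDiffAt_const)
      hne (neg_ne_zero.2 (one_div_ne_zero hnp0)) (v := basisVec i) ?_
    filter_upwards [h.isOpen.mem_nhds hy] with z hz
    rw [fderiv_clm_apply₂ ((hG z hz).differentiableAt (by simp))]
    exact h.fderiv_metric z hz i j k hi hj hk
  · refine (contDiffAt_const (c := (0 : ℝ))).congr_of_eventuallyEq ?_
    filter_upwards [h.isOpen.mem_nhds hy] with z hz using h.snd_eq_zero z hz i hi

end IsUmbilicalOn

end UmbilicalPairs

/-! ### Separated charts and the 1-forms `E` and `W` -/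

section Separation

variable {n p : ℕ} {V : Type*} [TopologicalSpace V] [ChartedSpace (Coord n) V]
  [IsManifold (𝓡 n) ∞ V] {g : PseudoMetric n V} {P : BilinField n V} {U : Set V}
  {e : OpenPartialHomeomorph V (Coord n)} {Ξ₁ Ξ₂ : Coord n → ℝ} {G : CoordTensor n}

theorem IsOrthogonalProjector.mono (h : IsOrthogonalProjector g P p U) {U' : Set V}
    (hU' : U' ⊆ U) : IsOrthogonalProjector g P p U' :=
  ⟨h.smooth.mono hU', fun x hx => h.symm x (hU' hx), fun x hx => h.idem x (hU' hx),
    fun x hx => h.trace_eq x (hU' hx)⟩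

theorem isUmbilicalOn_pull (hp : 0 < p) (hpn : p < n) (hU : IsOpen U)
    (hP : IsOrthogonalProjector g P p U) (hT : ∀ x ∈ U, ∀ a b c, tensorT g P p x a b c = 0)
    (he : e ∈ IsManifold.maximalAtlas (𝓡 n) ∞ V)
    (had : ∀ y ∈ e.target, IsAdaptedAt p (pull e g.form) (pull e P) y) :
    IsUmbilicalOn p (pull e g.form) (pull e P) (pullForm e (formE g P)) (pullForm e (formW g P))
      (e.target ∩ e.symm ⁻¹' U) := by
  have hD := isOpen_chart_preimage e hU
  have hG := (contDiffOn_pull_metric he g).mono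
    (Set.inter_subset_left (s := e.target) (t := e.symm ⁻¹' U))
  have hS := contDiffOn_pull he hP.smooth hU
  have hGs : ∀ y ∈ e.target ∩ e.symm ⁻¹' U, ∀ u v, pull e g.form y u v = pull e g.form y v u :=
    fun y _ u v => g.symm _ _ _
  have hSs : ∀ y ∈ e.target ∩ e.symm ⁻¹' U, ∀ u v, pull e P y u v = pull e P y v u :=
    fun y hy u v => pull_symm hP.symm hy.2 u v
  have hnd : ∀ y ∈ e.target ∩ e.symm ⁻¹' U, ∀ u, (∀ v, pull e g.form y u v = 0) → u = 0 :=
    fun y hy u hu => pull_nondegenerate he g hy.1 hu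
  have key := fun y (hy : y ∈ e.target ∩ e.symm ⁻¹' U) =>
    umbilical_of_separationIdentity hp hpn hD
      ((hG.contDiffAt (hD.mem_nhds hy)).differentiableAt (by simp))
      ((hS.contDiffAt (hD.mem_nhds hy)).differentiableAt (by simp)) hGs hSs (hnd y hy)
      (fun y hy => had y hy.1) hy (separationIdentity_pull hU hP hT he hy.1 hy.2)
  exact ⟨hD, hG, hS, hGs, hSs, hnd, fun y hy => had y hy.1, fun y hy => (key y hy).1,
    fun y hy => (key y hy).2.1, fun y hy => (key y hy).2.2.1, fun y hy => (key y hy).2.2.2⟩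

theorem IsSeparation.adapted (h : IsSeparation g P p e Ξ₁ Ξ₂ G) {y : Coord n}
    (hy : y ∈ e.target) : IsAdaptedAt p (pull e g.form) (pull e P) y := by
  have hm := h.metric_eq y hy
  have hl := h.leaf_eq y hy
  simp only [components_apply] at hm hl
  constructor
  · intro i hi v
    rw [← sub_eq_zero]
    refine eq_zero_of_basisVec
      (f := fun v => pull e P y (basisVec i) v - pull e g.form y (basisVec i) v) ?_ ?_
      (fun j => ?_) v
    · intro x x'; simp only [map_add]; ring
    · intro c x; simp only [map_smul, smul_eq_mul]; ring
    · rw [hm, hl]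
      by_cases hj : j.val < p
      · simp [hi, hj]
      · simp [hj, not_le.2 hi]
  · intro i hi v
    refine eq_zero_of_basisVec (f := fun v => pull e P y (basisVec i) v)
      (fun x x' => map_add _ x x') (fun c x => map_smul _ c x) (fun j => ?_) v
    rw [hl]
    simp [not_lt.2 hi]

/-- The first conformal factor has no zeros and satisfies `∂_A Ξ₁ = - E_A Ξ₁ / p`. -/
theorem IsSeparation.fderiv_fst (h : IsSeparation g P p e Ξ₁ Ξ₂ G) (hp : 0 < p) (hpn : p < n)
    {E W : Coord n → Coord n →L[ℝ] ℝ} {D : Set (Coord n)} (hDe : D ⊆ e.target)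
    (hu : IsUmbilicalOn p (pull e g.form) (pull e P) E W D) {y : Coord n} (hy : y ∈ D) :
    Ξ₁ y ≠ 0 ∧ ∀ i : Fin n, p ≤ i.val →
      fderiv ℝ Ξ₁ y (basisVec i) = -(1 / (p : ℝ)) * E y (basisVec i) * Ξ₁ y := by
  obtain ⟨j, k, hj, hk, hne⟩ := hu.exists_proj_ne_zero hp hpn hy
  have hl : ∀ z ∈ D, pull e P z (basisVec j) (basisVec k) = Ξ₁ z * G z j k := by
    intro z hz
    rw [← components_apply, h.leaf_eq z (hDe hz), if_pos ⟨hj, hk⟩]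
  have hyn := hu.isOpen.mem_nhds hy
  have hen := e.open_target.mem_nhds (hDe hy)
  have h0 := hl y hy
  rw [h0] at hne
  refine ⟨left_ne_zero_of_mul hne, fun i hi => ?_⟩
  have hΞ : DifferentiableAt ℝ Ξ₁ y := (h.contDiff_fst.contDiffAt hen).differentiableAt (by simp)
  have hG : DifferentiableAt ℝ (fun z => G z j k) y :=
    ((h.block_fst j k hj hk).1.contDiffAt hen).differentiableAt (by simp)
  have hS : DifferentiableAt ℝ (pull e P) y :=
    (hu.contDiff_proj.contDiffAt hyn).differentiableAt (by simp)
  have h1 := hu.fderiv_proj y hy i j k hi hj hk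
  have h2 : (fun z => pull e P z (basisVec j) (basisVec k)) =ᶠ[nhds y] fun z => Ξ₁ z * G z j k := by
    filter_upwards [hyn] with z hz using hl z hz
  have h3 := fderiv_eq_zero_of_dependsOnFirst e.open_target (h.block_fst j k hj hk).2 (hDe hy)
    hG hi
  rw [← fderiv_clm_apply₂ hS, h2.fderiv_eq, fderiv_fun_mul hΞ hG, h0] at h1
  simp only [add_apply, smul_apply, smul_eq_mul, h3, mul_zero, zero_add] at h1
  refine mul_left_cancel₀ (right_ne_zero_of_mul hne) (h1.trans ?_)
  ring

/-- The second conformal factor has no zeros and satisfies `∂_α Ξ₂ = - W_α Ξ₂ / (n - p)`. -/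
theorem IsSeparation.fderiv_snd (h : IsSeparation g P p e Ξ₁ Ξ₂ G) (hpn : p < n)
    {E W : Coord n → Coord n →L[ℝ] ℝ} {D : Set (Coord n)} (hDe : D ⊆ e.target)
    (hu : IsUmbilicalOn p (pull e g.form) (pull e P) E W D) {y : Coord n} (hy : y ∈ D) :
    Ξ₂ y ≠ 0 ∧ ∀ i : Fin n, i.val < p →
      fderiv ℝ Ξ₂ y (basisVec i) = -(1 / ((n : ℝ) - p)) * W y (basisVec i) * Ξ₂ y := by
  obtain ⟨j, k, hj, hk, hne⟩ := hu.exists_metric_ne_zero hpn hy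
  have hl : ∀ z ∈ D, pull e g.form z (basisVec j) (basisVec k) = Ξ₂ z * G z j k := by
    intro z hz
    rw [← components_apply, h.metric_eq z (hDe hz), if_neg fun hc => absurd hc.1 (not_lt.2 hj),
      if_pos ⟨hj, hk⟩]
  have hyn := hu.isOpen.mem_nhds hy
  have hen := e.open_target.mem_nhds (hDe hy)
  have h0 := hl y hy
  rw [h0] at hne
  refine ⟨left_ne_zero_of_mul hne, fun i hi => ?_⟩
  have hΞ : DifferentiableAt ℝ Ξ₂ y := (h.contDiff_snd.contDiffAt hen).differentiableAt (by simp)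
  have hG : DifferentiableAt ℝ (fun z => G z j k) y :=
    ((h.block_snd j k hj hk).1.contDiffAt hen).differentiableAt (by simp)
  have hS : DifferentiableAt ℝ (pull e g.form) y :=
    (hu.contDiff_metric.contDiffAt hyn).differentiableAt (by simp)
  have h1 := hu.fderiv_metric y hy i j k hi hj hk
  have h2 : (fun z => pull e g.form z (basisVec j) (basisVec k)) =ᶠ[nhds y]
      fun z => Ξ₂ z * G z j k := by
    filter_upwards [hyn] with z hz using hl z hz
  have h3 := fderiv_eq_zero_of_dependsOnLast e.open_target (h.block_snd j k hj hk).2 (hDe hy)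
    hG hi
  rw [← fderiv_clm_apply₂ hS, h2.fderiv_eq, fderiv_fun_mul hΞ hG, h0] at h1
  simp only [add_apply, smul_apply, smul_eq_mul, h3, mul_zero, zero_add] at h1
  refine mul_left_cancel₀ (right_ne_zero_of_mul hne) (h1.trans ?_)
  ring

/-- Conversely, any two functions without zeros and with the right transversal derivatives are the
conformal factors of a separation: the quotients `P_{αβ} / Ξ₁` and `Π_{AB} / Ξ₂` depend only on
the coordinates of their own leaves. -/
theorem exists_isSeparation (he : e ∈ IsManifold.maximalAtlas (𝓡 n) ∞ V)
    (hc : Convex ℝ e.target) {E W : Coord n → Coord n →L[ℝ] ℝ}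
    (hu : IsUmbilicalOn p (pull e g.form) (pull e P) E W e.target)
    (h₁ : ContDiffOn ℝ 2 Ξ₁ e.target) (h₂ : ContDiffOn ℝ 2 Ξ₂ e.target)
    (h₁0 : ∀ y ∈ e.target, Ξ₁ y ≠ 0) (h₂0 : ∀ y ∈ e.target, Ξ₂ y ≠ 0)
    (hd₁ : ∀ y ∈ e.target, ∀ i : Fin n, p ≤ i.val →
      fderiv ℝ Ξ₁ y (basisVec i) = -(1 / (p : ℝ)) * E y (basisVec i) * Ξ₁ y)
    (hd₂ : ∀ y ∈ e.target, ∀ i : Fin n, i.val < p →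
      fderiv ℝ Ξ₂ y (basisVec i) = -(1 / ((n : ℝ) - p)) * W y (basisVec i) * Ξ₂ y) :
    ∃ G, IsSeparation g P p e Ξ₁ Ξ₂ G := by
  have hS2 : ∀ j k : Fin n,
      ContDiffOn ℝ 2 (fun y => pull e P y (basisVec j) (basisVec k)) e.target := fun j k =>
    ((hu.contDiff_proj.clm_apply contDiffOn_const).clm_apply contDiffOn_const).of_le two_le_infty
  have hG2 : ∀ j k : Fin n,
      ContDiffOn ℝ 2 (fun y => pull e g.form y (basisVec j) (basisVec k)) e.target := fun j k =>
    ((hu.contDiff_metric.clm_apply contDiffOn_const).clm_apply contDiffOn_const).of_le two_le_infty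
  have hat : ∀ {f : Coord n → ℝ}, ContDiffOn ℝ 2 f e.target → ∀ y ∈ e.target,
      DifferentiableAt ℝ f y := fun hf y hy =>
    (hf.contDiffAt (e.open_target.mem_nhds hy)).differentiableAt (by simp)
  -- the mixed entries of `G` do not occur in the separation
  refine ⟨fun y => Matrix.of fun i j =>
    if i.val < p ∧ j.val < p then pull e P y (basisVec i) (basisVec j) / Ξ₁ y
    else pull e g.form y (basisVec i) (basisVec j) / Ξ₂ y, he, h₁, h₂, ?_, ?_, ?_, ?_⟩
  · intro i j hi hj
    simp only [Matrix.of_apply, hi, hj, and_self, if_true]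
    have hq := (hS2 i j).div h₁ h₁0
    refine ⟨hq, dependsOnFirst_of_fderiv e.open_target hc
      (hq.differentiableOn (by simp)) fun k hk y hy => ?_⟩
    refine fderiv_div_eq_zero (hat (hS2 i j) y hy) (hat h₁ y hy) (h₁0 y hy) ?_ (hd₁ y hy k hk)
    rw [fderiv_clm_apply₂ ((hu.contDiff_proj.contDiffAt
      (e.open_target.mem_nhds hy)).differentiableAt (by simp))]
    exact hu.fderiv_proj y hy k i j hk hi hj
  · intro i j hi hj
    simp only [Matrix.of_apply, not_lt.2 hi, false_and, if_false]
    have hq := (hG2 i j).div h₂ h₂0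
    refine ⟨hq, dependsOnLast_of_fderiv e.open_target hc
      (hq.differentiableOn (by simp)) fun k hk y hy => ?_⟩
    refine fderiv_div_eq_zero (hat (hG2 i j) y hy) (hat h₂ y hy) (h₂0 y hy) ?_ (hd₂ y hy k hk)
    rw [fderiv_clm_apply₂ ((hu.contDiff_metric.contDiffAt
      (e.open_target.mem_nhds hy)).differentiableAt (by simp))]
    exact hu.fderiv_metric y hy k i j hk hi hj
  · intro y hy i j
    have ha := hu.adapted y hy
    have hs := hu.symm_proj y hy
    simp only [components_apply, Matrix.of_apply]
    rcases lt_or_ge i.val p with hi | hi <;> rcases lt_or_ge j.val p with hj | hj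
    · simp only [hi, hj, and_self, if_true]
      rw [mul_div_cancel₀ _ (h₁0 y hy), ha.fst i hi]
    · simp only [hi, not_lt.2 hj, not_le.2 hi, and_false, false_and, if_false]
      exact ha.mixed hs hi hj
    · simp only [hj, not_lt.2 hi, not_le.2 hj, and_false, false_and, if_false]
      rw [hu.symm_metric y hy]
      exact ha.mixed hs hj hi
    · simp only [hi, hj, not_lt.2 hi, and_self, false_and, if_false, if_true]
      rw [mul_div_cancel₀ _ (h₂0 y hy)]
  · intro y hy i j
    have ha := hu.adapted y hy
    simp only [components_apply, Matrix.of_apply]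
    by_cases hij : i.val < p ∧ j.val < p
    · simp only [hij, and_self, if_true]
      rw [mul_div_cancel₀ _ (h₁0 y hy)]
    · rw [if_neg hij]
      rcases lt_or_ge i.val p with hi | hi
      · rw [hu.symm_proj y hy]
        exact ha.snd j (not_lt.1 fun hj => hij ⟨hi, hj⟩) _
      · exact ha.snd i hi _

/-- Around `q` there are charts with convex target, inside a given neighbourhood, adapted to the
pair of umbilical foliations; moreover a component `Π_{jk}` without zeros can be singled out. -/
theorem exists_umbilical_chart (hp : 0 < p) (hpn : p < n) {q : V} (hU : IsOpen U) (hq : q ∈ U)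
    (hP : IsOrthogonalProjector g P p U) (hT : ∀ x ∈ U, ∀ a b c, tensorT g P p x a b c = 0) :
    ∃ e ∈ IsManifold.maximalAtlas (𝓡 n) ∞ V, q ∈ e.source ∧ e.source ⊆ U ∧ Convex ℝ e.target ∧
      IsUmbilicalOn p (pull e g.form) (pull e P) (pullForm e (formE g P))
        (pullForm e (formW g P)) e.target ∧
      ∃ j k : Fin n, p ≤ j.val ∧ p ≤ k.val ∧
        ∀ y ∈ e.target, pull e g.form y (basisVec j) (basisVec k) ≠ 0 := by
  obtain ⟨c, hc, hqc, hcU, had⟩ := exists_adapted_chart hpn hU hq hP hT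
  have htarget : ∀ {e : OpenPartialHomeomorph V (Coord n)}, e.source ⊆ U →
      e.target ∩ e.symm ⁻¹' U = e.target := fun {e} h =>
    Set.inter_eq_left.2 fun y hy => h (e.map_target hy)
  have hu := isUmbilicalOn_pull hp hpn hU hP hT hc had
  rw [htarget hcU] at hu
  obtain ⟨j, k, hj, hk, hne⟩ := hu.exists_metric_ne_zero hpn (c.map_source hqc)
  have hcont : ContinuousOn (fun y => pull c g.form y (basisVec j) (basisVec k)) c.target :=
    ((hu.contDiff_metric.clm_apply contDiffOn_const).clm_apply contDiffOn_const).continuousOn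
  obtain ⟨e, he, hqe, hec, heT, hconv, hsymm⟩ := exists_restricted_chart hc hqc
    (hcont.isOpen_inter_preimage c.open_target isOpen_ne) ⟨c.map_source hqc, hne⟩
  have hpull := pull_congr hsymm
  have hu' := isUmbilicalOn_pull hp hpn hU hP hT he (fun y hy => by
    rw [hpull, hpull]
    exact had y (heT hy).1)
  rw [htarget (hec.trans hcU)] at hu'
  refine ⟨e, he, hqe, hec.trans hcU, hconv, hu', j, k, hj, hk, fun y hy => ?_⟩
  rw [hpull]
  exact (heT hy).2.2

theorem pullForm_formU (y : Coord n) : pullForm e (formU g P p) y =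
    (1 / (2 * (p : ℝ))) • pullForm e (formE g P) y +
      (1 / (2 * ((n : ℝ) - p))) • pullForm e (formW g P) y := rfl

omit [IsManifold (𝓡 n) ∞ V] in
theorem pullForm_eq_zero {η : ∀ x : V, TangentSpace (𝓡 n) x →L[ℝ] ℝ} {N : Set V}
    (hN : ∀ x ∈ N, η x = 0) (hsub : e.source ⊆ N) {y : Coord n} (hy : y ∈ e.target) :
    pullForm e η y = 0 := by
  have h : formAt η (e.symm y) = 0 := hN _ (hsub (e.map_target hy))
  rw [pullForm, h, ContinuousLinearMap.zero_comp]

theorem IsSeparation.differentiableOn_fst (hs : IsSeparation g P p e Ξ₁ Ξ₂ G)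
    {D : Set (Coord n)} (hD : D ⊆ e.target) : DifferentiableOn ℝ Ξ₁ D :=
  (hs.contDiff_fst.differentiableOn (by simp)).mono hD

theorem IsSeparation.differentiableOn_snd (hs : IsSeparation g P p e Ξ₁ Ξ₂ G)
    {D : Set (Coord n)} (hD : D ⊆ e.target) : DifferentiableOn ℝ Ξ₂ D :=
  (hs.contDiff_snd.differentiableOn (by simp)).mono hD

end Separation

/-! ### The five equivalences -/

section Equivalences

variable {n p : ℕ} {V : Type*} [TopologicalSpace V] [ChartedSpace (Coord n) V]
  [IsManifold (𝓡 n) ∞ V] {g : PseudoMetric n V} {P : BilinField n V} {U : Set V} {q : V}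
  {e : OpenPartialHomeomorph V (Coord n)} {Ξ₁ Ξ₂ : Coord n → ℝ} {G : CoordTensor n}

/-- `U` is an open neighbourhood of `q` on which `P` is an orthogonal projector of rank `p`, with
`0 < p < n`, and the tensor `T` vanishes. -/
structure IsUmbilicalNear (g : PseudoMetric n V) (P : BilinField n V) (p : ℕ) (U : Set V) (q : V) :
    Prop where
  pos : 0 < p
  lt : p < n
  isOpen : IsOpen U
  mem : q ∈ U
  projector : IsOrthogonalProjector g P p U
  tensorT_eq_zero : ∀ x ∈ U, ∀ a b c, tensorT g P p x a b c = 0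

namespace IsUmbilicalNear

theorem inter (h : IsUmbilicalNear g P p U q) {N : Set V} (hN : IsOpen N) (hqN : q ∈ N) :
    IsUmbilicalNear g P p (U ∩ N) q :=
  ⟨h.pos, h.lt, h.isOpen.inter hN, ⟨h.mem, hqN⟩, h.projector.mono Set.inter_subset_left,
    fun x hx => h.tensorT_eq_zero x hx.1⟩

theorem cast_ne_zero (h : IsUmbilicalNear g P p U q) : (p : ℝ) ≠ 0 := by
  exact_mod_cast h.pos.ne'

theorem sub_ne_zero (h : IsUmbilicalNear g P p U q) : (n : ℝ) - p ≠ 0 :=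
  _root_.sub_ne_zero.2 (by exact_mod_cast h.lt.ne')

/-- A separated chart is adapted to the umbilical foliations where `T` vanishes. -/
theorem isUmbilicalOn (h : IsUmbilicalNear g P p U q) (hs : IsSeparation g P p e Ξ₁ Ξ₂ G) :
    IsUmbilicalOn p (pull e g.form) (pull e P) (pullForm e (formE g P)) (pullForm e (formW g P))
      (e.target ∩ e.symm ⁻¹' U) :=
  isUmbilicalOn_pull h.pos h.lt h.isOpen h.projector h.tensorT_eq_zero hs.mem_atlas
    fun _ hy => hs.adapted hy

theorem apply_mem_preimage (h : IsUmbilicalNear g P p U q) (hq : q ∈ e.source) :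
    e q ∈ e.target ∩ e.symm ⁻¹' U :=
  ⟨e.map_source hq, by rw [Set.mem_preimage, e.left_inv hq]; exact h.mem⟩

theorem vanishesNear_formE (h : IsUmbilicalNear g P p U q) (hq : q ∈ e.source)
    (hs : IsSeparation g P p e Ξ₁ Ξ₂ G) (h1 : ∀ y ∈ e.target, Ξ₁ y = 1) :
    VanishesNear q (formE g P) := by
  have hu := h.isUmbilicalOn hs
  refine vanishesNear_of_chart hs.mem_atlas hq hu.isOpen (h.apply_mem_preimage hq) fun y hy =>
    clm_ext_basisVec fun i => ?_
  rcases lt_or_ge i.val p with hi | hi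
  · exact hu.fst_eq_zero y hy i hi
  · have hd := (hs.fderiv_fst h.pos h.lt Set.inter_subset_left hu hy).2 i hi
    have hev : Ξ₁ =ᶠ[nhds y] fun _ => 1 := by
      filter_upwards [e.open_target.mem_nhds hy.1] with z hz using h1 z hz
    rw [hev.fderiv_eq, h1 y hy.1, fderiv_fun_const, mul_one] at hd
    have hd' : 0 = -(1 / (p : ℝ)) * pullForm e (formE g P) y (basisVec i) := hd
    have hp0 := h.cast_ne_zero
    simpa [hp0] using hd'.symm

theorem vanishesNear_formW (h : IsUmbilicalNear g P p U q) (hq : q ∈ e.source)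
    (hs : IsSeparation g P p e Ξ₁ Ξ₂ G) (h1 : ∀ y ∈ e.target, Ξ₂ y = 1) :
    VanishesNear q (formW g P) := by
  have hu := h.isUmbilicalOn hs
  refine vanishesNear_of_chart hs.mem_atlas hq hu.isOpen (h.apply_mem_preimage hq) fun y hy =>
    clm_ext_basisVec fun i => ?_
  rcases lt_or_ge i.val p with hi | hi
  · have hd := (hs.fderiv_snd h.lt Set.inter_subset_left hu hy).2 i hi
    have hev : Ξ₂ =ᶠ[nhds y] fun _ => 1 := by
      filter_upwards [e.open_target.mem_nhds hy.1] with z hz using h1 z hz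
    rw [hev.fderiv_eq, h1 y hy.1, fderiv_fun_const, mul_one] at hd
    have hd' : 0 = -(1 / ((n : ℝ) - p)) * pullForm e (formW g P) y (basisVec i) := hd
    have hp0 := h.sub_ne_zero
    simpa [hp0] using hd'.symm
  · exact hu.snd_eq_zero y hy i hi

/-- A potential of `E` is `- p log |Ξ₁|`. -/
theorem exactNear_formE (h : IsUmbilicalNear g P p U q) (hq : q ∈ e.source)
    (hs : IsSeparation g P p e Ξ₁ Ξ₂ G) (h1 : DependsOnLast p e.target Ξ₁) :
    ExactNear q (formE g P) := by
  have hu := h.isUmbilicalOn hs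
  have key := fun y (hy : y ∈ e.target ∩ e.symm ⁻¹' U) =>
    hs.fderiv_fst h.pos h.lt Set.inter_subset_left hu hy
  have hd := hs.differentiableOn_fst (Set.inter_subset_left (t := e.symm ⁻¹' U))
  obtain ⟨hf, hdf⟩ := log_potential hu.isOpen (neg_ne_zero.2 (one_div_ne_zero h.cast_ne_zero))
    hd (fun y hy => (key y hy).1) (hu.contDiffOn_fst h.pos h.lt) (fun y hy i => by
      rcases lt_or_ge i.val p with hi | hi
      · rw [hu.fst_eq_zero y hy i hi, mul_zero, zero_mul]
        exact fderiv_eq_zero_of_dependsOnLast e.open_target h1 hy.1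
          ((hd y hy).differentiableAt (hu.isOpen.mem_nhds hy)) hi
      · exact (key y hy).2 i hi)
  exact exactNear_of_chart hs.mem_atlas hq hu.isOpen (h.apply_mem_preimage hq) hf hdf

/-- A potential of `W` is `- (n - p) log |Ξ₂|`. -/
theorem exactNear_formW (h : IsUmbilicalNear g P p U q) (hq : q ∈ e.source)
    (hs : IsSeparation g P p e Ξ₁ Ξ₂ G) (h1 : DependsOnFirst p e.target Ξ₂) :
    ExactNear q (formW g P) := by
  have hu := h.isUmbilicalOn hs
  have key := fun y (hy : y ∈ e.target ∩ e.symm ⁻¹' U) =>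
    hs.fderiv_snd h.lt Set.inter_subset_left hu hy
  have hd := hs.differentiableOn_snd (Set.inter_subset_left (t := e.symm ⁻¹' U))
  obtain ⟨hf, hdf⟩ := log_potential hu.isOpen (neg_ne_zero.2 (one_div_ne_zero h.sub_ne_zero))
    hd (fun y hy => (key y hy).1) (hu.contDiffOn_snd h.lt) (fun y hy i => by
      rcases lt_or_ge i.val p with hi | hi
      · exact (key y hy).2 i hi
      · rw [hu.snd_eq_zero y hy i hi, mul_zero, zero_mul]
        exact fderiv_eq_zero_of_dependsOnFirst e.open_target h1 hy.1
          ((hd y hy).differentiableAt (hu.isOpen.mem_nhds hy)) hi)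
  exact exactNear_of_chart hs.mem_atlas hq hu.isOpen (h.apply_mem_preimage hq) hf hdf

/-- If the conformal factors agree, a potential of `u` is `- log |Ξ| / 2`. -/
theorem exactNear_formU (h : IsUmbilicalNear g P p U q) (hq : q ∈ e.source)
    (hs : IsSeparation g P p e Ξ₁ Ξ₂ G) (h1 : ∀ y ∈ e.target, Ξ₁ y = Ξ₂ y) :
    ExactNear q (formU g P p) := by
  have hu := h.isUmbilicalOn hs
  have hp0 := h.cast_ne_zero
  have hnp0 := h.sub_ne_zero
  have key₁ := fun y (hy : y ∈ e.target ∩ e.symm ⁻¹' U) =>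
    hs.fderiv_fst h.pos h.lt Set.inter_subset_left hu hy
  have key₂ := fun y (hy : y ∈ e.target ∩ e.symm ⁻¹' U) =>
    hs.fderiv_snd h.lt Set.inter_subset_left hu hy
  have hd := hs.differentiableOn_fst (Set.inter_subset_left (t := e.symm ⁻¹' U))
  have hsm : ContDiffOn ℝ ∞ (pullForm e (formU g P p)) (e.target ∩ e.symm ⁻¹' U) := by
    have h2 := ((hu.contDiffOn_fst h.pos h.lt).const_smul (1 / (2 * (p : ℝ)))).add
      ((hu.contDiffOn_snd h.lt).const_smul (1 / (2 * ((n : ℝ) - p))))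
    exact h2.congr fun y _ => pullForm_formU y
  have hdΞ : ∀ y ∈ e.target ∩ e.symm ⁻¹' U, ∀ i, fderiv ℝ Ξ₁ y (basisVec i) =
      -2 * pullForm e (formU g P p) y (basisVec i) * Ξ₁ y := by
    intro y hy i
    rw [pullForm_formU]
    simp only [add_apply, smul_apply, smul_eq_mul]
    rcases lt_or_ge i.val p with hi | hi
    · have hev : Ξ₁ =ᶠ[nhds y] Ξ₂ := by
        filter_upwards [e.open_target.mem_nhds hy.1] with z hz using h1 z hz
      rw [hev.fderiv_eq, (key₂ y hy).2 i hi, hu.fst_eq_zero y hy i hi, h1 y hy.1]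
      field_simp
      ring
    · rw [(key₁ y hy).2 i hi, hu.snd_eq_zero y hy i hi]
      field_simp
      ring
  obtain ⟨hf, hdf⟩ := log_potential hu.isOpen (neg_ne_zero.2 (two_ne_zero (α := ℝ))) hd
    (fun y hy => (key₁ y hy).1) hsm hdΞ
  exact exactNear_of_chart hs.mem_atlas hq hu.isOpen (h.apply_mem_preimage hq) hf hdf

end IsUmbilicalNear

theorem fderiv_exp_mul {f : Coord n → ℝ} {y : Coord n} (hf : DifferentiableAt ℝ f y) (c : ℝ)
    (v : Coord n) : fderiv ℝ (fun z => Real.exp (c * f z)) y v =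
      c * fderiv ℝ f y v * Real.exp (c * f y) := by
  have h1 : HasFDerivAt (fun z => Real.exp (c * f z)) _ y := (hf.hasFDerivAt.const_mul c).exp
  rw [h1.fderiv]
  simp only [smul_apply, smul_eq_mul]
  ring

theorem fderiv_const_eq_zero (c : ℝ) (y v : Coord n) :
    fderiv ℝ (fun _ : Coord n => c) y v = 0 := by
  simp

namespace IsUmbilicalNear

theorem isReducibleAt (h : IsUmbilicalNear g P p U q) (hE : VanishesNear q (formE g P))
    (hW : VanishesNear q (formW g P)) : IsReducibleAt g P p q := by
  obtain ⟨N₁, hN₁, hq₁, hE⟩ := hE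
  obtain ⟨N₂, hN₂, hq₂, hW⟩ := hW
  have h' := (h.inter hN₁ hq₁).inter hN₂ hq₂
  obtain ⟨e, he, hqe, hsub, hc, hu, -⟩ :=
    exists_umbilical_chart h'.pos h'.lt h'.isOpen h'.mem h'.projector h'.tensorT_eq_zero
  obtain ⟨G, hG⟩ := exists_isSeparation (Ξ₁ := fun _ => 1) (Ξ₂ := fun _ => 1) he hc hu
    contDiffOn_const contDiffOn_const (fun _ _ => one_ne_zero) (fun _ _ => one_ne_zero)
    (fun y hy i _ => by
      rw [fderiv_const_eq_zero, pullForm_eq_zero hE (fun x hx => (hsub hx).1.2) hy]; simp)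
    (fun y hy i _ => by
      rw [fderiv_const_eq_zero, pullForm_eq_zero hW (fun x hx => (hsub hx).2) hy]; simp)
  exact ⟨e, _, _, G, hqe, hG, fun _ _ => rfl, fun _ _ => rfl⟩

/-- The conformal factor of the second leaves is `exp (- f / (n - p))`, where `W = df`. -/
theorem isWarpedAt (h : IsUmbilicalNear g P p U q) (hE : VanishesNear q (formE g P))
    (hW : ExactNear q (formW g P)) : IsWarpedAt g P p q := by
  obtain ⟨N₁, hN₁, hq₁, hE⟩ := hE
  obtain ⟨N₂, hN₂, hq₂, f, hf, hW⟩ := hW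
  have h' := (h.inter hN₁ hq₁).inter hN₂ hq₂
  obtain ⟨e, he, hqe, hsub, hc, hu, -⟩ :=
    exists_umbilical_chart h'.pos h'.lt h'.isOpen h'.mem h'.projector h'.tensorT_eq_zero
  obtain ⟨hfs, hfd⟩ := fderiv_comp_symm_of_exact he hN₂ (fun x hx => (hsub hx).2) hf hW
  have hat := fun y (hy : y ∈ e.target) =>
    (hfs.contDiffAt (e.open_target.mem_nhds hy)).differentiableAt (by simp)
  have hΞ : ContDiffOn ℝ 2 (fun y => Real.exp (-(1 / ((n : ℝ) - p)) * f (e.symm y))) e.target :=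
    ((contDiffOn_const.mul hfs).exp).of_le two_le_infty
  obtain ⟨G, hG⟩ := exists_isSeparation (Ξ₁ := fun _ => 1) he hc hu
    contDiffOn_const hΞ (fun _ _ => one_ne_zero) (fun _ _ => Real.exp_ne_zero _)
    (fun y hy i _ => by
      rw [fderiv_const_eq_zero, pullForm_eq_zero hE (fun x hx => (hsub hx).1.2) hy]; simp)
    (fun y hy i _ => by rw [fderiv_exp_mul (hat y hy), hfd y hy])
  refine ⟨e, _, _, G, hqe, hG, fun _ _ => rfl, dependsOnFirst_of_fderiv e.open_target hc
    (hΞ.differentiableOn (by simp)) fun i hi y hy => ?_⟩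
  rw [fderiv_exp_mul (hat y hy), hfd y hy, hu.snd_eq_zero y hy i hi, mul_zero, zero_mul]

/-- The conformal factors are `exp (- f₁ / p)` and `exp (- f₂ / (n - p))`, where `E = df₁` and
`W = df₂`. -/
theorem isDoubleWarpedAt (h : IsUmbilicalNear g P p U q) (hE : ExactNear q (formE g P))
    (hW : ExactNear q (formW g P)) : IsDoubleWarpedAt g P p q := by
  obtain ⟨N₁, hN₁, hq₁, f₁, hf₁, hE⟩ := hE
  obtain ⟨N₂, hN₂, hq₂, f₂, hf₂, hW⟩ := hW
  have h' := (h.inter hN₁ hq₁).inter hN₂ hq₂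
  obtain ⟨e, he, hqe, hsub, hc, hu, -⟩ :=
    exists_umbilical_chart h'.pos h'.lt h'.isOpen h'.mem h'.projector h'.tensorT_eq_zero
  obtain ⟨hfs₁, hfd₁⟩ := fderiv_comp_symm_of_exact he hN₁ (fun x hx => (hsub hx).1.2) hf₁ hE
  obtain ⟨hfs₂, hfd₂⟩ := fderiv_comp_symm_of_exact he hN₂ (fun x hx => (hsub hx).2) hf₂ hW
  have hat₁ := fun y (hy : y ∈ e.target) =>
    (hfs₁.contDiffAt (e.open_target.mem_nhds hy)).differentiableAt (by simp)
  have hat₂ := fun y (hy : y ∈ e.target) =>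
    (hfs₂.contDiffAt (e.open_target.mem_nhds hy)).differentiableAt (by simp)
  have hΞ₁ : ContDiffOn ℝ 2 (fun y => Real.exp (-(1 / (p : ℝ)) * f₁ (e.symm y))) e.target :=
    ((contDiffOn_const.mul hfs₁).exp).of_le two_le_infty
  have hΞ₂ : ContDiffOn ℝ 2 (fun y => Real.exp (-(1 / ((n : ℝ) - p)) * f₂ (e.symm y))) e.target :=
    ((contDiffOn_const.mul hfs₂).exp).of_le two_le_infty
  obtain ⟨G, hG⟩ := exists_isSeparation he hc hu
    hΞ₁ hΞ₂ (fun _ _ => Real.exp_ne_zero _) (fun _ _ => Real.exp_ne_zero _)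
    (fun y hy i _ => by rw [fderiv_exp_mul (hat₁ y hy), hfd₁ y hy])
    (fun y hy i _ => by rw [fderiv_exp_mul (hat₂ y hy), hfd₂ y hy])
  refine ⟨e, _, _, G, hqe, hG, dependsOnLast_of_fderiv e.open_target hc
    (hΞ₁.differentiableOn (by simp)) fun i hi y hy => ?_, dependsOnFirst_of_fderiv e.open_target hc
    (hΞ₂.differentiableOn (by simp)) fun i hi y hy => ?_⟩
  · rw [fderiv_exp_mul (hat₁ y hy), hfd₁ y hy, hu.fst_eq_zero y hy i hi, mul_zero, zero_mul]
  · rw [fderiv_exp_mul (hat₂ y hy), hfd₂ y hy, hu.snd_eq_zero y hy i hi, mul_zero, zero_mul]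

/-- Any component `Π_{AB}` without zeros is a conformal factor of the second leaves. -/
theorem isTwistedAt (h : IsUmbilicalNear g P p U q) (hE : VanishesNear q (formE g P)) :
    IsTwistedAt g P p q := by
  obtain ⟨N₁, hN₁, hq₁, hE⟩ := hE
  have h' := h.inter hN₁ hq₁
  obtain ⟨e, he, hqe, hsub, hc, hu, j, k, hj, hk, hne⟩ :=
    exists_umbilical_chart h'.pos h'.lt h'.isOpen h'.mem h'.projector h'.tensorT_eq_zero
  obtain ⟨G, hG⟩ := exists_isSeparation (Ξ₁ := fun _ => 1)
    (Ξ₂ := fun y => pull e g.form y (basisVec j) (basisVec k)) he hc hu contDiffOn_const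
    (((hu.contDiff_metric.clm_apply contDiffOn_const).clm_apply contDiffOn_const).of_le
      two_le_infty) (fun _ _ => one_ne_zero) hne
    (fun y hy i _ => by
      rw [fderiv_const_eq_zero, pullForm_eq_zero hE (fun x hx => (hsub hx).2) hy]; simp)
    (fun y hy i hi => by
      rw [fderiv_clm_apply₂ ((hu.contDiff_metric.contDiffAt
        (e.open_target.mem_nhds hy)).differentiableAt (by simp))]
      exact hu.fderiv_metric y hy i j k hi hj hk)
  exact ⟨e, _, _, G, hqe, hG, fun _ _ => rfl⟩

/-- The common conformal factor is `exp (- 2 f)`, where `u = df`. -/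
theorem isConformallyReducibleAt (h : IsUmbilicalNear g P p U q)
    (hu : ExactNear q (formU g P p)) : IsConformallyReducibleAt g P p q := by
  obtain ⟨N, hN, hqN, f, hf, hW⟩ := hu
  have h' := h.inter hN hqN
  have hp0 := h.cast_ne_zero
  have hnp0 := h.sub_ne_zero
  obtain ⟨e, he, hqe, hsub, hc, hu, -⟩ :=
    exists_umbilical_chart h'.pos h'.lt h'.isOpen h'.mem h'.projector h'.tensorT_eq_zero
  obtain ⟨hfs, hfd⟩ := fderiv_comp_symm_of_exact he hN (fun x hx => (hsub hx).2) hf hW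
  have hat := fun y (hy : y ∈ e.target) =>
    (hfs.contDiffAt (e.open_target.mem_nhds hy)).differentiableAt (by simp)
  have hΞ : ContDiffOn ℝ 2 (fun y => Real.exp (-2 * f (e.symm y))) e.target :=
    ((contDiffOn_const.mul hfs).exp).of_le two_le_infty
  obtain ⟨G, hG⟩ := exists_isSeparation he hc hu hΞ hΞ
    (fun _ _ => Real.exp_ne_zero _) (fun _ _ => Real.exp_ne_zero _)
    (fun y hy i hi => by
      rw [fderiv_exp_mul (hat y hy), hfd y hy, pullForm_formU]
      simp only [add_apply, smul_apply, smul_eq_mul, hu.snd_eq_zero y hy i hi]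
      field_simp
      ring)
    (fun y hy i hi => by
      rw [fderiv_exp_mul (hat y hy), hfd y hy, pullForm_formU]
      simp only [add_apply, smul_apply, smul_eq_mul, hu.fst_eq_zero y hy i hi]
      field_simp
      ring)
  exact ⟨e, _, _, G, hqe, hG, fun _ _ => rfl⟩

end IsUmbilicalNear

end Equivalences

end BiConformal

end

theorem mainTheorem2 {n p : ℕ} (hp : 0 < p) (hpn : p < n)
    {V : Type*} [TopologicalSpace V] [ChartedSpace (BiConformal.Coord n) V]
    [IsManifold (𝓡 n) ∞ V]
    (g : BiConformal.PseudoMetric n V) (P : BiConformal.BilinField n V)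
    (q : V) (U : Set V) (hU : IsOpen U) (hq : q ∈ U)
    (hP : BiConformal.IsOrthogonalProjector g P p U)
    (hT : ∀ x ∈ U, ∀ a b c, BiConformal.tensorT g P p x a b c = 0) :
    (BiConformal.IsReducibleAt g P p q ↔
      BiConformal.VanishesNear q (BiConformal.formE g P) ∧
        BiConformal.VanishesNear q (BiConformal.formW g P)) ∧
    (BiConformal.IsWarpedAt g P p q ↔
      BiConformal.VanishesNear q (BiConformal.formE g P) ∧
        BiConformal.ExactNear q (BiConformal.formW g P)) ∧
    (BiConformal.IsDoubleWarpedAt g P p q ↔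
      BiConformal.ExactNear q (BiConformal.formE g P) ∧
        BiConformal.ExactNear q (BiConformal.formW g P)) ∧
    (BiConformal.IsTwistedAt g P p q ↔
      BiConformal.VanishesNear q (BiConformal.formE g P)) ∧
    (BiConformal.IsConformallyReducibleAt g P p q ↔
      BiConformal.ExactNear q (BiConformal.formU g P p)) := by
  have h : BiConformal.IsUmbilicalNear g P p U q := ⟨hp, hpn, hU, hq, hP, hT⟩
  refine ⟨⟨?_, fun hEW => h.isReducibleAt hEW.1 hEW.2⟩,
    ⟨?_, fun hEW => h.isWarpedAt hEW.1 hEW.2⟩,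
    ⟨?_, fun hEW => h.isDoubleWarpedAt hEW.1 hEW.2⟩,
    ⟨?_, h.isTwistedAt⟩, ⟨?_, h.isConformallyReducibleAt⟩⟩
  · rintro ⟨e, Ξ₁, Ξ₂, G, hqe, hs, h₁, h₂⟩
    exact ⟨h.vanishesNear_formE hqe hs h₁, h.vanishesNear_formW hqe hs h₂⟩
  · rintro ⟨e, Ξ₁, Ξ₂, G, hqe, hs, h₁, h₂⟩
    exact ⟨h.vanishesNear_formE hqe hs h₁, h.exactNear_formW hqe hs h₂⟩
  · rintro ⟨e, Ξ₁, Ξ₂, G, hqe, hs, h₁, h₂⟩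
    exact ⟨h.exactNear_formE hqe hs h₁, h.exactNear_formW hqe hs h₂⟩
  · rintro ⟨e, Ξ₁, Ξ₂, G, hqe, hs, h₁⟩
    exact h.vanishesNear_formE hqe hs h₁
  · rintro ⟨e, Ξ₁, Ξ₂, G, hqe, hs, h₁⟩
    exact h.exactNear_formU hqe hs h₁
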